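/- **Knots.** A *knot* is a subset $K\subset\mathbb R^3$ that is the image of a topological embedding of the circle. Two subsets of $\mathbb R^3$ are *of the same type* if an ambient isotopy of $\mathbb R^3$ carries one onto the other. A knot is *tame* if it is of the same type as a simple closed polygon. A tame knot $K$ has *threefold rotational symmetry* if it is of the same type as some piecewise $C^1$ knot $L$ (a simple closed curve made of finitely many regular $C^1$ arcs meeting without cusps; in particular any smooth or polygonal knot is allowed) with $\rho(L)=L$ for some rotation $\rho$ of $\mathbb R^3$ by $120^\circ$ about a line. **The tessellation $\widetilde B_3$.** Divide each cube $\prod_{j=1}^3[m_j,m_j+1]$, $m\in\mathbb Z^3$, into $24$ pyramids (tetrahedra), each spanned by an edge of the cube, the center of a face containing this edge, and the center of the cube. Color the points of $\mathbb Z^3$ by $A$ or $B$ according to whether the sum of their coordinates is even or odd, the centers of the faces by $C$ and the centers of the cubes by $D$; every pyramid has one vertex of each color. For a pyramid $\mathcal C$ and a letter $s\in\{A,B,C,D\}$, denote by $s$ also the reflection in the plane of the face of $\mathcal C$ opposite to its vertex of color $s$. A word $s_1s_2\cdots s_k$ in these letters encodes the gallery that starts at $\mathcal C$ and whose $i$-th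 step crosses the face of the current pyramid opposite to its vertex of color $s_i$, into the adjacent pyramid (the mirror image of the current pyramid in that face); the word also stands for the isometry $w=s_1\circ s_2\circ\cdots\circ s_k$. The center of a pyramid is the centroid of its four vertices. **Proposition 3.1.** Let $K$ be a tame knot and let $\mathcal C$ be any pyramid of the tessellation $\widetilde B_3$. Then $K$ has threefold rotational symmetry if and only if there is a word $(s_1,\dots,s_k)$ in the letters $A,B,C,D$ such that the isometry $w=s_1\circ\cdots\circ s_k$ has order $3$ and the polygonal curve joining the consecutive centers of the pyramids of the gallery $$(s_1,\dots,s_k,\;s_1,\dots,s_k,\;s_1,\dots,s_k)$$ starting at $\mathcal C$ is a simple closed polygon of the same type as $K$. -/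

import Mathlib

open Set

noncomputable section

namespace ThreefoldKnots

/-- Euclidean three-space. -/
abbrev E3 := EuclideanSpace ℝ (Fin 3)

/-! ### Knots and knot types -/

/-- `K` and `L` have the same (unoriented) knot type: some ambient isotopy of space carries `K`
onto `L`. -/
def AmbientIsotopic (K L : Set E3) : Prop :=
  ∃ H : unitInterval → (E3 ≃ₜ E3),
    Continuous (fun p : unitInterval × E3 => H p.1 p.2) ∧
    H 0 = Homeomorph.refl E3 ∧ H 1 '' K = L

/-- A knot: the image of a topological embedding of the circle into space. -/
def IsKnot (K : Set E3) : Prop :=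
  ∃ f : Circle → E3, Topology.IsEmbedding f ∧ range f = K

/-- The path running along the segments from `v i` to `v (i + 1)`, `i = 0, 1, 2, …`, each in
unit time. -/
def polygonPath (v : ℕ → E3) (t : ℝ) : E3 :=
  AffineMap.lineMap (v ⌊t⌋₊) (v (⌊t⌋₊ + 1)) (Int.fract t)

/-- The polygonal curve `v 0, v 1, …, v n`, as a set of points. -/
def polygon (n : ℕ) (v : ℕ → E3) : Set E3 :=
  ⋃ i ∈ Finset.range n, segment ℝ (v i) (v (i + 1))

/-- `v 0, v 1, …, v n = v 0` is a closed polygonal curve without self-intersections. -/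
def IsSimpleClosedPolygon (n : ℕ) (v : ℕ → E3) : Prop :=
  3 ≤ n ∧ v n = v 0 ∧ InjOn (polygonPath v) (Ico 0 (n : ℝ))

/-- A tame knot: a knot with the knot type of a polygonal knot. -/
def IsTameKnot (K : Set E3) : Prop :=
  IsKnot K ∧ ∃ (n : ℕ) (v : ℕ → E3), IsSimpleClosedPolygon n v ∧ AmbientIsotopic K (polygon n v)

/-- `γ` parametrizes a simple closed curve made of `n` regular `C¹` arcs (the restrictions to the
intervals `[i, i + 1]`) that may form corners, but no cusps, where they meet. Up to an affine
change of parameter on each arc, every regular piecewise `C¹` simple closed curve without cusps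
is of this form; both smooth and polygonal knots are included. -/
structure IsPiecewiseC1Loop (n : ℕ) (γ : ℝ → E3) : Prop where
  pos : 0 < n
  periodic : ∀ t : ℝ, γ (t + n) = γ t
  injOn : InjOn γ (Ico 0 (n : ℝ))
  contDiffOn : ∀ i : ℤ, ContDiffOn ℝ 1 γ (Icc (i : ℝ) (i + 1))
  regular : ∀ i : ℤ, ∀ t ∈ Icc (i : ℝ) (i + 1), derivWithin γ (Icc (i : ℝ) (i + 1)) t ≠ 0
  /-- At `i` the outgoing direction is not opposite to the incoming one. -/
  no_cusp : ∀ i : ℤ, ¬ SameRay ℝ (derivWithin γ (Icc (i : ℝ) (i + 1)) i)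
    (-derivWithin γ (Icc ((i : ℝ) - 1) i) i)

/-- A piecewise `C¹` knot. -/
def IsPiecewiseC1Knot (L : Set E3) : Prop :=
  ∃ (n : ℕ) (γ : ℝ → E3), IsPiecewiseC1Loop n γ ∧ range γ = L

/-! ### Threefold rotational symmetry -/

/-- The rotation by the angle `θ` about the line through `o` in the direction `b 2`, where `b` is
an orthonormal basis. -/
def rotationAbout (o : E3) (b : OrthonormalBasis (Fin 3) ℝ E3) (θ : ℝ) (x : E3) : E3 :=
  o + ((inner ℝ (b 0) (x - o) * Real.cos θ - inner ℝ (b 1) (x - o) * Real.sin θ) • b 0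
    + (inner ℝ (b 0) (x - o) * Real.sin θ + inner ℝ (b 1) (x - o) * Real.cos θ) • b 1
    + inner ℝ (b 2) (x - o) • b 2)

/-- `K` has threefold rotational symmetry: its knot type has a representative that is mapped to
itself by a rotation by `120°` about some axis. -/
def HasThreefoldRotationalSymmetry (K : Set E3) : Prop :=
  ∃ L : Set E3, IsPiecewiseC1Knot L ∧ AmbientIsotopic K L ∧
    ∃ (o : E3) (b : OrthonormalBasis (Fin 3) ℝ E3),
      rotationAbout o b (2 * Real.pi / 3) '' L = L

/-! ### The tessellation of type `B̃₃` and its galleries -/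

/-- The four colors, which are also the letters of words: `A = 0`, `B = 1`, `C = 2`, `D = 3`. -/
abbrev Color := Fin 4

/-- `P` lists the vertices of colors `A, B, C, D` of one of the `24` pyramids into which a cube
`∏ⱼ [m j, m j + 1]` of the standard cubic tessellation is divided. The pyramid is spanned by an
edge `ab` of the cube, the center of a face (perpendicular to the `i`-th axis) containing that
edge, and the center of the cube. The vertices of the cubes are colored `A` and `B`
alternatingly (`A` if the sum of the coordinates is even, `B` if it is odd), the face centers are
colored `C`, the cube centers `D`. -/
def IsPyramid (P : Color → E3) : Prop :=
  ∃ (m a b : Fin 3 → ℤ) (i l : Fin 3),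
    (∀ j, a j = m j ∨ a j = m j + 1) ∧ (∀ j, b j = m j ∨ b j = m j + 1) ∧
    Even (∑ j, a j) ∧ Odd (∑ j, b j) ∧
    (∀ j, a j ≠ b j ↔ j = l) ∧ i ≠ l ∧
    (∀ j, P 0 j = a j) ∧
    (∀ j, P 1 j = b j) ∧
    (∀ j, P 2 j = if j = i then (a j : ℝ) else (m j : ℝ) + 1 / 2) ∧
    (∀ j, P 3 j = (m j : ℝ) + 1 / 2)

/-- The reflection in the plane of the face of `P` opposite to its vertex of color `s`. -/
def wallReflection (P : Color → E3) (s : Color) : E3 ≃ᵃⁱ[ℝ] E3 :=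
  EuclideanGeometry.reflection (affineSpan ℝ (range fun j : Fin 3 => P (s.succAbove j)))

/-- The pyramid on the other side of the face of `P` opposite to its vertex of color `s`: that
face is kept, and the remaining vertex is replaced by its mirror image. -/
def cross (P : Color → E3) (s : Color) : Color → E3 :=
  Function.update P s (wallReflection P s (P s))

/-- The `i`-th pyramid of the gallery that starts at `P` and crosses successively the faces
opposite to the vertices of colors `s₁, s₂, …`, the letters of `w`. -/
def galleryPyramid (P : Color → E3) (w : List Color) (i : ℕ) : Color → E3 :=
  (w.take i).foldl cross P

/-- The center of a pyramid. -/
def center (P : Color → E3) : E3 := (1 / 4 : ℝ) • ∑ s, P s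

/-- The element `s₁ ∘ s₂ ∘ ⋯ ∘ s_k` of the symmetry group that the word `w = s₁ s₂ ⋯ s_k` stands
for, the letters being the reflections in the planes of the faces of the initial pyramid `P`. -/
def wordSymmetry (P : Color → E3) (w : List Color) : E3 ≃ᵃⁱ[ℝ] E3 :=
  (w.map (wallReflection P)).prod

/-- The knot `K` is represented, from the initial pyramid `P`, by the word `w` of order three: the
symmetry given by `w` has order three and the polygonal curve joining consecutive centers of the
gallery `(w, w, w)` is a knot of the same type as `K`. -/
def IsRepresentedByWord (P : Color → E3) (w : List Color) (K : Set E3) : Prop :=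
  orderOf (wordSymmetry P w) = 3 ∧
  IsSimpleClosedPolygon (3 * w.length) (fun i => center (galleryPyramid P (w ++ w ++ w) i)) ∧
  AmbientIsotopic K
    (polygon (3 * w.length) (fun i => center (galleryPyramid P (w ++ w ++ w) i)))

end ThreefoldKnots

end

open Set

namespace ThreefoldKnots

/-! ### Ambient isotopies -/

/-! From a word to a symmetric knot: the `i`-th pyramid of a gallery is the image of the initial one
under `s₁ ∘ ⋯ ∘ sᵢ`, so the centers along `(w, w, w)` satisfy `c (i + k) = w (c i)`. Since `w³ = 1`,
the polygon of centers is mapped to itself by `w`, and an isometry of order three is a rotation by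
120° (`exists_rotationAbout_of_orderOf_eq_three`).

From a symmetric knot to a word: an orientation preserving isometry moves the axis to the line `x =
y = z`, where the rotation becomes a cyclic permutation `ρ` of the coordinates, a symmetry of the
tessellation. It lifts to the parameter line of the curve; after replacing `ρ` by `ρ²` if necessary,
the lift `φ` satisfies `φ³ (t) = t + p`, with `p` the period (`exists_equivariant_lift`). A large
multiple of the curve is approximated, equivariantly, by a polygon with vertices in `(2ℤ)³`, and its
corners are bevelled so finely that no root takes values of opposite signs on two consecutive edges:
these lie in a common closed Weyl chamber (`exists_latticeLoop`).

A large multiple of this lattice polygon is then followed by a gallery (`exists_gallery`). For every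
edge vector `F`, a minimal gallery leads from a pyramid to its translate by `F`; the walls it
crosses have normals `n` with `⟨n, F⟩ > 0`. The pyramid is kept parallel along one third of the
polygon and is turned by `ρ` at the end of the third. Hence the gallery of centers moves forward, in
a suitable direction, wherever the polygon does. One third of the gallery spells the word. An
isometry carries its first pyramid to the prescribed one; should this reverse orientation, the
gallery is started one pyramid later (`exists_word`).

Both approximations are turned into ambient isotopies by `ambientIsotopic_of_windows`: two closed
curves that stay close, and that locally increase in common directions, are joined by a linear
homotopy with uniformly Lipschitz displacement. Such a homotopy is cut into small steps, each the
restriction of a map `x + u x` with `u` a contraction of space. -/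

theorem AmbientIsotopic.refl (K : Set E3) : AmbientIsotopic K K :=
  ⟨fun _ => Homeomorph.refl E3, continuous_snd, rfl, by simp⟩

theorem AmbientIsotopic.trans {K L M : Set E3} (h : AmbientIsotopic K L)
    (h' : AmbientIsotopic L M) : AmbientIsotopic K M := by
  obtain ⟨H, hH, h0, h1⟩ := h
  obtain ⟨H', hH', h0', h1'⟩ := h'
  refine ⟨fun t => (H t).trans (H' t), hH'.comp (continuous_fst.prodMk hH), ?_, ?_⟩
  · simp only [h0, h0']; rfl
  · rw [← h1', ← h1, image_image]; rfl

/-- For `t ∈ [0, 1]` the map `x + t • u x` differs from the identity by a map with Lipschitz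
constant less than one, hence is a homeomorphism; these maps form the isotopy. -/
theorem ambientIsotopic_add_lipschitz {u : E3 → E3} {k : NNReal} (hu : LipschitzWith k u)
    (hk : k < 1) (K : Set E3) : AmbientIsotopic K ((fun x => x + u x) '' K) := by
  have key (t : unitInterval) : ∃ h : E3 ≃ₜ E3, ∀ x, h x = x + (t : ℝ) • u x := by
    have ha : ApproximatesLinearOn (fun x => x + (t : ℝ) • u x)
        ((ContinuousLinearEquiv.refl ℝ E3 : E3 ≃L[ℝ] E3) : E3 →L[ℝ] E3) univ k := by
      intro x _ y _
      have h1 : x + (t : ℝ) • u x - (y + (t : ℝ) • u y) -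
          ((ContinuousLinearEquiv.refl ℝ E3 : E3 ≃L[ℝ] E3) : E3 →L[ℝ] E3) (x - y)
          = (t : ℝ) • (u x - u y) := by
        simp [smul_sub]; abel
      rw [h1, norm_smul, Real.norm_of_nonneg t.2.1]
      have h2 := hu.norm_sub_le x y
      have h3 := norm_nonneg (u x - u y)
      nlinarith [t.2.2]
    refine ⟨ha.toHomeomorph _ (Or.inr ?_), fun x => rfl⟩
    have : ‖((ContinuousLinearEquiv.refl ℝ E3).symm : E3 →L[ℝ] E3)‖₊ ≤ 1 := by
      rw [← NNReal.coe_le_coe]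
      exact ContinuousLinearMap.norm_id_le
    refine lt_of_lt_of_le hk ?_
    rw [le_inv_comm₀ one_pos, inv_one]
    · exact this
    · have : (ContinuousLinearEquiv.refl ℝ E3).symm = ContinuousLinearEquiv.refl ℝ E3 := rfl
      rw [this, ← NNReal.coe_pos, coe_nnnorm]
      have h2 : ‖(ContinuousLinearMap.id ℝ E3)‖ = 1 := ContinuousLinearMap.norm_id
      have h3 : ((ContinuousLinearEquiv.refl ℝ E3 : E3 ≃L[ℝ] E3) : E3 →L[ℝ] E3)
        = ContinuousLinearMap.id ℝ E3 := rfl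
      rw [h3, h2]; exact one_pos
  choose H hH using key
  refine ⟨H, ?_, ?_, ?_⟩
  · simp only [hH]
    have := hu.continuous
    fun_prop
  · ext1 x; simp [hH]
  · ext y; simp [hH]

/-- A small step along a displacement field that is Lipschitz along the family is an ambient
isotopy. -/
theorem ambientIsotopic_range_add {ι : Type*} (x u : ι → E3) (k : NNReal)
    (hk : lipschitzExtensionConstant E3 * k < 1)
    (hu : ∀ i j, ‖u i - u j‖ ≤ k * ‖x i - x j‖) :
    AmbientIsotopic (range x) (range fun i => x i + u i) := by
  classical
  rcases isEmpty_or_nonempty ι with hι | hι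
  · simp only [range_eq_empty]; exact AmbientIsotopic.refl _
  -- The bound `hu` forces `u i = u j` whenever `x i = x j`, so `u` factors through `x` whichever
  -- preimage is chosen.
  let f : E3 → E3 := fun p => u (Function.invFun x p)
  have hf : ∀ i, f (x i) = u i := by
    intro i
    have h1 : x (Function.invFun x (x i)) = x i := Function.invFun_eq ⟨i, rfl⟩
    have h2 := hu (Function.invFun x (x i)) i
    rw [h1, sub_self, norm_zero, mul_zero] at h2
    exact sub_eq_zero.1 (norm_le_zero_iff.1 h2)
  have hL : LipschitzOnWith k f (range x) := by
    refine LipschitzOnWith.of_dist_le_mul ?_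
    rintro _ ⟨i, rfl⟩ _ ⟨j, rfl⟩
    rw [hf, hf, dist_eq_norm, dist_eq_norm]
    exact hu i j
  -- Extending from the range of `x` to all of space multiplies the Lipschitz constant by
  -- `lipschitzExtensionConstant E3`, which `hk` takes into account.
  obtain ⟨g, hg, hfg⟩ := hL.extend_finite_dimension
  have h := ambientIsotopic_add_lipschitz hg hk (range x)
  rw [← range_comp] at h
  convert h using 2
  funext i
  simp only [Function.comp]
  rw [← hfg ⟨i, rfl⟩, hf]

/-- The linear homotopy between two families is realized by an ambient isotopy as soon as the
displacement is Lipschitz along all intermediate families, uniformly. -/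
theorem ambientIsotopic_range_of_linear_homotopy {ι : Type*} (x y : ι → E3) (C : ℝ)
    (h : ∀ s ∈ Icc (0 : ℝ) 1, ∀ i j, ‖(y i - x i) - (y j - x j)‖ ≤
      C * ‖(1 - s) • (x i - x j) + s • (y i - y j)‖) :
    AmbientIsotopic (range x) (range y) := by
  -- One of `N` equal steps has a displacement with Lipschitz constant `|C| / N`, which remains less
  -- than one after extension.
  obtain ⟨N, hN⟩ := exists_nat_gt ((lipschitzExtensionConstant E3 : ℝ) * |C|)
  have hNpos : (0 : ℝ) < N := lt_of_le_of_lt (by positivity) hN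
  let z : ℕ → ι → E3 := fun j i => x i + ((j : ℝ) / N) • (y i - x i)
  have step : ∀ j, j ≤ N → AmbientIsotopic (range x) (range (z j)) := by
    intro j
    induction j with
    | zero => intro _; simp only [z]; simpa using AmbientIsotopic.refl _
    | succ j ih =>
      intro hj
      refine (ih (by omega)).trans ?_
      have h1 := ambientIsotopic_range_add (z j) (fun i => (1 / (N : ℝ)) • (y i - x i))
        (NNReal.mk (|C| / N) (by positivity)) ?_ ?_
      · convert h1 using 2
        funext i
        simp only [z]
        rw [add_assoc, ← add_smul]
        congr 2
        push_cast; ring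
      · rw [← NNReal.coe_lt_coe]
        push_cast
        rw [← mul_div_assoc, div_lt_one hNpos]
        exact hN
      · intro a b
        have hs : ((j : ℝ) / N) ∈ Icc (0 : ℝ) 1 := by
          refine ⟨by positivity, ?_⟩
          rw [div_le_one hNpos]
          exact_mod_cast (by omega : j ≤ N)
        have h2 := h _ hs a b
        have h3 : z j a - z j b = (1 - (j : ℝ) / N) • (x a - x b) + ((j : ℝ) / N) • (y a - y b) := by
          simp only [z]; module
        rw [← smul_sub, norm_smul, h3, NNReal.coe_mk, Real.norm_of_nonneg (by positivity)]
        have h4 := h2.trans (mul_le_mul_of_nonneg_right (le_abs_self C) (norm_nonneg _))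
        calc _ ≤ 1 / (N : ℝ) * _ := mul_le_mul_of_nonneg_left h4 (by positivity)
          _ = _ := by ring
  have h5 := step N le_rfl
  convert h5 using 2
  funext i
  simp only [z]
  rw [div_self hNpos.ne']
  simp

/-! ### Translations and linear maps of positive determinant are isotopic to the identity. -/

theorem ambientIsotopic_vadd (v : E3) (K : Set E3) :
    AmbientIsotopic K ((fun x => x + v) '' K) :=
  ambientIsotopic_add_lipschitz (u := fun _ => v) (k := 0) (LipschitzWith.const v) one_pos K

theorem ambientIsotopic_linear_of_path (A : E3 →ₗ[ℝ] E3)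
    (hA : ∀ t ∈ Icc (0 : ℝ) 1, LinearMap.det ((1 - t) • LinearMap.id + t • A) ≠ 0) (K : Set E3) :
    AmbientIsotopic K (A '' K) := by
  refine ⟨fun t => (LinearEquiv.ofIsUnitDet (v := EuclideanSpace.basisFun (Fin 3) ℝ |>.toBasis)
    (v' := EuclideanSpace.basisFun (Fin 3) ℝ |>.toBasis)
    (f := (1 - (t : ℝ)) • LinearMap.id + (t : ℝ) • A) ?_).toContinuousLinearEquiv.toHomeomorph,
    ?_, ?_, ?_⟩
  · rw [LinearMap.det_toMatrix]; exact (hA t t.2).isUnit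
  · change Continuous fun p : unitInterval × E3 => (1 - (p.1 : ℝ)) • p.2 + (p.1 : ℝ) • A p.2
    have := A.continuous_of_finiteDimensional
    fun_prop
  · ext1 x
    change (1 - ((0 : unitInterval) : ℝ)) • x + ((0 : unitInterval) : ℝ) • A x = x
    simp
  · ext y
    change (∃ x ∈ K, (1 - ((1 : unitInterval) : ℝ)) • x + ((1 : unitInterval) : ℝ) • A x = y) ↔ _
    simp

theorem ambientIsotopic_matrix_of_path (M : Matrix (Fin 3) (Fin 3) ℝ)
    (hM : ∀ t ∈ Icc (0 : ℝ) 1, ((1 - t) • (1 : Matrix (Fin 3) (Fin 3) ℝ) + t • M).det ≠ 0)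
    (K : Set E3) : AmbientIsotopic K (Matrix.toEuclideanLin M '' K) := by
  refine ambientIsotopic_linear_of_path _ (fun t ht => ?_) K
  have : (1 - t) • LinearMap.id + t • Matrix.toEuclideanLin M =
      Matrix.toEuclideanLin ((1 - t) • (1 : Matrix (Fin 3) (Fin 3) ℝ) + t • M) := by
    simp
  rw [this, Matrix.toEuclideanLin_eq_toLin_orthonormal, LinearMap.det_toLin]
  exact hM t ht

/-- The segment from the identity to a transvection consists of transvections, all of determinant
one. -/
theorem ambientIsotopic_transvections (l : List (Matrix.TransvectionStruct (Fin 3) ℝ))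
    (K : Set E3) : AmbientIsotopic K
      (Matrix.toEuclideanLin (l.map Matrix.TransvectionStruct.toMatrix).prod '' K) := by
  induction l with
  | nil => simpa using AmbientIsotopic.refl K
  | cons t l ih =>
    refine ih.trans ?_
    rw [List.map_cons, List.prod_cons]
    have h := ambientIsotopic_matrix_of_path t.toMatrix (fun s _ => ?_)
      (Matrix.toEuclideanLin (l.map Matrix.TransvectionStruct.toMatrix).prod '' K)
    · convert h using 1
      rw [image_image]
      congr 1
      funext x
      simp
    · have : (1 - s) • (1 : Matrix (Fin 3) (Fin 3) ℝ) + s • t.toMatrix =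
          Matrix.transvection t.i t.j (s * t.c) := by
        simp only [Matrix.TransvectionStruct.toMatrix, Matrix.transvection, smul_add,
          Matrix.smul_single, smul_eq_mul]
        module
      rw [this, Matrix.det_transvection_of_ne _ _ t.hij]
      exact one_ne_zero

theorem ambientIsotopic_diagonal_of_pos (D : Fin 3 → ℝ) (hD : ∀ i, 0 < D i) (K : Set E3) :
    AmbientIsotopic K (Matrix.toEuclideanLin (Matrix.diagonal D) '' K) := by
  refine ambientIsotopic_matrix_of_path _ (fun t ht => ?_) K
  have : (1 - t) • (1 : Matrix (Fin 3) (Fin 3) ℝ) + t • Matrix.diagonal D =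
      Matrix.diagonal (fun i => (1 - t) + t * D i) := by
    rw [← Matrix.diagonal_one, ← Matrix.diagonal_smul, ← Matrix.diagonal_smul,
      Matrix.diagonal_add]
    simp
  rw [this, Matrix.det_diagonal, Finset.prod_ne_zero_iff]
  intro i _
  have := hD i
  rcases eq_or_lt_of_le ht.1 with h | h
  · simp [← h]
  · have := mul_pos h this; linarith [ht.2]

theorem AmbientIsotopic.matrix_mul {A B : Matrix (Fin 3) (Fin 3) ℝ}
    (hA : ∀ K, AmbientIsotopic K (Matrix.toEuclideanLin A '' K))
    (hB : ∀ K, AmbientIsotopic K (Matrix.toEuclideanLin B '' K)) (K : Set E3) :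
    AmbientIsotopic K (Matrix.toEuclideanLin (A * B) '' K) := by
  convert (hB K).trans (hA _) using 1
  rw [image_image]
  congr 1
  funext x
  simp

/-- In the plane of the turn, the matrix is multiplication by the complex number `1 - t + t * I`,
which never vanishes. The segment from the identity to a half turn would pass through a singular
matrix, so half turns are treated as squares of quarter turns. -/
theorem det_quarter_turn_path (M : Matrix (Fin 3) (Fin 3) ℝ) (hM : M = !![0, -1, 0; 1, 0, 0; 0, 0, 1]
    ∨ M = !![0, 0, -1; 0, 1, 0; 1, 0, 0] ∨ M = !![1, 0, 0; 0, 0, -1; 0, 1, 0]) (t : ℝ) :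
    ((1 - t) • (1 : Matrix (Fin 3) (Fin 3) ℝ) + t • M).det ≠ 0 := by
  have : ((1 - t) • (1 : Matrix (Fin 3) (Fin 3) ℝ) + t • M).det = (1 - t) ^ 2 + t ^ 2 := by
    rcases hM with rfl | rfl | rfl <;> rw [Matrix.det_fin_three] <;> simp <;> ring
  rw [this]
  nlinarith [sq_nonneg (1 - 2 * t)]

/-- Either no entry is negative or exactly two are; in the second case a half turn, the square of a
quarter turn, makes all entries positive. -/
theorem ambientIsotopic_diagonal (D : Fin 3 → ℝ) (hD : 0 < ∏ i, D i) (K : Set E3) :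
    AmbientIsotopic K (Matrix.toEuclideanLin (Matrix.diagonal D) '' K) := by
  have hne : ∀ i, D i ≠ 0 := fun i hi => by
    rw [Finset.prod_eq_zero (Finset.mem_univ i) hi] at hD; exact lt_irrefl _ hD
  have habs := ambientIsotopic_diagonal_of_pos (fun i => |D i|) (fun i => abs_pos.2 (hne i))
  have turn (Q : Matrix (Fin 3) (Fin 3) ℝ)
      (hQ : Q = !![0, -1, 0; 1, 0, 0; 0, 0, 1] ∨ Q = !![0, 0, -1; 0, 1, 0; 1, 0, 0] ∨
        Q = !![1, 0, 0; 0, 0, -1; 0, 1, 0])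
      (h : Matrix.diagonal D = Q * Q * Matrix.diagonal fun i => |D i|) :
      AmbientIsotopic K (Matrix.toEuclideanLin (Matrix.diagonal D) '' K) := by
    have hQ' := ambientIsotopic_matrix_of_path Q (fun t _ => det_quarter_turn_path Q hQ t)
    rw [h]
    exact AmbientIsotopic.matrix_mul (AmbientIsotopic.matrix_mul hQ' hQ') habs K
  rw [Fin.prod_univ_three] at hD
  rcases lt_or_gt_of_ne (hne 0) with h0 | h0 <;> rcases lt_or_gt_of_ne (hne 1) with h1 | h1 <;>
    rcases lt_or_gt_of_ne (hne 2) with h2 | h2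
  · have := mul_neg_of_pos_of_neg (mul_pos_of_neg_of_neg h0 h1) h2; linarith
  · refine turn _ (Or.inl rfl) ?_
    ext i j; fin_cases i <;> fin_cases j <;>
      simp [Matrix.mul_apply, Fin.sum_univ_three, abs_of_neg, abs_of_pos, *]
  · refine turn _ (Or.inr (Or.inl rfl)) ?_
    ext i j; fin_cases i <;> fin_cases j <;>
      simp [Matrix.mul_apply, Fin.sum_univ_three, abs_of_neg, abs_of_pos, *]
  · have := mul_neg_of_neg_of_pos (mul_neg_of_neg_of_pos h0 h1) h2; linarith
  · refine turn _ (Or.inr (Or.inr rfl)) ?_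
    ext i j; fin_cases i <;> fin_cases j <;>
      simp [Matrix.mul_apply, Fin.sum_univ_three, abs_of_neg, abs_of_pos, *]
  · have := mul_neg_of_neg_of_pos (mul_neg_of_pos_of_neg h0 h1) h2; linarith
  · have := mul_neg_of_pos_of_neg (mul_pos h0 h1) h2; linarith
  · refine ambientIsotopic_diagonal_of_pos D (fun i => ?_) K
    fin_cases i <;> assumption

/-- Gaussian elimination writes the matrix as a product of transvections and a diagonal matrix of
the same determinant. -/
theorem ambientIsotopic_linear (A : E3 →ₗ[ℝ] E3) (hA : 0 < LinearMap.det A) (K : Set E3) :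
    AmbientIsotopic K (A '' K) := by
  obtain ⟨M, rfl⟩ := Matrix.toEuclideanLin.surjective A
  rw [Matrix.toEuclideanLin_eq_toLin_orthonormal, LinearMap.det_toLin] at hA
  obtain ⟨L, L', D, h⟩ := Matrix.Pivot.exists_list_transvec_mul_diagonal_mul_list_transvec M
  rw [h, Matrix.det_mul, Matrix.det_mul, Matrix.TransvectionStruct.det_toMatrix_prod,
    Matrix.TransvectionStruct.det_toMatrix_prod, Matrix.det_diagonal, one_mul, mul_one] at hA
  rw [h]
  exact AmbientIsotopic.matrix_mul (AmbientIsotopic.matrix_mul (ambientIsotopic_transvections L)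
    (ambientIsotopic_diagonal D hA)) (ambientIsotopic_transvections L') K

/-- Orientation preserving isometries are isotopic to the identity. -/
theorem ambientIsotopic_isometry (f : E3 ≃ᵃⁱ[ℝ] E3)
    (hf : 0 < LinearMap.det (f.linearIsometryEquiv.toLinearEquiv : E3 →ₗ[ℝ] E3)) (K : Set E3) :
    AmbientIsotopic K (f '' K) := by
  convert (ambientIsotopic_linear _ hf K).trans (ambientIsotopic_vadd (f 0) _) using 1
  rw [image_image]
  congr 1
  funext x
  have := f.map_vadd 0 x
  simpa using this

/-! ### Comparison of closed curves by local monotonicity -/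

/-- The three alternatives for a pair of parameters are: both curves increase at rate `κ` in a
common direction `d` along the arc between them, the same holds along the complementary arc through
the base point, or the points of `x` are `m` apart. In the first two, every convex combination of
the curves increases at rate `κ` too, so its points are at least `κ * l / D` apart for arc length
`l`, while the displacements differ by at most `2 * K * l`. In the third, displacements of size `m /
4` leave a distance of at least `m / 2`. So the displacement is uniformly Lipschitz along the linear
homotopy, and `y` is injective for the same reasons. -/
theorem ambientIsotopic_of_windows (x y : ℝ → E3) {p κ K D m : ℝ} (hκ : 0 < κ) (hK : 0 ≤ K)
    (hD : 0 ≤ D) (hm : 0 < m)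
    (hx : ∀ u, 0 ≤ u → x (u + p) = x u) (hy : ∀ u, 0 ≤ u → y (u + p) = y u)
    (hxL : ∀ u u', 0 ≤ u → u ≤ u' → ‖x u' - x u‖ ≤ K * (u' - u))
    (hyL : ∀ u u', 0 ≤ u → u ≤ u' → ‖y u' - y u‖ ≤ K * (u' - u))
    (hclose : ∀ u, 0 ≤ u → ‖y u - x u‖ ≤ m / 4)
    (h : ∀ u u', 0 ≤ u → u < u' → u' < p →
      (∃ d : E3, ‖d‖ ≤ D ∧ κ * (u' - u) ≤ inner ℝ (x u' - x u) d ∧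
        κ * (u' - u) ≤ inner ℝ (y u' - y u) d) ∨
      (∃ d : E3, ‖d‖ ≤ D ∧ κ * (u + p - u') ≤ inner ℝ (x (u + p) - x u') d ∧
        κ * (u + p - u') ≤ inner ℝ (y (u + p) - y u') d) ∨
      m ≤ ‖x u' - x u‖) :
    AmbientIsotopic (x '' Ico 0 p) (y '' Ico 0 p) ∧ InjOn y (Ico 0 p) := by
  -- The first summand serves pairs on a short arc, the second one distant pairs.
  set C : ℝ := 2 * K * D / κ + 1 with hC
  have hC1 : 1 ≤ C := by
    have : 0 ≤ 2 * K * D / κ := by positivity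
    linarith
  have near (a b a' b' d : E3) (l : ℝ) (hl : 0 ≤ l) (hd : ‖d‖ ≤ D)
      (h1 : κ * l ≤ inner ℝ (b - a) d) (h2 : κ * l ≤ inner ℝ (b' - a') d)
      (h3 : ‖b - a‖ ≤ K * l) (h4 : ‖b' - a'‖ ≤ K * l) (s : ℝ) (hs : s ∈ Icc (0 : ℝ) 1) :
      ‖(b' - b) - (a' - a)‖ ≤ C * ‖(1 - s) • (b - a) + s • (b' - a')‖ := by
    set q := (1 - s) • (b - a) + s • (b' - a') with hq
    have h5 : κ * l ≤ inner ℝ q d := by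
      rw [hq, inner_add_left, inner_smul_left, inner_smul_left]
      simp only [conj_trivial]
      nlinarith [mul_le_mul_of_nonneg_left h1 (sub_nonneg.2 hs.2),
        mul_le_mul_of_nonneg_left h2 hs.1]
    have h6 : κ * l ≤ ‖q‖ * D :=
      (h5.trans (real_inner_le_norm q d)).trans (mul_le_mul_of_nonneg_left hd (norm_nonneg _))
    have h7 : ‖(b' - b) - (a' - a)‖ ≤ 2 * K * l := by
      have : (b' - b) - (a' - a) = (b' - a') - (b - a) := by abel
      rw [this]
      linarith [norm_sub_le (b' - a') (b - a)]
    have h8 : 2 * K * l ≤ 2 * K * D / κ * ‖q‖ := by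
      rw [div_mul_eq_mul_div, le_div_iff₀ hκ]
      nlinarith [mul_le_mul_of_nonneg_left h6 (by positivity : (0 : ℝ) ≤ 2 * K)]
    nlinarith [norm_nonneg q]
  have far (a b a' b' : E3) (h1 : m ≤ ‖b - a‖) (h2 : ‖a' - a‖ ≤ m / 4) (h3 : ‖b' - b‖ ≤ m / 4)
      (s : ℝ) (hs : s ∈ Icc (0 : ℝ) 1) :
      ‖(b' - b) - (a' - a)‖ ≤ C * ‖(1 - s) • (b - a) + s • (b' - a')‖ := by
    have h4 : ‖(b' - b) - (a' - a)‖ ≤ m / 2 := by linarith [norm_sub_le (b' - b) (a' - a)]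
    have h5 : b - a = ((1 - s) • (b - a) + s • (b' - a')) - s • ((b' - b) - (a' - a)) := by
      module
    have h6 : ‖s • ((b' - b) - (a' - a))‖ ≤ m / 2 := by
      rw [norm_smul, Real.norm_of_nonneg hs.1]
      nlinarith [hs.2, norm_nonneg ((b' - b) - (a' - a)), hs.1]
    have h7 : m / 2 ≤ ‖(1 - s) • (b - a) + s • (b' - a')‖ := by
      have := norm_sub_le ((1 - s) • (b - a) + s • (b' - a')) (s • ((b' - b) - (a' - a)))
      rw [← h5] at this
      linarith
    nlinarith [norm_nonneg ((1 - s) • (b - a) + s • (b' - a'))]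
  have pair (s : ℝ) (hs : s ∈ Icc (0 : ℝ) 1) (u u' : ℝ) (hu : 0 ≤ u) (huu : u < u') (hup : u' < p) :
      ‖(y u' - x u') - (y u - x u)‖ ≤ C * ‖(1 - s) • (x u' - x u) + s • (y u' - y u)‖ := by
    rcases h u u' hu huu hup with ⟨d, hd, h1, h2⟩ | ⟨d, hd, h1, h2⟩ | h1
    · exact near _ _ _ _ d _ (by linarith) hd h1 h2 (hxL _ _ hu huu.le) (hyL _ _ hu huu.le) s hs
    · have h3 := near _ _ _ _ d _ (by linarith) hd h1 h2
        (hxL u' (u + p) (by linarith) (by linarith)) (hyL u' (u + p) (by linarith) (by linarith)) s hs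
      rw [hx u hu, hy u hu] at h3
      rw [norm_sub_rev, ← norm_neg ((1 - s) • (x u' - x u) + s • (y u' - y u))]
      rwa [show -((1 - s) • (x u' - x u) + s • (y u' - y u)) =
        (1 - s) • (x u - x u') + s • (y u - y u') by module]
    · exact far _ _ _ _ h1 (hclose u hu) (hclose u' (by linarith)) s hs
  refine ⟨?_, ?_⟩
  · have := ambientIsotopic_range_of_linear_homotopy (fun u : Ico (0 : ℝ) p => x u)
      (fun u : Ico (0 : ℝ) p => y u) C ?_
    · rwa [image_eq_range, image_eq_range]
    · rintro s hs ⟨u, hu⟩ ⟨u', hu'⟩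
      dsimp only
      rcases lt_trichotomy u u' with hlt | rfl | hlt
      · have := pair s hs u u' hu.1 hlt hu'.2
        rw [norm_sub_rev, ← norm_neg ((1 - s) • (x u - x u') + s • (y u - y u'))]
        rwa [show -((1 - s) • (x u - x u') + s • (y u - y u')) =
          (1 - s) • (x u' - x u) + s • (y u' - y u) by module]
      · simp
      · exact pair s hs u' u hu'.1 hlt hu.2
  · have ne (u u' : ℝ) (hu : 0 ≤ u) (huu : u < u') (hup : u' < p) : y u ≠ y u' := by
      intro he
      rcases h u u' hu huu hup with ⟨d, hd, h1, h2⟩ | ⟨d, hd, h1, h2⟩ | h1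
      · rw [he, sub_self, inner_zero_left] at h2
        nlinarith
      · rw [hy u hu, he, sub_self, inner_zero_left] at h2
        nlinarith
      · have h2 := hclose u hu
        have h3 := hclose u' (by linarith)
        rw [he] at h2
        have h4 : x u' - x u = (y u' - x u) - (y u' - x u') := by abel
        rw [h4] at h1
        linarith [norm_sub_le (y u' - x u) (y u' - x u')]
    intro u hu u' hu' he
    rcases lt_trichotomy u u' with hlt | h1 | hlt
    · exact absurd he (ne _ _ hu.1 hlt hu'.2)
    · exact h1
    · exact absurd he.symm (ne _ _ hu'.1 hlt hu.2)

/-! ### Piecewise linear interpolation -/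

section Interpolation

variable {V W : Type*} [NormedAddCommGroup V] [NormedSpace ℝ V] [NormedAddCommGroup W]
  [NormedSpace ℝ W]

/-- The piecewise linear function with the value `a i` at `i`. -/
noncomputable def interp (a : ℕ → V) (t : ℝ) : V :=
  a ⌊t⌋₊ + (t - ⌊t⌋₊) • (a (⌊t⌋₊ + 1) - a ⌊t⌋₊)

theorem polygonPath_eq_interp (v : ℕ → E3) {t : ℝ} (ht : 0 ≤ t) :
    polygonPath v t = interp v t := by
  have : Int.fract t = t - ⌊t⌋₊ := by rw [Int.fract, ← natCast_floor_eq_intCast_floor ht]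
  rw [polygonPath, interp, this, AffineMap.lineMap_apply]
  simp [add_comm]

theorem interp_natCast (a : ℕ → V) (k : ℕ) : interp a k = a k := by simp [interp]

theorem interp_of_mem (a : ℕ → V) {k : ℕ} {t : ℝ} (h : (k : ℝ) ≤ t) (h' : t ≤ k + 1) :
    interp a t = a k + (t - k) • (a (k + 1) - a k) := by
  rcases eq_or_lt_of_le h' with rfl | h'
  · have := interp_natCast a (k + 1)
    push_cast at this
    rw [this]; simp
  · have : ⌊t⌋₊ = k := by
      rw [Nat.floor_eq_iff (le_trans (Nat.cast_nonneg k) h)]; exact ⟨h, h'⟩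
    rw [interp, this]

theorem map_interp (f : V →ᵃ[ℝ] W) (a : ℕ → V) (t : ℝ) :
    f (interp a t) = interp (fun i => f (a i)) t := by
  have h (p q : V) (c : ℝ) : f (p + c • (q - p)) = f p + c • (f q - f p) := by
    have := f.apply_lineMap p q c
    rw [AffineMap.lineMap_apply, AffineMap.lineMap_apply] at this
    simpa [add_comm] using this
  simp only [interp, h]

theorem interp_shift (a : ℕ → V) (n : ℕ) {t : ℝ} (ht : 0 ≤ t) :
    interp a (t + n) = interp (fun i => a (i + n)) t := by
  rw [interp, interp, Nat.floor_add_natCast ht]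
  push_cast
  rw [add_sub_add_right_eq_sub, add_right_comm]

theorem norm_interp_sub_le (a : ℕ → V) {K : ℝ} (hK : ∀ i, ‖a (i + 1) - a i‖ ≤ K) {u u' : ℝ}
    (hu : 0 ≤ u) (huu : u ≤ u') : ‖interp a u' - interp a u‖ ≤ K * (u' - u) := by
  have hK0 : 0 ≤ K := (norm_nonneg _).trans (hK 0)
  have cell (k : ℕ) (s s' : ℝ) (h1 : (k : ℝ) ≤ s) (h2 : s ≤ s') (h3 : s' ≤ k + 1) :
      ‖interp a s' - interp a s‖ ≤ K * (s' - s) := by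
    rw [interp_of_mem a h1 (h2.trans h3), interp_of_mem a (h1.trans h2) h3]
    have : a k + (s' - k) • (a (k + 1) - a k) - (a k + (s - k) • (a (k + 1) - a k)) =
      (s' - s) • (a (k + 1) - a k) := by module
    rw [this, norm_smul, Real.norm_of_nonneg (by linarith), mul_comm]
    exact mul_le_mul_of_nonneg_right (hK k) (by linarith)
  have upto (n : ℕ) : ∀ s s' : ℝ, 0 ≤ s → s ≤ s' → s' ≤ n →
      ‖interp a s' - interp a s‖ ≤ K * (s' - s) := by
    induction n with
    | zero =>
      intro s s' h1 h2 h3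
      have : s' = s := by push_cast at h3; linarith
      simp [this]
    | succ n ih =>
      intro s s' h1 h2 h3
      push_cast at h3
      rcases le_total s' n with h | h
      · exact ih s s' h1 h2 h
      · rcases le_total s n with h' | h'
        · have e1 := ih s n h1 h' le_rfl
          have e2 := cell n n s' le_rfl h h3
          have := norm_add_le (interp a s' - interp a n) (interp a n - interp a s)
          rw [sub_add_sub_cancel] at this
          linarith
        · exact cell n s s' h' h2 h3
  exact upto ⌈u'⌉₊ u u' hu huu (Nat.le_ceil u')

/-- The slope is required only on the unit cells that meet the interval from `u` to `u'`; this
locality is what makes the estimate usable with a direction valid for a few edges only. -/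
theorem le_interp_sub (a : ℕ → ℝ) {κ : ℝ} {u u' : ℝ}
    (hκ : ∀ i : ℕ, ⌊u⌋₊ ≤ i → (i : ℝ) < u' → κ ≤ a (i + 1) - a i)
    (hu : 0 ≤ u) (huu : u ≤ u') : κ * (u' - u) ≤ interp a u' - interp a u := by
  have cell (k : ℕ) (s s' : ℝ) (h1 : (k : ℝ) ≤ s) (h2 : s ≤ s') (h3 : s' ≤ k + 1)
      (hk : κ ≤ a (k + 1) - a k) :
      κ * (s' - s) ≤ interp a s' - interp a s := by
    rw [interp_of_mem a h1 (h2.trans h3), interp_of_mem a (h1.trans h2) h3]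
    simp only [smul_eq_mul]
    nlinarith
  have upto (n : ℕ) : ∀ s s' : ℝ, u ≤ s → s ≤ s' → s' ≤ n → s' ≤ u' →
      κ * (s' - s) ≤ interp a s' - interp a s := by
    induction n with
    | zero =>
      intro s s' h1 h2 h3 h4
      have : s' = s := by push_cast at h3; linarith
      simp [this]
    | succ n ih =>
      intro s s' h1 h2 h3 h4
      push_cast at h3
      rcases le_total s' n with h | h
      · exact ih s s' h1 h2 h h4
      · rcases eq_or_lt_of_le h with h0 | h0
        · exact ih s s' h1 h2 h0.symm.le h4
        rcases le_total s n with h' | h'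
        · have e1 := ih s n h1 h' le_rfl (by linarith)
          have e2 := cell n n s' le_rfl h h3 (hκ n (by
            have : (⌊u⌋₊ : ℝ) ≤ n := (Nat.floor_le hu).trans (h1.trans h')
            exact_mod_cast this) (by linarith))
          linarith
        · rcases lt_or_ge n ⌊u⌋₊ with h5 | h5
          · have : ((n + 1 : ℕ) : ℝ) ≤ u := (Nat.cast_le.2 h5).trans (Nat.floor_le hu)
            push_cast at this
            have : s' = s := by linarith
            simp [this]
          · exact cell n s s' h' h2 h3 (hκ n h5 (by linarith))
  exact upto ⌈u'⌉₊ u u' le_rfl huu (Nat.le_ceil u') le_rfl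

theorem le_inner_interp_sub (a : ℕ → E3) (d : E3) {κ : ℝ} {u u' : ℝ}
    (hκ : ∀ i : ℕ, ⌊u⌋₊ ≤ i → (i : ℝ) < u' → κ ≤ inner ℝ (a (i + 1) - a i) d)
    (hu : 0 ≤ u) (huu : u ≤ u') :
    κ * (u' - u) ≤ inner ℝ (interp a u' - interp a u) d := by
  have e (t : ℝ) : inner ℝ (interp a t) d = interp (fun i => inner ℝ (a i) d) t := by
    simp only [interp, inner_add_left, inner_smul_left, inner_sub_left, conj_trivial, smul_eq_mul]
  rw [inner_sub_left, e, e]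
  refine le_interp_sub _ (fun i h1 h2 => ?_) hu huu
  rw [← inner_sub_left]
  exact hκ i h1 h2

theorem polygon_eq_image_interp (n : ℕ) (v : ℕ → E3) (hn : 0 < n) (hv : v n = v 0) :
    polygon n v = interp v '' Ico 0 (n : ℝ) := by
  ext x
  simp only [polygon, mem_iUnion, Finset.mem_range, segment_eq_image', mem_image, exists_prop]
  constructor
  · rintro ⟨i, hi, s, hs, rfl⟩
    have hval : v i + s • (v (i + 1) - v i) = interp v (i + s) := by
      rw [interp_of_mem v (k := i) (by linarith [hs.1]) (by linarith [hs.2])]; simp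
    rcases eq_or_lt_of_le hs.2 with h | h
    · rcases Nat.lt_or_ge (i + 1) n with h' | h'
      · exact ⟨i + s, ⟨by linarith [hs.1, (Nat.cast_nonneg i : (0 : ℝ) ≤ i)], by
          rw [h]; exact_mod_cast h'⟩, hval.symm⟩
      · have : i + 1 = n := by omega
        refine ⟨0, ⟨le_rfl, by exact_mod_cast hn⟩, ?_⟩
        have h0 := interp_natCast v 0
        push_cast at h0
        rw [h0, ← hv, h, ← this]; simp
    · refine ⟨i + s, ⟨by linarith [hs.1, (Nat.cast_nonneg i : (0 : ℝ) ≤ i)], ?_⟩, hval.symm⟩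
      have : (i : ℝ) + 1 ≤ n := by exact_mod_cast hi
      linarith
  · rintro ⟨t, ht, rfl⟩
    exact ⟨⌊t⌋₊, (Nat.floor_lt ht.1).2 ht.2, t - ⌊t⌋₊,
      ⟨sub_nonneg.2 (Nat.floor_le ht.1), by linarith [Nat.lt_floor_add_one t]⟩, rfl⟩

theorem strictMonoOn_interp {a : ℕ → ℝ} (ha : StrictMono a) : StrictMonoOn (interp a) (Ici 0) := by
  intro u hu u' hu' h
  obtain ⟨κ, hκ, hκ'⟩ : ∃ κ > 0, ∀ i < ⌈u'⌉₊ + 1, κ ≤ a (i + 1) - a i := by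
    have hne : (Finset.range (⌈u'⌉₊ + 1)).Nonempty := ⟨0, by simp⟩
    refine ⟨(Finset.range (⌈u'⌉₊ + 1)).inf' hne fun i => a (i + 1) - a i, ?_, ?_⟩
    · rw [gt_iff_lt, Finset.lt_inf'_iff]
      intro i _
      exact sub_pos.2 (ha (Nat.lt_succ_self i))
    · intro i hi
      exact Finset.inf'_le _ (Finset.mem_range.2 hi)
  have := le_interp_sub a (κ := κ) (u := u) (u' := u') (fun i _ h2 => hκ' i (by
    have := Nat.lt_ceil.2 h2; omega)) hu h.le
  have h2 : 0 < κ * (u' - u) := mul_pos hκ (by linarith)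
  linarith

theorem interp_image_Ico {a : ℕ → ℝ} (ha : StrictMono a) (n : ℕ) :
    interp a '' Ico 0 (n : ℝ) = Ico (a 0) (a n) := by
  have h0 := interp_natCast a 0
  have hn := interp_natCast a n
  push_cast at h0
  have hmono := strictMonoOn_interp ha
  apply Subset.antisymm
  · rintro _ ⟨t, ht, rfl⟩
    refine ⟨?_, ?_⟩
    · rw [← h0]; exact hmono.monotoneOn (mem_Ici.2 le_rfl) ht.1 ht.1
    · rw [← hn]; exact hmono ht.1 (mem_Ici.2 (Nat.cast_nonneg n)) ht.2
  · intro s hs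
    obtain ⟨k, hk, hk'⟩ : ∃ k, a k ≤ s ∧ s < a (k + 1) := by
      have hex : ∃ k, s < a k := ⟨n, hs.2⟩
      classical
      have h1 := Nat.find_spec hex
      have h2 : Nat.find hex ≠ 0 := fun h => by rw [h] at h1; exact absurd hs.1 (not_le.2 h1)
      obtain ⟨k, hk⟩ := Nat.exists_eq_succ_of_ne_zero h2
      exact ⟨k, not_lt.1 (Nat.find_min hex (m := k) (by omega)), by rw [hk] at h1; exact h1⟩
    have hd : 0 < a (k + 1) - a k := sub_pos.2 (ha (Nat.lt_succ_self k))
    have q0 : 0 ≤ (s - a k) / (a (k + 1) - a k) := div_nonneg (by linarith) hd.le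
    have q1 : (s - a k) / (a (k + 1) - a k) < 1 := by rw [div_lt_one hd]; linarith
    have hkn : k < n := by
      by_contra h
      exact absurd (ha.monotone (not_lt.1 h)) (not_le.2 (hk.trans_lt hs.2))
    refine ⟨k + (s - a k) / (a (k + 1) - a k), ⟨by positivity, ?_⟩, ?_⟩
    · have : (k : ℝ) + 1 ≤ n := by exact_mod_cast hkn
      linarith
    · rw [interp_of_mem a (k := k) (by linarith) (by linarith), add_sub_cancel_left, smul_eq_mul,
        div_mul_cancel₀ _ hd.ne']
      ring

end Interpolation

/-! ### Isometries of order three are rotations -/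

theorem isometry_apply (w : E3 ≃ᵃⁱ[ℝ] E3) (x : E3) : w x = w.linearIsometryEquiv x + w 0 := by
  simpa using w.map_vadd 0 x

theorem isometry_sub (w : E3 ≃ᵃⁱ[ℝ] E3) (x y : E3) :
    w x - w y = w.linearIsometryEquiv (x - y) := by
  rw [isometry_apply w x, isometry_apply w y, map_sub]; abel

/-- The vector `A² y + A y + y` is always fixed. If it vanished for all `y`, then `(2 A + 1)² = -3`,
so a square of a real determinant would equal `(-3)³`. -/
theorem exists_fixed_of_cube (A : E3 ≃ₗᵢ[ℝ] E3) (hA : ∀ x, A (A (A x)) = x) :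
    ∃ e : E3, ‖e‖ = 1 ∧ A e = e := by
  by_cases h : ∀ y, A (A y) + A y + y = 0
  · exfalso
    let B : E3 →ₗ[ℝ] E3 := (2 : ℝ) • (A.toLinearEquiv : E3 →ₗ[ℝ] E3) + LinearMap.id
    have hB : B * B = (-3 : ℝ) • LinearMap.id := by
      ext1 y
      have h1 : A (A y) = -(A y) - y := by
        have := h y
        rw [← sub_eq_zero, ← this]; abel
      simp only [B, Module.End.mul_apply, LinearMap.add_apply, LinearMap.smul_apply,
        LinearMap.id_apply, LinearEquiv.coe_coe, LinearIsometryEquiv.coe_toLinearEquiv, map_add,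
        map_smul, h1]
      module
    have h2 := congrArg LinearMap.det hB
    rw [map_mul, LinearMap.det_smul, LinearMap.det_id] at h2
    simp at h2
    nlinarith [mul_self_nonneg (LinearMap.det B)]
  · push Not at h
    obtain ⟨y, hy⟩ := h
    refine ⟨(‖A (A y) + A y + y‖⁻¹) • (A (A y) + A y + y), ?_, ?_⟩
    · rw [norm_smul, norm_inv, norm_norm, inv_mul_cancel₀ (norm_ne_zero_iff.2 hy)]
    · rw [map_smul, map_add, map_add, hA]
      congr 1; abel

theorem exists_rotationAbout_of_orderOf_eq_three (w : E3 ≃ᵃⁱ[ℝ] E3) (hw : orderOf w = 3) :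
    ∃ (o : E3) (b : OrthonormalBasis (Fin 3) ℝ E3),
      ∀ x, w x = rotationAbout o b (2 * Real.pi / 3) x := by
  set A := w.linearIsometryEquiv with hAdef
  set c := w 0 with hc
  have hwx : ∀ x, w x = A x + c := isometry_apply w
  have hw3 : ∀ x, w (w (w x)) = x := by
    intro x
    have h := pow_orderOf_eq_one w
    rw [hw] at h
    have h2 := congrArg (fun f : E3 ≃ᵃⁱ[ℝ] E3 => f x) h
    simpa [pow_succ] using h2
  have hc0 : A (A c) + A c + c = 0 := by
    have := hw3 0
    simpa [hwx] using this
  have hA3 : ∀ x, A (A (A x)) = x := by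
    intro x
    have := hw3 x
    simp only [hwx, map_add] at this
    have e : A (A (A x)) + A (A c) + A c + c = A (A (A x)) + (A (A c) + A c + c) := by abel
    rw [e, hc0, add_zero] at this
    exact this
  -- The centroid of the orbit `0, c, A c + c` of the origin is a fixed point of `w`.
  set o : E3 := (1 / 3 : ℝ) • ((2 : ℝ) • c + A c) with ho
  have hoc : c = o - A o := by
    have e : A (A c) = -(A c) - c := by rw [← sub_eq_zero, ← hc0]; abel
    rw [ho, map_smul, map_add, map_smul, e]
    module
  have hwo : ∀ x, w x = o + A (x - o) := by
    intro x; rw [hwx, map_sub]; nth_rewrite 1 [hoc]; abel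
  -- A normalized difference `A x - x` is orthogonal to all fixed vectors, and its orbit under `A`
  -- sums to zero.
  obtain ⟨v, hv1, hv3, hvn⟩ : ∃ v : E3, ‖v‖ = 1 ∧ A (A v) = -(A v) - v ∧
      ∀ e, A e = e → inner ℝ v e = 0 := by
    have : ∃ x, A x ≠ x := by
      by_contra hcon
      push Not at hcon
      have h1 : w = 1 := by ext1 x; rw [hwo, hcon]; simp
      rw [h1, orderOf_one] at hw
      omega
    obtain ⟨x, hx⟩ := this
    refine ⟨‖A x - x‖⁻¹ • (A x - x), ?_, ?_, ?_⟩
    · rw [norm_smul, norm_inv, norm_norm, inv_mul_cancel₀ (norm_ne_zero_iff.2 (sub_ne_zero.2 hx))]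
    · simp only [map_sub, hA3, map_smul]; module
    · intro e he
      rw [inner_smul_left, inner_sub_left]
      nth_rewrite 1 [← he]
      rw [A.inner_map_map, sub_self, mul_zero]
  obtain ⟨e, hen, he⟩ := exists_fixed_of_cube A hA3
  have hnA : ‖A v‖ = 1 := (A.norm_map v).trans hv1
  have hip : inner ℝ v (A v) = (-(1 / 2) : ℝ) := by
    have h1 : ‖A (A v)‖ ^ 2 = ‖A v + v‖ ^ 2 := by
      rw [hv3, ← norm_neg]; congr 2; abel
    rw [A.norm_map, norm_add_sq_real, hnA, hv1, real_inner_comm] at h1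
    linarith
  have hve : inner ℝ v e = 0 := hvn e he
  -- Since `⟨v, A v⟩ = -1/2`, this is the component of `A v` orthogonal to `v`. Taking it as the
  -- second axis makes the angle `+120°`, whatever the orientation of the frame.
  obtain ⟨u, hu⟩ : ∃ u, u = A v + (1 / 2 : ℝ) • v := ⟨_, rfl⟩
  have hvu : inner ℝ v u = 0 := by
    rw [hu, inner_add_right, inner_smul_right, hip, real_inner_self_eq_norm_sq, hv1]; norm_num
  have huu : inner ℝ u u = (3 / 4 : ℝ) := by
    nth_rewrite 1 [hu]
    rw [inner_add_left, inner_smul_left, hvu, hu, inner_add_right, inner_smul_right,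
      real_inner_self_eq_norm_sq, hnA, real_inner_comm, hip]; norm_num
  have hue : inner ℝ u e = 0 := by
    rw [hu, inner_add_left, inner_smul_left, hve]
    nth_rewrite 1 [← he]
    rw [A.inner_map_map, hve]; simp
  have huv : inner ℝ u v = 0 := by rw [real_inner_comm]; exact hvu
  have hev : inner ℝ e v = 0 := by rw [real_inner_comm]; exact hve
  have heu : inner ℝ e u = 0 := by rw [real_inner_comm]; exact hue
  set q := Real.sqrt 3 with hq
  have hq2 : q ^ 2 = 3 := Real.sq_sqrt (by norm_num)
  have hq0 : 0 < q := Real.sqrt_pos.2 (by norm_num)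
  have hAv : A v = u - (1 / 2 : ℝ) • v := by rw [hu]; abel
  have hAu : A u = -(1 / 2 : ℝ) • u - (3 / 4 : ℝ) • v := by
    rw [hu, map_add, map_smul, hv3, hAv, hu]; module
  have hun : ‖(2 / q) • u‖ = 1 := by
    rw [← sq_eq_sq₀ (norm_nonneg _) zero_le_one, ← real_inner_self_eq_norm_sq, inner_smul_left,
      inner_smul_right, huu, conj_trivial]
    field_simp
    linarith
  let f : Fin 3 → E3 := ![v, (2 / q) • u, e]
  have hf : Orthonormal ℝ f := by
    refine ⟨fun i => ?_, fun i j hij => ?_⟩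
    · fin_cases i
      · exact hv1
      · exact hun
      · exact hen
    · fin_cases i <;> fin_cases j <;> first
        | exact absurd rfl hij
        | simp [f, inner_smul_left, inner_smul_right, hve, hev, hvu, huv, hue, heu]
  have hspan : ⊤ ≤ Submodule.span ℝ (range f) := by
    have h1 := (basisOfOrthonormalOfCardEqFinrank hf (by simp)).span_eq
    rw [coe_basisOfOrthonormalOfCardEqFinrank] at h1
    exact h1.ge
  refine ⟨o, OrthonormalBasis.mk hf hspan, fun x => ?_⟩
  have hcos : Real.cos (2 * Real.pi / 3) = -(1 / 2) := by
    rw [show 2 * Real.pi / 3 = Real.pi - Real.pi / 3 by ring, Real.cos_pi_sub,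
      Real.cos_pi_div_three]
  have hsin : Real.sin (2 * Real.pi / 3) = q / 2 := by
    rw [show 2 * Real.pi / 3 = Real.pi - Real.pi / 3 by ring, Real.sin_pi_sub,
      Real.sin_pi_div_three]
  have hz : x - o = inner ℝ (f 0) (x - o) • f 0 + inner ℝ (f 1) (x - o) • f 1 +
      inner ℝ (f 2) (x - o) • f 2 := by
    have := (OrthonormalBasis.mk hf hspan).sum_repr' (x - o)
    rw [Fin.sum_univ_three, OrthonormalBasis.coe_mk] at this
    exact this.symm
  rw [hwo, rotationAbout, hcos, hsin, OrthonormalBasis.coe_mk]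
  congr 1
  nth_rewrite 1 [hz]
  generalize inner ℝ (f 0) (x - o) = s0
  generalize inner ℝ (f 1) (x - o) = s1
  generalize inner ℝ (f 2) (x - o) = s2
  simp only [f, Matrix.cons_val_zero, Matrix.cons_val_one, Matrix.cons_val, map_add, map_smul, he,
    hAv, hAu]
  match_scalars
  · field_simp
  · field_simp; linear_combination (4 * s1) * hq2
  · ring

/-! ### Simple closed polygons are piecewise `C¹` knots -/

theorem exists_int_of_eq {γ : ℝ → E3} {p : ℝ} (hp : 0 < p) (hper : Function.Periodic γ p)
    (hinj : InjOn γ (Ico 0 p)) {a b : ℝ} (h : γ a = γ b) : ∃ z : ℤ, a - b = z * p := by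
  have h1 (t : ℝ) : γ (toIcoMod hp 0 t) = γ t := by
    have := self_sub_toIcoMod hp 0 t
    rw [show toIcoMod hp 0 t = t - toIcoDiv hp 0 t • p by rw [← this]; abel]
    exact hper.sub_zsmul_eq _
  have h2 : toIcoMod hp 0 a = toIcoMod hp 0 b :=
    hinj (toIcoMod_mem_Ico' hp a) (toIcoMod_mem_Ico' hp b) (by rw [h1, h1, h])
  refine ⟨toIcoDiv hp 0 a - toIcoDiv hp 0 b, ?_⟩
  have ha := self_sub_toIcoMod hp 0 a
  have hb := self_sub_toIcoMod hp 0 b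
  rw [zsmul_eq_mul] at ha hb
  push_cast
  linear_combination ha - hb + h2

theorem Function.Periodic.range_eq_image_Ico {γ : ℝ → E3} {p : ℝ} (hp : 0 < p)
    (hper : Function.Periodic γ p) : range γ = γ '' Ico 0 p := by
  have := hper.image_Ioc hp
  refine Subset.antisymm ?_ (image_subset_range _ _)
  rintro _ ⟨t, rfl⟩
  obtain ⟨s, hs, h⟩ := hper.exists_mem_Ico₀ hp t
  exact ⟨s, hs, h.symm⟩

theorem IsSimpleClosedPolygon.isPiecewiseC1Knot {n : ℕ} {v : ℕ → E3}
    (h : IsSimpleClosedPolygon n v) : IsPiecewiseC1Knot (polygon n v) := by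
  obtain ⟨hn, hclosed, hinj⟩ := h
  have hn0 : (0 : ℝ) < n := by exact_mod_cast (by omega : 0 < n)
  let vz : ℤ → E3 := fun i => v (i % n).toNat
  let γ : ℝ → E3 := fun t => vz ⌊t⌋ + Int.fract t • (vz (⌊t⌋ + 1) - vz ⌊t⌋)
  have hvz : ∀ i : ℤ, vz (i + n) = vz i := fun i => by simp [vz]
  have hγI : ∀ (i : ℤ) (t : ℝ), t ∈ Icc (i : ℝ) (i + 1) →
      γ t = vz i + (t - i) • (vz (i + 1) - vz i) := by
    intro i t ht
    rcases eq_or_lt_of_le ht.2 with rfl | h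
    · simp [γ]
    · have : ⌊t⌋ = i := Int.floor_eq_iff.2 ⟨ht.1, h⟩
      simp only [γ, Int.fract, this]
  have hγper : Function.Periodic γ (n : ℝ) := by
    intro t
    have h1 : ⌊t + (n : ℝ)⌋ = ⌊t⌋ + n := Int.floor_add_natCast t n
    have h2 : Int.fract (t + (n : ℝ)) = Int.fract t := Int.fract_add_natCast t n
    simp only [γ, h1, h2, hvz]
    rw [add_right_comm, hvz]
  have hγeq : ∀ t ∈ Ico (0 : ℝ) n, γ t = interp v t := by
    intro t ht
    have h1 : ((⌊t⌋₊ : ℕ) : ℝ) ≤ t := Nat.floor_le ht.1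
    have h2 := Nat.lt_floor_add_one t
    have hlt : ⌊t⌋₊ < n := (Nat.floor_lt ht.1).2 ht.2
    have e1 : vz (⌊t⌋₊ : ℤ) = v ⌊t⌋₊ := by
      simp only [vz]
      rw [Int.emod_eq_of_lt (by positivity) (by exact_mod_cast hlt)]
      simp
    have e2 : vz ((⌊t⌋₊ : ℤ) + 1) = v (⌊t⌋₊ + 1) := by
      rcases Nat.lt_or_ge (⌊t⌋₊ + 1) n with h | h
      · simp only [vz]
        rw [Int.emod_eq_of_lt (by positivity) (by exact_mod_cast h)]
        congr 1
      · have h3 : ⌊t⌋₊ + 1 = n := by omega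
        simp only [vz]
        have h4 : ((⌊t⌋₊ : ℤ) + 1) = n := by exact_mod_cast h3
        rw [h4, h3, hclosed]
        simp
    rw [hγI (⌊t⌋₊ : ℤ) t ⟨by exact_mod_cast h1, by exact_mod_cast h2.le⟩, e1, e2, interp]
    simp
  have hinjγ : InjOn γ (Ico 0 (n : ℝ)) := by
    intro s hs t ht hst
    refine hinj hs ht ?_
    rw [polygonPath_eq_interp v hs.1, polygonPath_eq_interp v ht.1, ← hγeq s hs, ← hγeq t ht, hst]
  -- The period is at least three, so parameters less than three apart give different points.
  have hsmall : ∀ a b : ℝ, 0 < a - b → a - b < 3 → γ a ≠ γ b := by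
    intro a b h0 h3 he
    obtain ⟨z, hz⟩ := exists_int_of_eq hn0 hγper hinjγ he
    have hn3 : (3 : ℝ) ≤ n := by exact_mod_cast hn
    rw [hz] at h0 h3
    have hz0 : 0 < z := by
      by_contra hcon
      have : (z : ℝ) ≤ 0 := by exact_mod_cast not_lt.1 hcon
      nlinarith
    have hz1 : (1 : ℝ) ≤ z := by exact_mod_cast hz0
    nlinarith
  have hedge : ∀ i : ℤ, vz (i + 1) - vz i ≠ 0 := by
    intro i he
    have h1 : γ ((i : ℝ) + 1) = γ i := by
      rw [hγI i _ ⟨by linarith, le_rfl⟩, hγI i i ⟨le_rfl, by linarith⟩, he]; simp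
    exact hsmall _ _ (by simp) (by norm_num) h1
  have hder : ∀ (i : ℤ) (t : ℝ), t ∈ Icc (i : ℝ) (i + 1) →
      derivWithin γ (Icc (i : ℝ) (i + 1)) t = vz (i + 1) - vz i := by
    intro i t ht
    have hd : HasDerivAt (fun t : ℝ => vz i + (t - i) • (vz (i + 1) - vz i))
        ((1 : ℝ) • (vz (i + 1) - vz i)) t :=
      (((hasDerivAt_id t).sub_const (i : ℝ)).smul_const _).const_add _
    rw [one_smul] at hd
    exact (hd.hasDerivWithinAt.congr (hγI i) (hγI i t ht)).derivWithin
      (uniqueDiffOn_Icc (by linarith) t ht)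
  refine ⟨n, γ, ⟨by omega, hγper, hinjγ, ?_, ?_, ?_⟩, ?_⟩
  · intro i
    refine ContDiffOn.congr (ContDiff.contDiffOn ?_) (hγI i)
    fun_prop
  · intro i t ht
    rw [hder i t ht]
    exact hedge i
  · intro i hray
    rw [hder i i ⟨le_rfl, by linarith⟩] at hray
    have h1 := hder (i - 1) i ⟨by push_cast; linarith, by push_cast; linarith⟩
    push_cast at h1
    rw [sub_add_cancel, sub_add_cancel] at h1
    rw [h1] at hray
    have h2 := hedge (i - 1)
    rw [sub_add_cancel] at h2
    obtain ⟨r1, r2, hr1, hr2, hr⟩ := hray.exists_pos (hedge i) (neg_ne_zero.2 h2)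
    have hs : 0 < r1 + r2 := by positivity
    have q1 : r1 / (r1 + r2) ≤ 1 := by rw [div_le_one hs]; linarith
    have q2 : r2 / (r1 + r2) ≤ 1 := by rw [div_le_one hs]; linarith
    have p1 : 0 < r1 / (r1 + r2) := by positivity
    have p2 : 0 < r2 / (r1 + r2) := by positivity
    -- At a cusp the outgoing edge runs back over the incoming one: these two parameters, which
    -- differ by exactly one, would give the same point.
    refine hsmall (i + r1 / (r1 + r2)) (i - r2 / (r1 + r2)) (by linarith) (by linarith) ?_
    rw [hγI i _ ⟨by linarith, by linarith⟩,
      hγI (i - 1) _ ⟨by push_cast; linarith, by push_cast; linarith⟩, sub_add_cancel]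
    have e1 : (i : ℝ) + r1 / (r1 + r2) - i = (1 / (r1 + r2)) * r1 := by ring
    have e2 : (i : ℝ) - r2 / (r1 + r2) - ((i - 1 : ℤ) : ℝ) = 1 - (1 / (r1 + r2)) * r2 := by
      push_cast; ring
    rw [e1, e2, mul_smul, hr]
    module
  · rw [Function.Periodic.range_eq_image_Ico hn0 hγper, polygon_eq_image_interp n v (by omega) hclosed]
    exact image_congr hγeq

/-! ### Galleries -/

theorem wallReflection_comp_apply (f : E3 ≃ᵃⁱ[ℝ] E3) (P : Color → E3) (s : Color) (x : E3) :
    wallReflection (fun c => f (P c)) s (f x) = f (wallReflection P s x) := by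
  have h : affineSpan ℝ (range fun j : Fin 3 => f (P (s.succAbove j))) =
      (affineSpan ℝ (range fun j : Fin 3 => P (s.succAbove j))).map
        f.toAffineIsometry.toAffineMap := by
    rw [AffineSubspace.map_span, ← range_comp]; rfl
  simp only [wallReflection]
  rw [EuclideanGeometry.eq_reflection_of_eq_subspace h]
  exact EuclideanGeometry.reflection_map _ f.toAffineIsometry x

theorem wallReflection_comp (f : E3 ≃ᵃⁱ[ℝ] E3) (P : Color → E3) (s : Color) :
    wallReflection (fun c => f (P c)) s = f * wallReflection P s * f⁻¹ := by
  ext1 x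
  have h := wallReflection_comp_apply f P s (f⁻¹ x)
  have h2 : f (f⁻¹ x) = x := f.apply_symm_apply x
  rw [h2] at h
  rw [h]; rfl

/-- The reflection fixes the three vertices of the face crossed, so it moves the whole pyramid as
`cross` does. -/
theorem cross_eq (P : Color → E3) (s : Color) :
    cross P s = fun c => wallReflection P s (P c) := by
  funext c
  rw [cross]
  rcases eq_or_ne c s with rfl | h
  · simp
  · rw [Function.update_of_ne h]
    obtain ⟨j, rfl⟩ := Fin.exists_succAbove_eq h
    symm
    simp only [wallReflection]
    rw [EuclideanGeometry.reflection_eq_self_iff]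
    exact subset_affineSpan ℝ _ ⟨j, rfl⟩

/-- The product of the first `i` reflections of a sequence of letters. -/
noncomputable def letterProd (P : Color → E3) (s : ℕ → Color) : ℕ → (E3 ≃ᵃⁱ[ℝ] E3)
  | 0 => 1
  | i + 1 => letterProd P s i * wallReflection P (s i)

theorem wordSymmetry_map_range (P : Color → E3) (s : ℕ → Color) (i : ℕ) :
    wordSymmetry P ((List.range i).map s) = letterProd P s i := by
  induction i with
  | zero => simp [wordSymmetry, letterProd]
  | succ i ih =>
    rw [letterProd, ← ih, List.range_succ]
    simp [wordSymmetry]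

/-- If the current pyramid is `h P`, its wall reflection is the conjugate `h s h⁻¹`, and `(h s h⁻¹)
h = h s`. Hence the letters, although they denote reflections in the walls of the initial pyramid,
are appended on the right. -/
theorem foldl_cross_map_range (P : Color → E3) (s : ℕ → Color) (i : ℕ) :
    ((List.range i).map s).foldl cross P = fun c => letterProd P s i (P c) := by
  induction i with
  | zero => simp [letterProd]
  | succ i ih =>
    rw [List.range_succ, List.map_append, List.foldl_append, ih]
    simp only [List.map_cons, List.map_nil, List.foldl_cons, List.foldl_nil, letterProd]
    rw [cross_eq]
    funext c
    exact wallReflection_comp_apply _ P _ _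

theorem letterProd_add (P : Color → E3) (s : ℕ → Color) (k i : ℕ) :
    letterProd P s (k + i) = letterProd P s k * letterProd P (fun j => s (k + j)) i := by
  induction i with
  | zero => simp [letterProd]
  | succ i ih => rw [← add_assoc, letterProd, letterProd, ih, mul_assoc]

theorem letterProd_add_of_periodic (P : Color → E3) {s : ℕ → Color} {k : ℕ}
    (hs : ∀ i, s (i + k) = s i) (i : ℕ) :
    letterProd P s (i + k) = letterProd P s k * letterProd P s i := by
  rw [add_comm, letterProd_add]
  congr 2
  funext j
  rw [add_comm, hs]

theorem galleryPyramid_of_periodic (P : Color → E3) {s : ℕ → Color} {k : ℕ}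
    (hs : ∀ i, s (i + k) = s i) {i : ℕ} (hi : i ≤ 3 * k) :
    galleryPyramid P ((List.range k).map s ++ (List.range k).map s ++ (List.range k).map s) i =
      fun c => letterProd P s i (P c) := by
  have h : (List.range k).map s ++ (List.range k).map s ++ (List.range k).map s =
      (List.range (3 * k)).map s := by
    have h2 : ∀ n, (List.range (n + k)).map s = (List.range k).map s ++ (List.range n).map s := by
      intro n
      rw [add_comm, List.range_add, List.map_append, List.map_map]
      congr 2
      funext j
      simp only [Function.comp]
      rw [add_comm, hs]
    rw [show 3 * k = k + k + k by ring, h2, h2, List.append_assoc]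
  rw [h, galleryPyramid, ← List.map_take, List.take_range, min_eq_left hi, foldl_cross_map_range]

theorem center_comp (f : E3 ≃ᵃⁱ[ℝ] E3) (P : Color → E3) :
    center (fun c => f (P c)) = f (center P) := by
  simp only [center, Fin.sum_univ_four]
  rw [isometry_apply f (P 0), isometry_apply f (P 1), isometry_apply f (P 2),
    isometry_apply f (P 3), isometry_apply f ((1 / 4 : ℝ) • _)]
  simp only [map_smul, map_add]
  module

theorem exists_periodic_letters (w : List Color) :
    ∃ s : ℕ → Color, (∀ i, s (i + w.length) = s i) ∧ w = (List.range w.length).map s := by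
  -- The default letter occurs only for the empty word.
  refine ⟨fun i => w.getD (i % w.length) 0, fun i => by simp, ?_⟩
  apply List.ext_getElem
  · simp
  · intro i h1 h2
    simp [Nat.mod_eq_of_lt h1, h1]

theorem interp_congr {V : Type*} [NormedAddCommGroup V] [NormedSpace ℝ V] {a b : ℕ → V} {n : ℕ}
    (h : ∀ i ≤ n, a i = b i) {t : ℝ} (ht : t ∈ Ico (0 : ℝ) n) : interp a t = interp b t := by
  have : ⌊t⌋₊ < n := (Nat.floor_lt ht.1).2 ht.2
  rw [interp, interp, h _ this.le, h _ this]

theorem polygon_congr {n : ℕ} {a b : ℕ → E3} (h : ∀ i ≤ n, a i = b i) :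
    polygon n a = polygon n b := by
  simp only [polygon]
  refine iUnion₂_congr fun i hi => ?_
  rw [Finset.mem_range] at hi
  rw [h i hi.le, h (i + 1) hi]

theorem IsSimpleClosedPolygon.congr {n : ℕ} {a b : ℕ → E3} (h : ∀ i ≤ n, a i = b i)
    (ha : IsSimpleClosedPolygon n a) : IsSimpleClosedPolygon n b := by
  refine ⟨ha.1, by rw [← h n le_rfl, ← h 0 (Nat.zero_le n), ha.2.1], ?_⟩
  refine ha.2.2.congr fun t ht => ?_
  rw [polygonPath_eq_interp a ht.1, polygonPath_eq_interp b ht.1, interp_congr h ht]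

theorem polygon_shift {n : ℕ} {c : ℕ → E3} (hn : 0 < n) (hc : ∀ i, c (i + n) = c i) (j : ℕ) :
    polygon n (fun i => c (i + j)) = polygon n c := by
  induction j with
  | zero => rfl
  | succ j ih =>
    rw [← ih]
    ext x
    simp only [polygon, mem_iUnion, Finset.mem_range, exists_prop]
    constructor
    · rintro ⟨i, hi, hx⟩
      rcases Nat.lt_or_ge (i + 1) n with h | h
      · exact ⟨i + 1, h, by convert hx using 3 <;> ring⟩
      · have hin : i + 1 = n := by omega
        refine ⟨0, hn, ?_⟩
        have e1 : c (i + (j + 1)) = c (0 + j) := by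
          rw [← hc (0 + j)]; congr 1; omega
        have e2 : c (i + 1 + (j + 1)) = c (0 + 1 + j) := by
          rw [← hc (0 + 1 + j)]; congr 1; omega
        rwa [e1, e2] at hx
    · rintro ⟨i, hi, hx⟩
      rcases Nat.eq_zero_or_pos i with rfl | h
      · refine ⟨n - 1, by omega, ?_⟩
        have e1 : c (n - 1 + (j + 1)) = c (0 + j) := by
          rw [← hc (0 + j)]; congr 1; omega
        have e2 : c (n - 1 + 1 + (j + 1)) = c (0 + 1 + j) := by
          rw [← hc (0 + 1 + j)]; congr 1; omega
        rwa [e1, e2]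
      · exact ⟨i - 1, by omega, by convert hx using 3 <;> omega⟩

theorem image_polygon_of_shift {n k : ℕ} {c : ℕ → E3} (hn : 0 < n) (f : E3 ≃ᵃⁱ[ℝ] E3)
    (hc : ∀ i, c (i + n) = c i) (hf : ∀ i, c (i + k) = f (c i)) :
    f '' polygon n c = polygon n c := by
  have h0 : c n = c 0 := by simpa using hc 0
  have h1 : f '' polygon n c = polygon n (fun i => f (c i)) := by
    rw [polygon_eq_image_interp n c hn h0, polygon_eq_image_interp n _ hn (by rw [h0]),
      image_image]
    refine image_congr fun t _ => ?_
    exact map_interp (f.toAffineEquiv : E3 →ᵃ[ℝ] E3) c t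
  rw [h1, ← polygon_shift hn hc k]
  simp only [hf]

/-- The symmetry `w` shifts the closed polygon of centers by `k` vertices, and it is a rotation by
120° because it has order three. -/
theorem IsRepresentedByWord.hasThreefoldRotationalSymmetry {P : Color → E3} {w : List Color}
    {K : Set E3} (h : IsRepresentedByWord P w K) : HasThreefoldRotationalSymmetry K := by
  obtain ⟨hord, hpoly, hiso⟩ := h
  have hw : w ≠ [] := by rintro rfl; simp [wordSymmetry] at hord
  obtain ⟨s, hs, hws⟩ := exists_periodic_letters w
  set k := w.length with hk
  have hkpos : 0 < k := List.length_pos_iff.2 hw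
  obtain ⟨o, b, hrot⟩ := exists_rotationAbout_of_orderOf_eq_three _ hord
  refine ⟨_, hpoly.isPiecewiseC1Knot, hiso, o, b, ?_⟩
  have himg : ∀ X : Set E3, rotationAbout o b (2 * Real.pi / 3) '' X = wordSymmetry P w '' X :=
    fun X => image_congr fun x _ => (hrot x).symm
  have hW : wordSymmetry P w = letterProd P s k := by
    rw [hws, wordSymmetry_map_range]
  have hg : ∀ i ≤ 3 * k, center (galleryPyramid P (w ++ w ++ w) i) =
      letterProd P s i (center P) := by
    intro i hi
    rw [hws, galleryPyramid_of_periodic P hs hi, center_comp]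
  have hshift : ∀ i, letterProd P s (i + k) (center P) =
      wordSymmetry P w (letterProd P s i (center P)) := by
    intro i
    rw [letterProd_add_of_periodic P hs, hW]; rfl
  rw [himg, polygon_congr hg]
  refine image_polygon_of_shift (k := k) (by omega) _ (fun i => ?_) hshift
  rw [show i + 3 * k = i + k + k + k by ring, hshift, hshift, hshift]
  have h1 := pow_orderOf_eq_one (wordSymmetry P w)
  rw [hord] at h1
  have h2 := congrArg (fun f : E3 ≃ᵃⁱ[ℝ] E3 => f (letterProd P s i (center P))) h1
  simpa [pow_succ] using h2

/-! ### Symmetries of the tessellation -/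

/-- The symmetries of the coloured cubic lattice, in coordinates. -/
def IsSym (f : E3 ≃ᵃⁱ[ℝ] E3) : Prop :=
  ∃ (a : Fin 3 → ℤ) (σ : Equiv.Perm (Fin 3)) (ε : Fin 3 → ℤ), (∀ j, ε j = 1 ∨ ε j = -1) ∧
    Even (∑ j, a j) ∧ ∀ x j, f x j = a j + ε j * x (σ j)

theorem even_sum_sign_mul {ε b : Fin 3 → ℤ} (hε : ∀ j, ε j = 1 ∨ ε j = -1)
    (σ : Equiv.Perm (Fin 3)) (hb : Even (∑ j, b j)) : Even (∑ j, ε j * b (σ j)) := by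
  have h1 : ∑ j, ε j * b (σ j) = ∑ j, (ε j - 1) * b (σ j) + ∑ j, b j := by
    rw [← Equiv.sum_comp σ b, ← Finset.sum_add_distrib]
    exact Finset.sum_congr rfl fun j _ => by ring
  rw [h1]
  refine Even.add (Finset.even_sum _ fun j _ => Even.mul_right ?_ _) hb
  rcases hε j with h | h <;> rw [h] <;> decide

theorem IsSym.one : IsSym 1 :=
  ⟨0, 1, 1, fun _ => Or.inl rfl, by simp, fun x j => by simp⟩

theorem IsSym.mul {f g : E3 ≃ᵃⁱ[ℝ] E3} (hf : IsSym f) (hg : IsSym g) : IsSym (f * g) := by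
  obtain ⟨a, σ, ε, hε, ha, hf⟩ := hf
  obtain ⟨b, τ, δ, hδ, hb, hg⟩ := hg
  refine ⟨fun j => a j + ε j * b (σ j), σ.trans τ, fun j => ε j * δ (σ j), fun j => ?_, ?_,
    fun x j => ?_⟩
  · rcases hε j with h | h <;> rcases hδ (σ j) with h' | h' <;> simp [h, h']
  · rw [Finset.sum_add_distrib]
    exact ha.add (even_sum_sign_mul hε σ hb)
  · have : (f * g) x = f (g x) := rfl
    rw [this, hf, hg]
    push_cast
    simp only [Equiv.trans_apply]
    ring

theorem IsSym.inv {f : E3 ≃ᵃⁱ[ℝ] E3} (hf : IsSym f) : IsSym f⁻¹ := by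
  obtain ⟨a, σ, ε, hε, ha, hf⟩ := hf
  have hε' : ∀ j, (fun j => -ε (σ.symm j)) j = 1 ∨ (fun j => -ε (σ.symm j)) j = -1 := by
    intro j
    rcases hε (σ.symm j) with h | h <;> simp [h]
  refine ⟨fun j => -ε (σ.symm j) * a (σ.symm j), σ.symm, fun j => ε (σ.symm j), fun j => hε _,
    even_sum_sign_mul hε' σ.symm ha, fun y j => ?_⟩
  obtain ⟨x, rfl⟩ : ∃ x, y = f x := ⟨f⁻¹ y, (f.apply_symm_apply y).symm⟩
  have : f⁻¹ (f x) = x := f.symm_apply_apply x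
  rw [this, hf]
  rcases hε (σ.symm j) with h | h <;> simp [h]

theorem exists_isometry_of_signs (a : Fin 3 → ℤ) (σ : Equiv.Perm (Fin 3)) (ε : Fin 3 → ℤ)
    (hε : ∀ j, ε j = 1 ∨ ε j = -1) :
    ∃ f : E3 ≃ᵃⁱ[ℝ] E3, ∀ x j, f x j = a j + ε j * x (σ j) := by
  let f1 : E3 ≃ᵃⁱ[ℝ] E3 :=
    (LinearIsometryEquiv.piLpCongrLeft 2 ℝ ℝ σ.symm).toAffineIsometryEquiv
  let f2 : E3 ≃ᵃⁱ[ℝ] E3 :=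
    (LinearIsometryEquiv.piLpCongrRight 2 (fun i : Fin 3 =>
      if ε i = 1 then LinearIsometryEquiv.refl ℝ ℝ
        else LinearIsometryEquiv.neg ℝ)).toAffineIsometryEquiv
  let f3 : E3 ≃ᵃⁱ[ℝ] E3 :=
    AffineIsometryEquiv.constVAdd ℝ E3 (WithLp.toLp 2 fun j => (a j : ℝ))
  refine ⟨f3 * (f2 * f1), fun x j => ?_⟩
  have : (f3 * (f2 * f1)) x = f3 (f2 (f1 x)) := rfl
  rw [this]
  rcases hε j with h | h <;> simp [f1, f2, f3, h]

/-! ### Roots -/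

/-- The integer vectors orthogonal to the walls. -/
def IsRoot (n : Fin 3 → ℤ) : Prop := ∑ i, n i ^ 2 = 1 ∨ ∑ i, n i ^ 2 = 2

/-- The real vector with given integer coordinates. -/
noncomputable def intVec (n : Fin 3 → ℤ) : E3 := WithLp.toLp 2 fun i => (n i : ℝ)

theorem intVec_apply (n : Fin 3 → ℤ) (i : Fin 3) : intVec n i = n i := rfl

theorem inner_intVec (n : Fin 3 → ℤ) (x : E3) :
    inner ℝ (intVec n) x = n 0 * x 0 + n 1 * x 1 + n 2 * x 2 := by
  rw [PiLp.inner_apply, Fin.sum_univ_three]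
  simp [intVec_apply, mul_comm]

theorem IsRoot.bounds {n : Fin 3 → ℤ} (hn : IsRoot n) (i : Fin 3) : -1 ≤ n i ∧ n i ≤ 1 := by
  have h : n i ^ 2 ≤ 2 := by
    have h1 : n i ^ 2 ≤ ∑ i, n i ^ 2 :=
      Finset.single_le_sum (f := fun i => n i ^ 2) (fun i _ => sq_nonneg _) (Finset.mem_univ i)
    rcases hn with h | h <;> omega
  constructor <;> nlinarith

/-- Symmetries permute the planes `⟨n, x⟩ = k` with `n` a root and `k` an integer; `c` records the
change of level. -/
theorem IsSym.exists_root {f : E3 ≃ᵃⁱ[ℝ] E3} (hf : IsSym f) {n : Fin 3 → ℤ} (hn : IsRoot n) :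
    ∃ (n' : Fin 3 → ℤ) (c : ℤ), IsRoot n' ∧
      (∀ x, inner ℝ (intVec n') (f x) = inner ℝ (intVec n) x + c) ∧
      f.linearIsometryEquiv (intVec n) = intVec n' := by
  obtain ⟨a, σ, ε, hε, ha, hf⟩ := hf
  have hε2 : ∀ j, ε j ^ 2 = 1 := fun j => by rcases hε j with h | h <;> simp [h]
  have hlin : f.linearIsometryEquiv (intVec n) = intVec (fun j => ε j * n (σ j)) := by
    have h1 := isometry_apply f (intVec n)
    ext j
    have h2 := congrArg (fun v : E3 => v j) h1
    simp only [PiLp.add_apply, hf, PiLp.zero_apply] at h2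
    rw [intVec_apply] at h2
    rw [intVec_apply]
    push_cast
    linarith
  refine ⟨fun j => ε j * n (σ j), ∑ j, ε j * n (σ j) * a j, ?_, fun x => ?_, hlin⟩
  · have : ∑ j, (ε j * n (σ j)) ^ 2 = ∑ j, n j ^ 2 := by
      rw [← Equiv.sum_comp σ fun j => n j ^ 2]
      exact Finset.sum_congr rfl fun j _ => by rw [mul_pow, hε2, one_mul]
    rw [IsRoot, this]; exact hn
  · rw [isometry_apply f x, inner_add_right, ← hlin, f.linearIsometryEquiv.inner_map_map, hlin,
      inner_intVec, inner_intVec]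
    simp only [hf, PiLp.zero_apply, Fin.sum_univ_three]
    push_cast
    ring

/-! ### The standard pyramid -/

/-- The standard pyramid. -/
noncomputable def stdPyramid : Color → E3 :=
  ![!₂[0, 0, 0], !₂[1, 0, 0], !₂[1 / 2, 1 / 2, 0], !₂[1 / 2, 1 / 2, 1 / 2]]

/-- The center of the standard pyramid. -/
noncomputable def stdCenter : E3 := !₂[1 / 2, 1 / 4, 1 / 8]

theorem center_stdPyramid : center stdPyramid = stdCenter := by
  ext j
  fin_cases j <;> simp [center, Fin.sum_univ_four, stdPyramid, stdCenter] <;> norm_num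

/-- The reflections in the walls of the standard pyramid. -/
noncomputable def stdReflection (s : Color) : E3 ≃ᵃⁱ[ℝ] E3 := wallReflection stdPyramid s

/-- The vector `v` is normal to the face and `x - v` lies in its plane, with affine coordinates `α`,
`β`; the reflection replaces `v` by `-v`. -/
theorem wallReflection_apply_of_decomposition (P : Color → E3) (s : Color) (x v : E3) (α β : ℝ)
    (h1 : inner ℝ (P (s.succAbove 1) - P (s.succAbove 0)) v = 0)
    (h2 : inner ℝ (P (s.succAbove 2) - P (s.succAbove 0)) v = 0)
    (hx : x = v + (P (s.succAbove 0) + α • (P (s.succAbove 1) - P (s.succAbove 0)) +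
      β • (P (s.succAbove 2) - P (s.succAbove 0)))) :
    wallReflection P s x = x - (2 : ℝ) • v := by
  set Q : Fin 3 → E3 := fun j => P (s.succAbove j) with hQ
  set p := Q 0 + α • (Q 1 - Q 0) + β • (Q 2 - Q 0) with hp
  have hdir : ∀ j, Q j - Q 0 ∈ (affineSpan ℝ (range Q)).direction := fun j =>
    AffineSubspace.vsub_mem_direction (subset_affineSpan ℝ _ ⟨j, rfl⟩)
      (subset_affineSpan ℝ _ ⟨0, rfl⟩)
  have hpm : p ∈ affineSpan ℝ (range Q) := by
    have : p = (α • (Q 1 - Q 0) + β • (Q 2 - Q 0)) +ᵥ Q 0 := by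
      rw [hp, vadd_eq_add]; abel
    rw [this]
    exact AffineSubspace.vadd_mem_of_mem_direction
      (Submodule.add_mem _ (Submodule.smul_mem _ _ (hdir 1)) (Submodule.smul_mem _ _ (hdir 2)))
      (subset_affineSpan ℝ _ ⟨0, rfl⟩)
  have hv : v ∈ (affineSpan ℝ (range Q)).directionᗮ := by
    rw [direction_affineSpan, vectorSpan_range_eq_span_range_vsub_right ℝ Q 0,
      Submodule.mem_orthogonal]
    intro u hu
    induction hu using Submodule.span_induction with
    | mem u hu =>
      obtain ⟨j, rfl⟩ := hu
      fin_cases j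
      · simp
      · exact h1
      · exact h2
    | zero => simp
    | add u w _ _ hu hw => rw [inner_add_left, hu, hw, add_zero]
    | smul c u _ hu => rw [inner_smul_left, hu, mul_zero]
  have h := EuclideanGeometry.reflection_orthogonal_vadd hpm hv
  have hx' : x = v +ᵥ p := hx
  rw [wallReflection]
  change EuclideanGeometry.reflection (affineSpan ℝ (range Q)) x = _
  rw [hx', h]
  simp only [vadd_eq_add]
  module

theorem stdReflection_zero (x : E3) : stdReflection 0 x = !₂[1 - x 1, 1 - x 0, x 2] := by
  rw [stdReflection, wallReflection_apply_of_decomposition stdPyramid 0 x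
    (((x 0 + x 1 - 1) / 2) • !₂[1, 1, 0]) (x 1 - x 0 + 1 - 2 * x 2) (2 * x 2)]
  · ext j; fin_cases j <;> simp <;> ring
  · rw [PiLp.inner_apply, Fin.sum_univ_three]
    simp [stdPyramid, Fin.succAbove]; ring
  · rw [PiLp.inner_apply, Fin.sum_univ_three]
    simp [stdPyramid, Fin.succAbove]; ring
  · ext j; fin_cases j <;> simp [stdPyramid, Fin.succAbove] <;> ring

theorem stdReflection_one (x : E3) : stdReflection 1 x = !₂[x 1, x 0, x 2] := by
  rw [stdReflection, wallReflection_apply_of_decomposition stdPyramid 1 x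
    (((x 0 - x 1) / 2) • !₂[1, -1, 0]) (x 0 + x 1 - 2 * x 2) (2 * x 2)]
  · ext j; fin_cases j <;> simp <;> ring
  · rw [PiLp.inner_apply, Fin.sum_univ_three]
    simp [stdPyramid, Fin.succAbove]
  · rw [PiLp.inner_apply, Fin.sum_univ_three]
    simp [stdPyramid, Fin.succAbove]
  · ext j; fin_cases j <;> simp [stdPyramid, Fin.succAbove] <;> ring

theorem stdReflection_two (x : E3) : stdReflection 2 x = !₂[x 0, x 2, x 1] := by
  rw [stdReflection, wallReflection_apply_of_decomposition stdPyramid 2 x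
    (((x 1 - x 2) / 2) • !₂[0, 1, -1]) (x 0 - (x 1 + x 2) / 2) (x 1 + x 2)]
  · ext j; fin_cases j <;> simp <;> ring
  · rw [PiLp.inner_apply, Fin.sum_univ_three]
    simp [stdPyramid, Fin.succAbove]
  · rw [PiLp.inner_apply, Fin.sum_univ_three]
    simp [stdPyramid, Fin.succAbove]
  · ext j; fin_cases j <;> simp [stdPyramid, Fin.succAbove] <;> ring

theorem stdReflection_three (x : E3) : stdReflection 3 x = !₂[x 0, x 1, -x 2] := by
  rw [stdReflection, wallReflection_apply_of_decomposition stdPyramid 3 x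
    ((x 2) • !₂[0, 0, 1]) (x 0 - x 1) (2 * x 1)]
  · ext j; fin_cases j <;> simp <;> ring
  · rw [PiLp.inner_apply, Fin.sum_univ_three]
    simp [stdPyramid, Fin.succAbove]
  · rw [PiLp.inner_apply, Fin.sum_univ_three]
    simp [stdPyramid, Fin.succAbove]
  · ext j; fin_cases j <;> simp [stdPyramid, Fin.succAbove] <;> ring

theorem isSym_stdReflection (s : Color) : IsSym (stdReflection s) := by
  fin_cases s
  · refine ⟨![1, 1, 0], Equiv.swap 0 1, ![-1, -1, 1], by decide, by decide, fun x j => ?_⟩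
    change stdReflection 0 x j = _
    rw [stdReflection_zero]
    fin_cases j <;> simp [Equiv.swap_apply_def] <;> ring
  · refine ⟨0, Equiv.swap 0 1, 1, by decide, by decide, fun x j => ?_⟩
    change stdReflection 1 x j = _
    rw [stdReflection_one]
    fin_cases j <;> simp [Equiv.swap_apply_def]
  · refine ⟨0, Equiv.swap 1 2, 1, by decide, by decide, fun x j => ?_⟩
    change stdReflection 2 x j = _
    rw [stdReflection_two]
    fin_cases j <;> simp [Equiv.swap_apply_def]
  · refine ⟨0, 1, ![1, 1, -1], by decide, by decide, fun x j => ?_⟩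
    change stdReflection 3 x j = _
    rw [stdReflection_three]
    fin_cases j <;> simp

theorem IsPyramid.exists_sym {P : Color → E3} (hP : IsPyramid P) :
    ∃ f, IsSym f ∧ P = fun c => f (stdPyramid c) := by
  obtain ⟨m, a, b, i, l, ha, hb, hae, hbo, hab, hil, h0, h1, h2, h3⟩ := hP
  -- In the standard pyramid the edge `AB` has the direction of axis 0 and the face centered at `C`
  -- is perpendicular to axis 2; the signs below make the map point from the vertex `a` into the
  -- cube.
  obtain ⟨σ, hσl, hσi⟩ : ∃ σ : Equiv.Perm (Fin 3), σ l = 0 ∧ σ i = 2 := by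
    clear h2 hab; revert i l; decide
  have hε : ∀ j, 2 * (m j - a j) + 1 = 1 ∨ 2 * (m j - a j) + 1 = -1 := by
    intro j; rcases ha j with h | h <;> rw [h] <;> simp
  obtain ⟨f, hf⟩ := exists_isometry_of_signs a σ (fun j => 2 * (m j - a j) + 1) hε
  refine ⟨f, ⟨a, σ, _, hε, hae, hf⟩, ?_⟩
  have hl : ∀ j, σ j = 0 ↔ j = l := fun j => by rw [← hσl]; exact σ.injective.eq_iff
  have hi : ∀ j, σ j = 2 ↔ j = i := fun j => by rw [← hσi]; exact σ.injective.eq_iff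
  have hcase : ∀ j, σ j = 0 ∨ σ j = 1 ∨ σ j = 2 := fun j => by
    generalize σ j = t; revert t; decide
  have cast (j : Fin 3) : (a j : ℝ) = m j ∨ (a j : ℝ) = m j + 1 := by
    rcases ha j with h | h
    · left; exact_mod_cast h
    · right; exact_mod_cast h
  funext c
  ext j
  rw [hf]
  push_cast
  fin_cases c
  · change P 0 j = _
    rw [h0]
    have : stdPyramid 0 (σ j) = 0 := by
      rcases hcase j with h | h | h <;> rw [h] <;> simp [stdPyramid]
    change _ = (a j : ℝ) + _ * stdPyramid 0 (σ j)
    rw [this, mul_zero, add_zero]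
  · change P 1 j = (a j : ℝ) + _ * stdPyramid 1 (σ j)
    rw [h1]
    by_cases hj : j = l
    · rw [(hl j).2 hj]
      have hne := (hab j).2 hj
      have e : b j = a j + (2 * (m j - a j) + 1) := by
        rcases ha j with h | h <;> rcases hb j with h' | h' <;> omega
      rw [e]
      simp [stdPyramid]
    · have e : a j = b j := by
        by_contra hcon; exact hj ((hab j).1 hcon)
      have h0' : σ j ≠ 0 := fun h => hj ((hl j).1 h)
      rw [← e]
      rcases hcase j with h | h | h
      · exact absurd h h0'
      · rw [h]; simp [stdPyramid]
      · rw [h]; simp [stdPyramid]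
  · change P 2 j = (a j : ℝ) + _ * stdPyramid 2 (σ j)
    rw [h2]
    by_cases hj : j = i
    · rw [if_pos hj, (hi j).2 hj]; simp [stdPyramid]
    · rw [if_neg hj]
      rcases hcase j with h | h | h
      · rw [h]; simp [stdPyramid]; ring
      · rw [h]; simp [stdPyramid]; ring
      · exact absurd ((hi j).1 h) hj
  · change P 3 j = (a j : ℝ) + _ * stdPyramid 3 (σ j)
    rw [h3]
    rcases hcase j with h | h | h <;> rw [h] <;> simp [stdPyramid] <;> ring

/-! ### Minimal galleries -/

/-- The outer normal and the level of the wall of the standard pyramid of the given type. -/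
def wallNormal : Color → (Fin 3 → ℤ) := ![![1, 1, 0], ![-1, 1, 0], ![0, -1, 1], ![0, 0, -1]]

/-- The level of the wall of the standard pyramid of the given type. -/
def wallLevel : Color → ℤ := ![1, 0, 0, 0]

theorem stdCenter_lt_wall (s : Color) : inner ℝ (intVec (wallNormal s)) stdCenter < wallLevel s := by
  rw [inner_intVec]
  fin_cases s <;> simp [wallNormal, wallLevel, stdCenter] <;> norm_num

theorem isRoot_wallNormal (s : Color) : IsRoot (wallNormal s) := by
  fin_cases s <;> simp [IsRoot, wallNormal, Fin.sum_univ_three]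

theorem color_cases (s : Color) : s = 0 ∨ s = 1 ∨ s = 2 ∨ s = 3 := by revert s; decide

/-- The reflections, and their effect on the distance to the center. -/
theorem stdReflection_facts (s : Color) (x : E3) :
    ∃ μ : ℝ, (1 / 8 ≤ μ ∧ μ ≤ 1 / 4) ∧ inner ℝ (intVec (wallNormal s)) (stdReflection s x) - wallLevel s =
        -(inner ℝ (intVec (wallNormal s)) x - wallLevel s) ∧
      stdReflection s stdCenter - stdCenter = μ • intVec (wallNormal s) ∧
      (wallLevel s < inner ℝ (intVec (wallNormal s)) x →
        ∑ j, (stdReflection s x j - stdCenter j) ^ 2 < ∑ j, (x j - stdCenter j) ^ 2) := by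
  simp only [inner_intVec, Fin.sum_univ_three]
  rcases color_cases s with rfl | rfl | rfl | rfl
  · rw [stdReflection_zero, stdReflection_zero]
    refine ⟨1 / 4, by norm_num, ?_, ?_, ?_⟩
    · simp [wallNormal, wallLevel]; ring
    · ext j; fin_cases j <;> simp [wallNormal, intVec, stdCenter] <;> norm_num
    · simp [wallNormal, wallLevel, stdCenter]; intro h; nlinarith
  · rw [stdReflection_one, stdReflection_one]
    refine ⟨1 / 4, by norm_num, ?_, ?_, ?_⟩
    · simp [wallNormal, wallLevel]
    · ext j; fin_cases j <;> simp [wallNormal, intVec, stdCenter] <;> norm_num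
    · simp [wallNormal, wallLevel, stdCenter]; intro h; nlinarith
  · rw [stdReflection_two, stdReflection_two]
    refine ⟨1 / 8, by norm_num, ?_, ?_, ?_⟩
    · simp [wallNormal, wallLevel]
    · ext j; fin_cases j <;> simp [wallNormal, intVec, stdCenter] <;> norm_num
    · simp [wallNormal, wallLevel, stdCenter]; intro h; nlinarith
  · rw [stdReflection_three, stdReflection_three]
    refine ⟨1 / 4, by norm_num, ?_, ?_, ?_⟩
    · simp [wallNormal, wallLevel]
    · ext j; fin_cases j <;> simp [wallNormal, intVec, stdCenter] <;> norm_num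
    · simp [wallNormal, wallLevel, stdCenter]; intro h; nlinarith

theorem norm_intVec_le {n : Fin 3 → ℤ} (hn : IsRoot n) : ‖intVec n‖ ≤ 2 := by
  have h : ‖intVec n‖ ^ 2 = ((∑ i, n i ^ 2 : ℤ) : ℝ) := by
    rw [EuclideanSpace.norm_sq_eq]; simp [intVec_apply]
  have h2 : ((∑ i, n i ^ 2 : ℤ) : ℝ) ≤ 2 := by rcases hn with h | h <;> rw [h] <;> norm_num
  nlinarith [norm_nonneg (intVec n)]

theorem norm_stdReflection_sub_le (s : Color) : ‖stdReflection s stdCenter - stdCenter‖ ≤ 1 := by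
  obtain ⟨μ, ⟨h1, h2⟩, -, h3, -⟩ := stdReflection_facts s 0
  rw [h3, norm_smul, Real.norm_of_nonneg (by linarith)]
  have := norm_intVec_le (isRoot_wallNormal s)
  nlinarith [norm_nonneg (intVec (wallNormal s))]

/-- Only one wall separates the standard pyramid from its neighbour. -/
theorem wall_unique {s : Color} {n : Fin 3 → ℤ} (hn : IsRoot n) {k : ℤ}
    (h1 : inner ℝ (intVec n) stdCenter < k) (h2 : k ≤ inner ℝ (intVec n) (stdReflection s stdCenter)) :
    n = wallNormal s ∧ k = wallLevel s := by
  have b0 := hn.bounds 0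
  have b1 := hn.bounds 1
  have b2 := hn.bounds 2
  rw [IsRoot, Fin.sum_univ_three] at hn
  rw [inner_intVec] at h1 h2
  -- The standard center is `(4, 2, 1) / 8`, so the conditions become integer inequalities, to be
  -- checked for the finitely many roots.
  have e1 : 4 * n 0 + 2 * n 1 + n 2 < 8 * k := by
    simp only [stdCenter, PiLp.toLp_apply, Matrix.cons_val] at h1
    have : (4 * n 0 + 2 * n 1 + n 2 : ℝ) < 8 * k := by linarith
    exact_mod_cast this
  suffices h : n 0 = wallNormal s 0 ∧ n 1 = wallNormal s 1 ∧ n 2 = wallNormal s 2 ∧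
      k = wallLevel s by
    refine ⟨funext fun j => ?_, h.2.2.2⟩
    fin_cases j
    exacts [h.1, h.2.1, h.2.2.1]
  generalize n 0 = p at *
  generalize n 1 = q at *
  generalize n 2 = r at *
  rcases color_cases s with rfl | rfl | rfl | rfl
  · rw [stdReflection_zero] at h2
    have e2 : 8 * k ≤ 6 * p + 4 * q + r := by
      simp only [stdCenter, PiLp.toLp_apply, Matrix.cons_val] at h2
      have : (8 * k : ℝ) ≤ 6 * p + 4 * q + r := by linarith
      exact_mod_cast this
    simp only [wallNormal, wallLevel, Matrix.cons_val]
    obtain ⟨_, _⟩ := b0; obtain ⟨_, _⟩ := b1; obtain ⟨_, _⟩ := b2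
    interval_cases p <;> interval_cases q <;> interval_cases r <;> omega
  · rw [stdReflection_one] at h2
    have e2 : 8 * k ≤ 2 * p + 4 * q + r := by
      simp only [stdCenter, PiLp.toLp_apply, Matrix.cons_val] at h2
      have : (8 * k : ℝ) ≤ 2 * p + 4 * q + r := by linarith
      exact_mod_cast this
    simp only [wallNormal, wallLevel, Matrix.cons_val]
    obtain ⟨_, _⟩ := b0; obtain ⟨_, _⟩ := b1; obtain ⟨_, _⟩ := b2
    interval_cases p <;> interval_cases q <;> interval_cases r <;> omega
  · rw [stdReflection_two] at h2
    have e2 : 8 * k ≤ 4 * p + q + 2 * r := by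
      simp only [stdCenter, PiLp.toLp_apply, Matrix.cons_val] at h2
      have : (8 * k : ℝ) ≤ 4 * p + q + 2 * r := by linarith
      exact_mod_cast this
    simp only [wallNormal, wallLevel, Matrix.cons_val]
    obtain ⟨_, _⟩ := b0; obtain ⟨_, _⟩ := b1; obtain ⟨_, _⟩ := b2
    interval_cases p <;> interval_cases q <;> interval_cases r <;> omega
  · rw [stdReflection_three] at h2
    have e2 : 8 * k ≤ 4 * p + 2 * q - r := by
      simp only [stdCenter, PiLp.toLp_apply, Matrix.cons_val] at h2
      have : (8 * k : ℝ) ≤ 4 * p + 2 * q - r := by linarith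
      exact_mod_cast this
    simp only [wallNormal, wallLevel, Matrix.cons_val]
    obtain ⟨_, _⟩ := b0; obtain ⟨_, _⟩ := b1; obtain ⟨_, _⟩ := b2
    interval_cases p <;> interval_cases q <;> interval_cases r <;> omega

/-- The coordinates of the center of a pyramid, in eighths. -/
theorem IsSym.eighths {f : E3 ≃ᵃⁱ[ℝ] E3} (hf : IsSym f) :
    ∃ z : Fin 3 → ℤ, ∀ j, 8 * f stdCenter j = z j := by
  obtain ⟨a, σ, ε, hε, ha, hf⟩ := hf
  refine ⟨fun j => 8 * a j + ε j * ![4, 2, 1] (σ j), fun j => ?_⟩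
  rw [hf]
  have : (8 * stdCenter (σ j) : ℝ) = ((![4, 2, 1] : Fin 3 → ℤ) (σ j) : ℤ) := by
    generalize σ j = t
    fin_cases t <;> simp [stdCenter] <;> norm_num
  push_cast
  rw [← this]; ring

/-- A pyramid lying beyond no wall of the standard one is the standard one. -/
theorem IsSym.eq_one_or_exists_wall {f : E3 ≃ᵃⁱ[ℝ] E3} (hf : IsSym f) :
    f = 1 ∨ ∃ s, (wallLevel s : ℝ) < inner ℝ (intVec (wallNormal s)) (f stdCenter) := by
  obtain ⟨a, σ, ε, hε, ha, hf⟩ := hf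
  by_contra hcon
  push Not at hcon
  obtain ⟨hne, hwall⟩ := hcon
  obtain ⟨M, hM⟩ : ∃ M : Fin 3 → ℤ, M = ![4, 2, 1] := ⟨_, rfl⟩
  have hz : ∀ j, 8 * f stdCenter j = ((8 * a j + ε j * M (σ j) : ℤ) : ℝ) := by
    intro j
    rw [hf]
    have : (8 * stdCenter (σ j) : ℝ) = (M (σ j) : ℤ) := by
      rw [hM]
      generalize σ j = t
      fin_cases t <;> simp [stdCenter] <;> norm_num
    push_cast
    rw [← this]; ring
  have w0 := hwall 0
  have w1 := hwall 1
  have w2 := hwall 2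
  have w3 := hwall 3
  simp only [inner_intVec, wallNormal, wallLevel, Matrix.cons_val] at w0 w1 w2 w3
  have hval : ∀ j, M (σ j) = 4 ∧ σ j = 0 ∨ M (σ j) = 2 ∧ σ j = 1 ∨ M (σ j) = 1 ∧ σ j = 2 := by
    intro j
    rw [hM]
    generalize σ j = t
    revert t; decide
  have i01 : σ 0 ≠ σ 1 := σ.injective.ne (by decide)
  have i02 : σ 0 ≠ σ 2 := σ.injective.ne (by decide)
  have i12 : σ 1 ≠ σ 2 := σ.injective.ne (by decide)
  have z0 := hz 0
  have z1 := hz 1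
  have z2 := hz 2
  rw [Fin.sum_univ_three, Int.even_iff] at ha
  -- Measured in eighths, the four wall inequalities leave finitely many cases. The parity of `∑ a`
  -- is needed to exclude the reflection `x₀ ↦ 1 - x₀`, which preserves the standard pyramid but
  -- exchanges the colors `A` and `B`.
  have key : σ 0 = 0 ∧ σ 1 = 1 ∧ σ 2 = 2 ∧ ε 0 = 1 ∧ ε 1 = 1 ∧ ε 2 = 1 ∧ a 0 = 0 ∧ a 1 = 0 ∧
      a 2 = 0 := by
    have c0 : 8 * a 0 + ε 0 * M (σ 0) + (8 * a 1 + ε 1 * M (σ 1)) ≤ 8 := by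
      have : ((8 * a 0 + ε 0 * M (σ 0) : ℤ) : ℝ) + ((8 * a 1 + ε 1 * M (σ 1) : ℤ) : ℝ) ≤ 8 := by
        rw [← z0, ← z1]; push_cast at w0; linarith
      exact_mod_cast this
    have c1 : 8 * a 1 + ε 1 * M (σ 1) ≤ 8 * a 0 + ε 0 * M (σ 0) := by
      have : ((8 * a 1 + ε 1 * M (σ 1) : ℤ) : ℝ) ≤ ((8 * a 0 + ε 0 * M (σ 0) : ℤ) : ℝ) := by
        rw [← z0, ← z1]; push_cast at w1; linarith
      exact_mod_cast this
    have c2 : 8 * a 2 + ε 2 * M (σ 2) ≤ 8 * a 1 + ε 1 * M (σ 1) := by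
      have : ((8 * a 2 + ε 2 * M (σ 2) : ℤ) : ℝ) ≤ ((8 * a 1 + ε 1 * M (σ 1) : ℤ) : ℝ) := by
        rw [← z2, ← z1]; push_cast at w2; linarith
      exact_mod_cast this
    have c3 : 0 ≤ 8 * a 2 + ε 2 * M (σ 2) := by
      have : (0 : ℝ) ≤ ((8 * a 2 + ε 2 * M (σ 2) : ℤ) : ℝ) := by
        rw [← z2]; push_cast at w3; linarith
      exact_mod_cast this
    clear hwall w0 w1 w2 w3 hf hz z0 z1 z2 hne
    rcases hval 0 with ⟨m0, s0⟩ | ⟨m0, s0⟩ | ⟨m0, s0⟩ <;>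
    rcases hval 1 with ⟨m1, s1⟩ | ⟨m1, s1⟩ | ⟨m1, s1⟩ <;>
    rcases hval 2 with ⟨m2, s2⟩ | ⟨m2, s2⟩ | ⟨m2, s2⟩ <;>
    first
      | exact absurd (s0.trans s1.symm) i01
      | exact absurd (s0.trans s2.symm) i02
      | exact absurd (s1.trans s2.symm) i12
      | (rw [m0, m1] at c0 c1; rw [m1, m2] at c2; rw [m2] at c3
         rcases hε 0 with e0 | e0 <;> rcases hε 1 with e1 | e1 <;> rcases hε 2 with e2 | e2 <;>
         rw [e0, e1] at c0 c1 <;> rw [e1, e2] at c2 <;> rw [e2] at c3 <;>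
         omega)
  obtain ⟨s0, s1, s2, e0, e1, e2, a0, a1, a2⟩ := key
  apply hne
  ext x j
  rw [hf]
  change _ = x j
  fin_cases j <;> simp [s0, s1, s2, e0, e1, e2, a0, a1, a2]

/-- Squared distances between centers are multiples of `1/64`, which makes descent on them
terminate. -/
theorem IsSym.exists_nat_dist {f : E3 ≃ᵃⁱ[ℝ] E3} (hf : IsSym f) :
    ∃ V : ℤ, 64 * ∑ j, (f stdCenter j - stdCenter j) ^ 2 = V := by
  obtain ⟨z, hz⟩ := hf.eighths
  refine ⟨∑ j, (z j - (![4, 2, 1] : Fin 3 → ℤ) j) ^ 2, ?_⟩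
  generalize f stdCenter = y at hz ⊢
  have e (j : Fin 3) : 8 * stdCenter j = ((![4, 2, 1] : Fin 3 → ℤ) j : ℝ) := by
    fin_cases j <;> simp [stdCenter] <;> norm_num
  rw [Finset.mul_sum, Int.cast_sum]
  refine Finset.sum_congr rfl fun j _ => ?_
  rw [Int.cast_pow, Int.cast_sub, ← hz j, ← e j]
  ring

theorem stdReflection_stdReflection (s : Color) (x : E3) :
    stdReflection s (stdReflection s x) = x := by
  unfold stdReflection wallReflection
  exact EuclideanGeometry.reflection_reflection _ x

theorem stdReflection_mul_self (s : Color) : stdReflection s * stdReflection s = 1 := by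
  ext1 x
  exact stdReflection_stdReflection s x

theorem mul_linearIsometryEquiv (f g : E3 ≃ᵃⁱ[ℝ] E3) (v : E3) :
    (f * g).linearIsometryEquiv v = f.linearIsometryEquiv (g.linearIsometryEquiv v) := by
  have h1 := isometry_sub (f * g) v 0
  have h2 : (f * g) v - (f * g) 0 = f (g v) - f (g 0) := rfl
  rw [h2, isometry_sub f, isometry_sub g, sub_zero] at h1
  exact h1.symm

theorem wordSymmetry_cons (s : Color) (w : List Color) : wordSymmetry stdPyramid (s :: w) =
    stdReflection s * wordSymmetry stdPyramid w := by
  simp [wordSymmetry, stdReflection]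

/-- The word `w` describes a gallery from the standard pyramid to its image under `f`, all of whose
steps cross walls that separate the two. -/
def IsMinimalWord (w : List Color) (f : E3 ≃ᵃⁱ[ℝ] E3) : Prop :=
  wordSymmetry stdPyramid w = f ∧ ∀ u s v, w = u ++ s :: v →
    ∃ (n : Fin 3 → ℤ) (k : ℤ) (μ : ℝ), IsRoot n ∧ 1 / 8 ≤ μ ∧
      (wordSymmetry stdPyramid u).linearIsometryEquiv (stdReflection s stdCenter - stdCenter) =
        μ • intVec n ∧
      inner ℝ (intVec n) stdCenter < k ∧ k < inner ℝ (intVec n) (f stdCenter)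

/-- A minimal gallery to the reflected target is mirrored in the wall `s` and preceded by one
crossing of that wall. The mirrored steps still cross separating walls, because the wall `s` itself
is not crossed again. -/
theorem IsMinimalWord.cons {f : E3 ≃ᵃⁱ[ℝ] E3} {s : Color} {w : List Color}
    (h : IsMinimalWord w (stdReflection s * f))
    (hs : (wallLevel s : ℝ) < inner ℝ (intVec (wallNormal s)) (f stdCenter)) :
    IsMinimalWord (s :: w) f := by
  obtain ⟨hw, hsteps⟩ := h
  obtain ⟨μ, ⟨hμ, -⟩, hrefl, hstep, -⟩ := stdReflection_facts s (f stdCenter)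
  refine ⟨?_, ?_⟩
  · rw [wordSymmetry_cons, hw, ← mul_assoc, stdReflection_mul_self, one_mul]
  · intro u t v huv
    rcases u with _ | ⟨u0, u⟩
    · simp only [List.nil_append, List.cons.injEq] at huv
      obtain ⟨rfl, rfl⟩ := huv
      refine ⟨wallNormal s, wallLevel s, μ, isRoot_wallNormal s, hμ, ?_,
        stdCenter_lt_wall s, hs⟩
      rw [hstep]; simp [wordSymmetry]; rfl
    · simp only [List.cons_append, List.cons.injEq] at huv
      obtain ⟨rfl, hw'⟩ := huv
      obtain ⟨n, k, ν, hn, hν, hlin, hk1, hk2⟩ := hsteps u t v hw'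
      obtain ⟨n', c, hn', hin, hln⟩ := (isSym_stdReflection s).exists_root hn
      have e3 : (stdReflection s * f) stdCenter = stdReflection s (f stdCenter) := rfl
      rw [e3] at hk2
      refine ⟨n', k + c, ν, hn', hν, ?_, ?_, ?_⟩
      · rw [wordSymmetry_cons, mul_linearIsometryEquiv, hlin, map_smul, hln]
      · by_contra hcon
        push Not at hcon
        have e1 := hin (stdReflection s stdCenter)
        rw [stdReflection_stdReflection] at e1
        push_cast at hcon
        -- A mirrored wall not having the standard center on its near side would come from a wall
        -- separating the standard pyramid from its neighbour, hence from the wall `s`; but the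
        -- reflected target lies on the near side of that wall.
        obtain ⟨rfl, rfl⟩ := wall_unique (s := s) hn hk1 (by linarith)
        linarith
      · have e4 := hin (stdReflection s (f stdCenter))
        rw [stdReflection_stdReflection] at e4
        rw [e4]; push_cast; linarith

/-- Unless the target is the standard pyramid, it lies beyond one of its four walls; reflecting the
target in that wall brings its center closer to the standard one. -/
theorem exists_minimal_word (f : E3 ≃ᵃⁱ[ℝ] E3) (hf : IsSym f) : ∃ w, IsMinimalWord w f := by
  have main : ∀ D : ℕ, ∀ f : E3 ≃ᵃⁱ[ℝ] E3, IsSym f →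
      64 * ∑ j, (f stdCenter j - stdCenter j) ^ 2 < D → ∃ w, IsMinimalWord w f := by
    intro D
    induction D with
    | zero =>
      intro f _ h
      have : (0 : ℝ) ≤ 64 * ∑ j, (f stdCenter j - stdCenter j) ^ 2 := by positivity
      push_cast at h; linarith
    | succ D ih =>
      intro f hf hD
      rcases hf.eq_one_or_exists_wall with rfl | ⟨s, hs⟩
      · exact ⟨[], by simp [wordSymmetry], fun u s v h => by simp at h⟩
      obtain ⟨μ, -, -, -, hdist⟩ := stdReflection_facts s (f stdCenter)
      obtain ⟨w, hw⟩ := ih (stdReflection s * f) ((isSym_stdReflection s).mul hf) (by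
        have h1 := hdist hs
        obtain ⟨V, hV⟩ := hf.exists_nat_dist
        rw [hV] at hD
        have h3 : (V : ℝ) ≤ D := by
          have : V < (D : ℤ) + 1 := by exact_mod_cast hD
          exact_mod_cast (by omega : V ≤ (D : ℤ))
        rw [← hV] at h3
        have e3 : (stdReflection s * f) stdCenter = stdReflection s (f stdCenter) := rfl
        rw [e3]
        linarith)
      exact ⟨s :: w, hw.cons hs⟩
  obtain ⟨D, hD⟩ := exists_nat_gt (64 * ∑ j, (f stdCenter j - stdCenter j) ^ 2)
  exact main D f hf hD

/-! ### Concatenation of words -/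

/-- The infinite word `U 0, U 1, …`, with `start c` the position at which `U c` begins. -/
theorem exists_concatenation {α : Type*} (U : ℕ → List α) (hU : ∀ c, U c ≠ []) :
    ∃ (s : ℕ → α) (start : ℕ → ℕ), start 0 = 0 ∧ (∀ c, start (c + 1) = start c + (U c).length) ∧
      (∀ i, ∃ c j, j < (U c).length ∧ i = start c + j) ∧
      ∀ c j (hj : j < (U c).length), s (start c + j) = (U c)[j] := by
  let start : ℕ → ℕ := fun c => ∑ d ∈ Finset.range c, (U d).length
  have hs : ∀ c, start (c + 1) = start c + (U c).length := fun c => Finset.sum_range_succ _ _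
  have hmono : StrictMono start := strictMono_nat_of_lt_succ fun c => by
    rw [hs]; have := List.length_pos_iff.2 (hU c); omega
  have hex : ∀ i, ∃ c j, j < (U c).length ∧ i = start c + j := by
    intro i
    have h1 : ∃ c, i < start c := ⟨i + 1, (Nat.lt_succ_self i).trans_le (hmono.le_apply)⟩
    classical
    have h2 := Nat.find_spec h1
    have h3 : Nat.find h1 ≠ 0 := fun h => by rw [h] at h2; simp [start] at h2
    obtain ⟨c, hc⟩ := Nat.exists_eq_succ_of_ne_zero h3
    have h4 : start c ≤ i := not_lt.1 (Nat.find_min h1 (m := c) (by omega))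
    rw [hc, Nat.succ_eq_add_one, hs] at h2
    exact ⟨c, i - start c, by omega, by omega⟩
  have huniq : ∀ c j c' j', j < (U c).length → j' < (U c').length →
      start c + j = start c' + j' → c = c' := by
    intro c j c' j' hj hj' h
    rcases lt_trichotomy c c' with hlt | h1 | hlt
    · have := hmono.monotone (Nat.succ_le_of_lt hlt)
      rw [Nat.succ_eq_add_one, hs] at this
      omega
    · exact h1
    · have := hmono.monotone (Nat.succ_le_of_lt hlt)
      rw [Nat.succ_eq_add_one, hs] at this
      omega
  choose cell off hoff hi using hex
  refine ⟨fun i => (U (cell i))[off i]'(hoff i), start, by simp [start], hs,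
    fun i => ⟨cell i, off i, hoff i, hi i⟩, ?_⟩
  intro c j hj
  have h1 := huniq c j _ _ hj (hoff (start c + j)) (hi (start c + j))
  have h2 : j = off (start c + j) := by
    have := hi (start c + j)
    rw [← h1] at this
    omega
  have h3 : ∀ (a b : ℕ) (ha : c = a) (hb : j = b) (hlt : b < (U a).length),
      (U a)[b] = (U c)[j] := by
    rintro a b rfl rfl _; rfl
  exact h3 _ _ h1 h2 _

/-! ### Separation of distant points of a simple closed polygon -/

theorem continuousOn_interp {n : ℕ} (hn : 0 < n) {V : ℕ → E3} (hV : ∀ i, V (i + n) = V i) :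
    ContinuousOn (interp V) (Ici 0) := by
  obtain ⟨B, hB⟩ : ∃ B : ℝ, ∀ i, ‖V (i + 1) - V i‖ ≤ B := by
    refine ⟨∑ i ∈ Finset.range n, ‖V (i + 1) - V i‖, fun i => ?_⟩
    have hper : Function.Periodic (fun i => ‖V (i + 1) - V i‖) n := fun i => by
      simp only [add_right_comm i n 1, hV]
    rw [← hper.map_mod_nat i]
    exact Finset.single_le_sum (f := fun i => ‖V (i + 1) - V i‖) (fun _ _ => norm_nonneg _)
      (Finset.mem_range.2 (Nat.mod_lt i hn))
  have hB0 : 0 ≤ B := (norm_nonneg _).trans (hB 0)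
  have : LipschitzOnWith (Real.toNNReal B) (interp V) (Ici 0) := by
    refine LipschitzOnWith.of_dist_le_mul fun u hu u' hu' => ?_
    rw [Real.coe_toNNReal _ hB0, dist_eq_norm, Real.dist_eq]
    rcases le_total u u' with h | h
    · rw [norm_sub_rev, abs_sub_comm, abs_of_nonneg (by linarith)]
      exact norm_interp_sub_le V hB hu h
    · rw [abs_of_nonneg (by linarith)]
      exact norm_interp_sub_le V hB hu' h
  exact this.continuousOn

/-- Pairs of parameters at least one unit apart in both directions around the polygon form a compact
set, on which the distance has a positive minimum. -/
theorem exists_separation {n : ℕ} {V : ℕ → E3} (hV : ∀ i, V (i + n) = V i)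
    (h : IsSimpleClosedPolygon n V) : ∃ m > 0, ∀ u u' : ℝ, 0 ≤ u → u' ≤ n → 1 ≤ u' - u →
      u' - u ≤ n - 1 → m ≤ ‖interp V u' - interp V u‖ := by
  obtain ⟨hn, hclosed, hinj⟩ := h
  have hn3 : (3 : ℝ) ≤ n := by exact_mod_cast hn
  let S : Set (ℝ × ℝ) := {q | 0 ≤ q.1 ∧ q.2 ≤ n ∧ 1 ≤ q.2 - q.1 ∧ q.2 - q.1 ≤ n - 1}
  have hS : IsCompact S := by
    have hcl : IsClosed S := by
      have c1 : IsClosed {q : ℝ × ℝ | 0 ≤ q.1} := isClosed_le (by fun_prop) (by fun_prop)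
      have c2 : IsClosed {q : ℝ × ℝ | q.2 ≤ n} := isClosed_le (by fun_prop) (by fun_prop)
      have c3 : IsClosed {q : ℝ × ℝ | 1 ≤ q.2 - q.1} := isClosed_le (by fun_prop) (by fun_prop)
      have c4 : IsClosed {q : ℝ × ℝ | q.2 - q.1 ≤ n - 1} :=
        isClosed_le (by fun_prop) (by fun_prop)
      exact c1.inter (c2.inter (c3.inter c4))
    refine (isCompact_Icc.prod isCompact_Icc :
      IsCompact (Icc (0 : ℝ) n ×ˢ Icc (0 : ℝ) n)).of_isClosed_subset hcl ?_
    rintro ⟨a, b⟩ ⟨h1, h2, h3, h4⟩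
    dsimp only at *
    exact ⟨⟨h1, by linarith⟩, ⟨by linarith, h2⟩⟩
  have hcont : ContinuousOn (fun q : ℝ × ℝ => ‖interp V q.2 - interp V q.1‖) S := by
    have hc := continuousOn_interp (by omega) hV
    refine ((hc.comp continuousOn_snd ?_).sub (hc.comp continuousOn_fst ?_)).norm
    · rintro ⟨a, b⟩ ⟨h1, h2, h3, h4⟩
      dsimp only at *
      exact mem_Ici.2 (by linarith)
    · rintro ⟨a, b⟩ ⟨h1, -⟩
      exact h1
  have hpos : ∀ q ∈ S, 0 < ‖interp V q.2 - interp V q.1‖ := by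
    rintro ⟨a, b⟩ ⟨h1, h2, h3, h4⟩
    dsimp only at *
    rw [norm_pos_iff, sub_ne_zero]
    intro he
    have key : ∀ b' : ℝ, 0 ≤ b' → b' < n → interp V b' = interp V a → b' = a := by
      intro b' hb0 hbn hba
      exact hinj ⟨hb0, hbn⟩ ⟨h1, by linarith⟩ (by
        rw [polygonPath_eq_interp V hb0, polygonPath_eq_interp V h1, hba])
    -- The parameter `n` gives the same point as `0`, outside the half-open interval on which
    -- injectivity is known.
    rcases eq_or_lt_of_le h2 with rfl | hlt
    · have h0 := interp_natCast V 0
      rw [interp_natCast, hclosed, ← h0] at he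
      push_cast at he
      have := key 0 le_rfl (by linarith) he
      linarith
    · have := key b (by linarith) hlt he
      linarith
  have hne : S.Nonempty := ⟨(0, 1), by norm_num, by dsimp only; linarith, by norm_num,
    by dsimp only; linarith⟩
  obtain ⟨q, hq, hmin⟩ := hS.exists_isMinOn hne hcont
  exact ⟨_, hpos q hq, fun u u' h1 h2 h3 h4 =>
    isMinOn_iff.1 hmin (u, u') ⟨h1, h2, h3, h4⟩⟩

/-! ### Chambers and translations -/

/-- The point `g stdCenter` lies inside a Weyl chamber whose closure contains `F`. To find it, the
coordinates of `F` are made nonnegative by signs and decreasing by a permutation; the standard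
center, proportional to `(4, 2, 1)`, is interior to the chamber of such vectors. -/
theorem exists_chamber (F : E3) : ∃ g, IsSym g ∧ g 0 = 0 ∧ ∀ n, IsRoot n →
    0 < inner ℝ (intVec n) (g stdCenter) → 0 ≤ inner ℝ (intVec n) F := by
  let τ : Equiv.Perm (Fin 3) := Tuple.sort fun j => -|F j|
  have hτ : Monotone ((fun j => -|F j|) ∘ τ) := Tuple.monotone_sort fun j => -|F j|
  let ε : Fin 3 → ℤ := fun j => if 0 ≤ F j then 1 else -1
  have hε : ∀ j, ε j = 1 ∨ ε j = -1 := fun j => by simp only [ε]; split_ifs <;> simp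
  obtain ⟨g, hg⟩ := exists_isometry_of_signs 0 τ.symm ε hε
  have hgs : IsSym g := ⟨0, τ.symm, ε, hε, by simp, hg⟩
  have hg0 : g 0 = 0 := by ext j; rw [hg]; simp
  refine ⟨g, hgs, hg0, fun n hn hpos => ?_⟩
  obtain ⟨y, hy⟩ : ∃ y : E3, y = WithLp.toLp 2 fun i => |F (τ i)| := ⟨_, rfl⟩
  have hyv : ∀ i, y i = |F (τ i)| := fun i => by rw [hy]
  have hgy : g y = F := by
    ext j
    rw [hg, hyv, Equiv.apply_symm_apply]
    simp only [ε, Pi.zero_apply]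
    split_ifs with h
    · rw [abs_of_nonneg h]; simp
    · rw [abs_of_neg (not_le.1 h)]; simp
  obtain ⟨n', c, hn', hin, -⟩ := hgs.inv.exists_root hn
  have hinv : ∀ x, g⁻¹ (g x) = x := fun x => g.symm_apply_apply x
  have hc : (c : ℝ) = 0 := by
    have h1 := hin (g 0)
    rw [hinv, hg0, inner_zero_right, inner_zero_right] at h1
    linarith
  have h1 := hin (g stdCenter)
  have h2 := hin (g y)
  rw [hinv, hc, add_zero] at h1 h2
  rw [hgy] at h2
  rw [← h1, inner_intVec] at hpos
  rw [← h2, inner_intVec]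
  have b0 := hn'.bounds 0
  have b1 := hn'.bounds 1
  have b2 := hn'.bounds 2
  have m01 : y 1 ≤ y 0 := by
    have := hτ (show (0 : Fin 3) ≤ 1 by decide)
    simp only [Function.comp, neg_le_neg_iff] at this
    rwa [hyv, hyv]
  have m12 : y 2 ≤ y 1 := by
    have := hτ (show (1 : Fin 3) ≤ 2 by decide)
    simp only [Function.comp, neg_le_neg_iff] at this
    rwa [hyv, hyv]
  have m2 : 0 ≤ y 2 := by rw [hyv]; exact abs_nonneg _
  rw [IsRoot, Fin.sum_univ_three] at hn'
  have hpos' : 0 < 4 * n' 0 + 2 * n' 1 + n' 2 := by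
    simp only [stdCenter, PiLp.toLp_apply, Matrix.cons_val] at hpos
    have : (0 : ℝ) < 4 * n' 0 + 2 * n' 1 + n' 2 := by linarith
    exact_mod_cast this
  generalize n' 0 = p at *
  generalize n' 1 = q at *
  generalize n' 2 = r at *
  obtain ⟨_, _⟩ := b0; obtain ⟨_, _⟩ := b1; obtain ⟨_, _⟩ := b2
  clear hpos h1 h2 hin
  interval_cases p <;> interval_cases q <;> interval_cases r <;> first
    | omega
    | (push_cast; linarith)

/-- Translations. -/
noncomputable def translation (v : E3) : E3 ≃ᵃⁱ[ℝ] E3 := AffineIsometryEquiv.constVAdd ℝ E3 v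

theorem translation_apply (v x : E3) : translation v x = v + x := rfl

theorem translation_add (v w : E3) : translation (v + w) = translation v * translation w := by
  ext1 x
  have : (translation v * translation w) x = translation v (translation w x) := rfl
  rw [this, translation_apply, translation_apply, translation_apply, add_assoc]

theorem isSym_translation {z : Fin 3 → ℤ} (hz : ∀ j, Even (z j)) :
    IsSym (translation (intVec z)) :=
  ⟨z, 1, 1, fun _ => Or.inl rfl, Finset.even_sum _ fun j _ => hz j, fun x j => by
    rw [translation_apply]; simp [intVec_apply]⟩

theorem mul_translation {ρ : E3 ≃ᵃⁱ[ℝ] E3} (hρ : ρ 0 = 0) (v : E3) :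
    ρ * translation v = translation (ρ v) * ρ := by
  ext1 x
  have h1 : (ρ * translation v) x = ρ (v + x) := rfl
  have h2 : (translation (ρ v) * ρ) x = ρ v + ρ x := rfl
  rw [h1, h2, isometry_apply ρ (v + x), isometry_apply ρ v, isometry_apply ρ x, hρ, map_add]
  simp

theorem IsSym.pow {f : E3 ≃ᵃⁱ[ℝ] E3} (hf : IsSym f) (n : ℕ) : IsSym (f ^ n) := by
  induction n with
  | zero => exact IsSym.one
  | succ n ih => rw [pow_succ]; exact ih.mul hf

/-- The bound is `4/8 + 2/8 + 1/8`. Being less than one, it shows that only walls through the origin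
can separate two such pyramids at the origin, and it limits the effect of a center in inner products
with roots. -/
theorem IsSym.abs_inner_le {g : E3 ≃ᵃⁱ[ℝ] E3} (hg : IsSym g) (hg0 : g 0 = 0) {n : Fin 3 → ℤ}
    (hn : IsRoot n) : |inner ℝ (intVec n) (g stdCenter)| ≤ 7 / 8 := by
  obtain ⟨n', c, hn', hin, -⟩ := hg.inv.exists_root hn
  have hinv : ∀ x, g⁻¹ (g x) = x := fun x => g.symm_apply_apply x
  have h1 := hin (g stdCenter)
  have h2 := hin (g 0)
  rw [hinv, hg0, inner_zero_right, inner_zero_right, zero_add] at h2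
  rw [hinv, ← h2, add_zero, inner_intVec] at h1
  rw [← h1]
  have b (i : Fin 3) : (-1 : ℝ) ≤ n' i ∧ (n' i : ℝ) ≤ 1 :=
    ⟨by exact_mod_cast (hn'.bounds i).1, by exact_mod_cast (hn'.bounds i).2⟩
  simp only [stdCenter, PiLp.toLp_apply, Matrix.cons_val]
  rw [abs_le]
  constructor <;> linarith [(b 0).1, (b 0).2, (b 1).1, (b 1).2, (b 2).1, (b 2).2]

theorem IsSym.le_inner_of_pos {g : E3 ≃ᵃⁱ[ℝ] E3} (hg : IsSym g) {n : Fin 3 → ℤ}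
    (h : 0 < inner ℝ (intVec n) (g stdCenter)) : 1 / 8 ≤ inner ℝ (intVec n) (g stdCenter) := by
  obtain ⟨z, hz⟩ := hg.eighths
  have h1 : 8 * inner ℝ (intVec n) (g stdCenter) = ((n 0 * z 0 + n 1 * z 1 + n 2 * z 2 : ℤ) : ℝ) := by
    push_cast
    rw [← hz 0, ← hz 1, ← hz 2, inner_intVec]
    ring
  have h2 : 0 < n 0 * z 0 + n 1 * z 1 + n 2 * z 2 := by
    have : (0 : ℝ) < ((n 0 * z 0 + n 1 * z 1 + n 2 * z 2 : ℤ) : ℝ) := by rw [← h1]; linarith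
    exact_mod_cast this
  have h3 : (1 : ℝ) ≤ ((n 0 * z 0 + n 1 * z 1 + n 2 * z 2 : ℤ) : ℝ) := by exact_mod_cast h2
  linarith

theorem norm_sym_stdCenter_le {g : E3 ≃ᵃⁱ[ℝ] E3} (hg0 : g 0 = 0) : ‖g stdCenter‖ ≤ 1 := by
  have h1 : ‖g stdCenter‖ = ‖stdCenter‖ := by
    rw [isometry_apply, hg0, add_zero, g.linearIsometryEquiv.norm_map]
  have h2 : ‖stdCenter‖ ^ 2 ≤ 1 := by
    rw [EuclideanSpace.norm_sq_eq, Fin.sum_univ_three]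
    simp [stdCenter]; norm_num
  rw [h1]
  nlinarith [norm_nonneg stdCenter]

/-! ### Galleries along lattice vectors -/

/-- A minimal word for a symmetry. -/
noncomputable def minWord (f : E3 ≃ᵃⁱ[ℝ] E3) : List Color :=
  open Classical in if h : IsSym f then (exists_minimal_word f h).choose else []

theorem isMinimalWord_minWord {f : E3 ≃ᵃⁱ[ℝ] E3} (hf : IsSym f) : IsMinimalWord (minWord f) f := by
  rw [minWord, dif_pos hf]
  exact (exists_minimal_word f hf).choose_spec

/-- The minimal gallery of `f` is transported by `H`; roots, levels and separation are carried
along. -/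
theorem minWord_step {H f : E3 ≃ᵃⁱ[ℝ] E3} (hH : IsSym H) (hf : IsSym f) {u v : List Color}
    {s : Color} (h : minWord f = u ++ s :: v) :
    ∃ (n : Fin 3 → ℤ) (k : ℤ) (μ : ℝ), IsRoot n ∧ 1 / 8 ≤ μ ∧
      (H * wordSymmetry stdPyramid u).linearIsometryEquiv (stdReflection s stdCenter - stdCenter) =
        μ • intVec n ∧
      inner ℝ (intVec n) (H stdCenter) < k ∧ k < inner ℝ (intVec n) (H (f stdCenter)) := by
  obtain ⟨n, k, μ, hn, hμ, hlin, h1, h2⟩ := (isMinimalWord_minWord hf).2 u s v h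
  obtain ⟨n', c, hn', hin, hln⟩ := hH.exists_root hn
  refine ⟨n', k + c, μ, hn', hμ, ?_, ?_, ?_⟩
  · rw [mul_linearIsometryEquiv, hlin, map_smul, hln]
  · rw [hin]; push_cast; linarith
  · rw [hin]; push_cast; linarith

/-- A vector with even integer coordinates. -/
def IsEvenVec (v : E3) : Prop := ∃ z : Fin 3 → ℤ, (∀ j, Even (z j)) ∧ v = intVec z

theorem IsEvenVec.isSym {v : E3} (hv : IsEvenVec v) : IsSym (translation v) := by
  obtain ⟨z, hz, rfl⟩ := hv
  exact isSym_translation hz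

theorem IsEvenVec.inner_eq {v : E3} (hv : IsEvenVec v) (n : Fin 3 → ℤ) :
    ∃ q : ℤ, inner ℝ (intVec n) v = q := by
  obtain ⟨z, hz, rfl⟩ := hv
  refine ⟨n 0 * z 0 + n 1 * z 1 + n 2 * z 2, ?_⟩
  rw [inner_intVec]; simp [intVec_apply]

theorem IsEvenVec.add {v w : E3} (hv : IsEvenVec v) (hw : IsEvenVec w) : IsEvenVec (v + w) := by
  obtain ⟨y, hy, rfl⟩ := hv
  obtain ⟨z, hz, rfl⟩ := hw
  exact ⟨y + z, fun j => (hy j).add (hz j), by ext j; simp [intVec_apply]⟩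

theorem IsEvenVec.sub {v w : E3} (hv : IsEvenVec v) (hw : IsEvenVec w) : IsEvenVec (v - w) := by
  obtain ⟨y, hy, rfl⟩ := hv
  obtain ⟨z, hz, rfl⟩ := hw
  exact ⟨y - z, fun j => (hy j).sub (hz j), by ext j; simp [intVec_apply]⟩

theorem IsEvenVec.natCast_smul {v : E3} (hv : IsEvenVec v) (N : ℕ) :
    IsEvenVec ((N : ℝ) • v) := by
  obtain ⟨y, hy, rfl⟩ := hv
  exact ⟨fun j => N * y j, fun j => (hy j).mul_left _, by ext j; simp [intVec_apply]⟩

/-- A word leading from a pyramid to its translate by `F`, and from there to another pyramid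
having a vertex in common with it. -/
noncomputable def cellWord (g : E3 ≃ᵃⁱ[ℝ] E3) (F : E3) (g' : E3 ≃ᵃⁱ[ℝ] E3) : List Color :=
  minWord (g⁻¹ * translation F * g) ++ minWord (g⁻¹ * g')

theorem wordSymmetry_append (u v : List Color) : wordSymmetry stdPyramid (u ++ v) =
    wordSymmetry stdPyramid u * wordSymmetry stdPyramid v := by
  simp [wordSymmetry]

section CellWord

variable {g g' : E3 ≃ᵃⁱ[ℝ] E3} {X F : E3}

theorem translation_mul_cellWord_left (hg : IsSym g) (hF : IsEvenVec F) :
    translation X * g * wordSymmetry stdPyramid (minWord (g⁻¹ * translation F * g)) =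
      translation (X + F) * g := by
  rw [(isMinimalWord_minWord ((hg.inv.mul hF.isSym).mul hg)).1, translation_add]
  group

theorem translation_mul_cellWord (hg : IsSym g) (hg' : IsSym g') (hF : IsEvenVec F) :
    translation X * g * wordSymmetry stdPyramid (cellWord g F g') = translation (X + F) * g' := by
  rw [cellWord, wordSymmetry_append, ← mul_assoc, translation_mul_cellWord_left hg hF,
    (isMinimalWord_minWord (hg.inv.mul hg')).1]
  group

theorem cellWord_ne_nil (hg : IsSym g) (hF : IsEvenVec F) (hF0 : F ≠ 0) :
    cellWord g F g' ≠ [] := by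
  intro h
  rw [cellWord, List.append_eq_nil_iff] at h
  have h1 := translation_mul_cellWord_left (X := 0) hg hF
  rw [h.1] at h1
  have h2 : translation 0 * g = translation (0 + F) * g := by
    rw [← h1]; simp [wordSymmetry]
  have h3 := congrArg (fun f : E3 ≃ᵃⁱ[ℝ] E3 => f 0) (mul_right_cancel h2)
  simp only [translation_apply] at h3
  apply hF0
  simpa using h3.symm

/-- In the translation part, the wall separates a pyramid from its translate by `F`, so the integer
`⟨n, F⟩` is positive. In the turning part, both pyramids have the vertex `X + F` and roots take
values of size less than one on their centers relative to it, so the wall passes through that vertex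
and separates the two directions. -/
theorem cellWord_step (hg : IsSym g) (hg' : IsSym g') (hg0 : g 0 = 0) (hg0' : g' 0 = 0)
    (hX : IsEvenVec X) (hF : IsEvenVec F) {u v : List Color} {s : Color}
    (h : cellWord g F g' = u ++ s :: v) :
    ∃ (n : Fin 3 → ℤ) (μ : ℝ), IsRoot n ∧ 1 / 8 ≤ μ ∧
      (translation X * g * wordSymmetry stdPyramid u).linearIsometryEquiv
        (stdReflection s stdCenter - stdCenter) = μ • intVec n ∧
      (1 ≤ inner ℝ (intVec n) F ∨
        inner ℝ (intVec n) (g stdCenter) < 0 ∧ 0 < inner ℝ (intVec n) (g' stdCenter)) := by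
  have first {u v : List Color} (h : minWord (g⁻¹ * translation F * g) = u ++ s :: v) :
      ∃ (n : Fin 3 → ℤ) (μ : ℝ), IsRoot n ∧ 1 / 8 ≤ μ ∧
      (translation X * g * wordSymmetry stdPyramid u).linearIsometryEquiv
        (stdReflection s stdCenter - stdCenter) = μ • intVec n ∧
      (1 ≤ inner ℝ (intVec n) F ∨
        inner ℝ (intVec n) (g stdCenter) < 0 ∧ 0 < inner ℝ (intVec n) (g' stdCenter)) := by
    obtain ⟨n, k, μ, hn, hμ, hlin, h1, h2⟩ :=
      minWord_step (hX.isSym.mul hg) ((hg.inv.mul hF.isSym).mul hg) h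
    refine ⟨n, μ, hn, hμ, hlin, Or.inl ?_⟩
    have e1 : (translation X * g) ((g⁻¹ * translation F * g) stdCenter) =
        X + (F + g stdCenter) := by
      have : translation X * g * (g⁻¹ * translation F * g) = translation X * (translation F * g) := by
        group
      exact congrArg (fun f : E3 ≃ᵃⁱ[ℝ] E3 => f stdCenter) this
    have e2 : (translation X * g) stdCenter = X + g stdCenter := rfl
    rw [e1, inner_add_right, inner_add_right] at h2
    rw [e2, inner_add_right] at h1
    obtain ⟨q, hq⟩ := hF.inner_eq n
    have h3 : (0 : ℝ) < q := by rw [← hq]; linarith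
    rw [hq]
    exact_mod_cast h3
  have second {u v : List Color} (h : minWord (g⁻¹ * g') = u ++ s :: v) :
      ∃ (n : Fin 3 → ℤ) (μ : ℝ), IsRoot n ∧ 1 / 8 ≤ μ ∧
      (translation X * g * wordSymmetry stdPyramid (minWord (g⁻¹ * translation F * g) ++ u)
        ).linearIsometryEquiv (stdReflection s stdCenter - stdCenter) = μ • intVec n ∧
      (1 ≤ inner ℝ (intVec n) F ∨
        inner ℝ (intVec n) (g stdCenter) < 0 ∧ 0 < inner ℝ (intVec n) (g' stdCenter)) := by
    have hXF := hX.add hF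
    obtain ⟨n, k, μ, hn, hμ, hlin, h1, h2⟩ :=
      minWord_step (hXF.isSym.mul hg) (hg.inv.mul hg') h
    refine ⟨n, μ, hn, hμ, ?_, Or.inr ?_⟩
    · rw [wordSymmetry_append, ← mul_assoc, translation_mul_cellWord_left hg hF, hlin]
    have e1 : (translation (X + F) * g) ((g⁻¹ * g') stdCenter) = (X + F) + g' stdCenter := by
      have : translation (X + F) * g * (g⁻¹ * g') = translation (X + F) * g' := by group
      exact congrArg (fun f : E3 ≃ᵃⁱ[ℝ] E3 => f stdCenter) this
    have e2 : (translation (X + F) * g) stdCenter = (X + F) + g stdCenter := rfl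
    rw [e1, inner_add_right] at h2
    rw [e2, inner_add_right] at h1
    obtain ⟨q, hq⟩ := hXF.inner_eq n
    have b1 := abs_le.1 (hg.abs_inner_le hg0 hn)
    have b2 := abs_le.1 (hg'.abs_inner_le hg0' hn)
    rw [hq] at h1 h2
    -- The level of the wall is within distance less than one of the integer `⟨n, X + F⟩`.
    have hk : k = q := by
      have c1 : (k : ℝ) < q + 1 := by linarith
      have c2 : (q : ℝ) < k + 1 := by linarith
      have c1' : k < q + 1 := by exact_mod_cast c1
      have c2' : q < k + 1 := by exact_mod_cast c2
      omega
    rw [hk] at h1 h2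
    constructor <;> linarith
  rw [cellWord, List.append_eq_append_iff] at h
  rcases h with ⟨a, rfl, h⟩ | ⟨c, hc, h⟩
  · exact second h
  · rcases c with _ | ⟨c0, c⟩
    · rw [List.nil_append] at h
      have := second (u := []) h.symm
      rw [List.append_nil] at this hc
      rwa [hc] at this
    · simp only [List.cons_append, List.cons.injEq] at h
      obtain ⟨rfl, h⟩ := h
      exact first hc

end CellWord

/-- A simple closed polygon through lattice points with threefold symmetry that turns slowly, so
that consecutive edges lie in a common closed Weyl chamber. -/
structure IsLatticeLoop (ρ : E3 ≃ᵃⁱ[ℝ] E3) (m : ℕ) (V : ℕ → E3) : Prop where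
  two_le : 2 ≤ m
  even : ∀ k, IsEvenVec (V k)
  shift : ∀ k, V (k + m) = ρ (V k)
  ne : ∀ k, V (k + 1) - V k ≠ 0
  compat : ∀ k n, IsRoot n → 0 ≤ inner ℝ (intVec n) (V (k + 1) - V k) *
    inner ℝ (intVec n) (V (k + 2) - V (k + 1))
  -- Near the vertices at which the gallery changes its chamber the polygon is straight: the two
  -- edges before such a vertex and the one after it are positively parallel.
  parallel : ∀ k, m ∣ k + 2 → ∃ c c' : ℝ, 0 < c ∧ 0 < c' ∧
    V (k + 2) - V (k + 1) = c • (V (k + 3) - V (k + 2)) ∧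
    V (k + 1) - V k = c' • (V (k + 3) - V (k + 2))
  simple : IsSimpleClosedPolygon (3 * m) V

/-! ### Galleries along lattice loops -/

theorem exists_bound_of_periodic (a : ℕ → ℝ) {n : ℕ} (hn : 0 < n) (ha : ∀ k, a (k + n) = a k) :
    ∃ B, 0 ≤ B ∧ ∀ k, a k ≤ B := by
  refine ⟨∑ i ∈ Finset.range n, |a i|, Finset.sum_nonneg fun _ _ => abs_nonneg _, fun k => ?_⟩
  have hper : Function.Periodic a n := ha
  rw [← hper.map_mod_nat k]
  exact (le_abs_self _).trans (Finset.single_le_sum (f := fun i => |a i|)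
    (fun _ _ => abs_nonneg _) (Finset.mem_range.2 (Nat.mod_lt k hn)))

theorem mul_letterProd_concatenation {H : ℕ → (E3 ≃ᵃⁱ[ℝ] E3)} {U : ℕ → List Color}
    (hH : ∀ c, H c * wordSymmetry stdPyramid (U c) = H (c + 1)) {s : ℕ → Color} {start : ℕ → ℕ}
    (h0 : start 0 = 0) (hstart : ∀ c, start (c + 1) = start c + (U c).length)
    (hs : ∀ c j (hj : j < (U c).length), s (start c + j) = (U c)[j]) (c j : ℕ)
    (hj : j ≤ (U c).length) :
    H 0 * letterProd stdPyramid s (start c + j) =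
      H c * wordSymmetry stdPyramid ((U c).take j) := by
  have hcell : ∀ c j, j ≤ (U c).length →
      letterProd stdPyramid (fun i => s (start c + i)) j =
        wordSymmetry stdPyramid ((U c).take j) := by
    intro c j hj
    rw [← wordSymmetry_map_range]
    congr 1
    apply List.ext_getElem
    · simp [hj]
    · intro i h1 h2
      simp only [List.length_map, List.length_range] at h1
      simp only [List.getElem_map, List.getElem_range, List.getElem_take]
      exact hs c i (by omega)
  have hcells : ∀ c, H 0 * letterProd stdPyramid s (start c) = H c := by
    intro c
    induction c with
    | zero => rw [h0, letterProd, mul_one]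
    | succ c ih =>
      rw [hstart, letterProd_add, ← mul_assoc, ih, hcell c _ le_rfl, List.take_length, hH]
  rw [letterProd_add, ← mul_assoc, hcells, hcell c j hj]

theorem le_norm_of_isEvenVec {F : E3} (hF : IsEvenVec F) (hF0 : F ≠ 0) : 2 ≤ ‖F‖ := by
  obtain ⟨z, hz, rfl⟩ := hF
  obtain ⟨j, hj⟩ : ∃ j, z j ≠ 0 := by
    by_contra hcon
    push Not at hcon
    exact hF0 (by ext j; simp [intVec_apply, hcon j])
  obtain ⟨r, hr⟩ := hz j
  have h1 : ‖intVec z j‖ ≤ ‖intVec z‖ := PiLp.norm_apply_le _ j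
  rw [intVec_apply, Real.norm_eq_abs] at h1
  have h2 : (2 : ℤ) ≤ |z j| := by
    rcases abs_cases (z j) with ⟨h, _⟩ | ⟨h, _⟩ <;> omega
  have h3 : (2 : ℝ) ≤ |(z j : ℝ)| := by exact_mod_cast h2
  linarith

namespace IsLatticeLoop

variable {ρ : E3 ≃ᵃⁱ[ℝ] E3} {m : ℕ} {V : ℕ → E3}

theorem map_sub_of_fixed (hρ0 : ρ 0 = 0) (x y : E3) : ρ (x - y) = ρ x - ρ y := by
  rw [isometry_apply ρ (x - y), isometry_apply ρ x, isometry_apply ρ y, map_sub, hρ0]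
  simp

theorem edge_shift (h : IsLatticeLoop ρ m V) (hρ0 : ρ 0 = 0) (k : ℕ) :
    V (k + m + 1) - V (k + m) = ρ (V (k + 1) - V k) := by
  rw [map_sub_of_fixed hρ0, ← h.shift, ← h.shift, add_right_comm]

theorem isEvenVec_edge (h : IsLatticeLoop ρ m V) (k : ℕ) : IsEvenVec (V (k + 1) - V k) :=
  (h.even _).sub (h.even _)

theorem pow_fixed (hρ0 : ρ 0 = 0) (q : ℕ) : (ρ ^ q) 0 = 0 := by
  induction q with
  | zero => rfl
  | succ q ih =>
    rw [pow_succ]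
    change (ρ ^ q) (ρ 0) = 0
    rw [hρ0, ih]

/-- The closed chamber of `g` contains the first edge; applying `ρ ^ q` gives a chamber containing
the first edge of the later thirds. -/
theorem chamber_shift (h : IsLatticeLoop ρ m V) (hρ : IsSym ρ) (hρ0 : ρ 0 = 0)
    {g : E3 ≃ᵃⁱ[ℝ] E3} (hg : ∀ n, IsRoot n → 0 < inner ℝ (intVec n) (g stdCenter) →
      0 ≤ inner ℝ (intVec n) (V 1 - V 0)) (q : ℕ) :
    ∀ n, IsRoot n → 0 < inner ℝ (intVec n) ((ρ ^ q * g) stdCenter) →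
      0 ≤ inner ℝ (intVec n) (V (m * q + 1) - V (m * q)) := by
  induction q with
  | zero => intro n hn; simpa using hg n hn
  | succ q ih =>
    intro n hn hpos
    obtain ⟨n', c, hn', hin, -⟩ := hρ.inv.exists_root hn
    have hinv : ∀ x, ρ⁻¹ (ρ x) = x := fun x => ρ.symm_apply_apply x
    have h0 := hin (ρ 0)
    rw [hinv, hρ0, inner_zero_right, inner_zero_right, zero_add] at h0
    have key : ∀ x, inner ℝ (intVec n) (ρ x) = inner ℝ (intVec n') x := by
      intro x
      have := hin (ρ x)
      rw [hinv, ← h0, add_zero] at this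
      exact this.symm
    have e1 : (ρ ^ (q + 1) * g) stdCenter = ρ ((ρ ^ q * g) stdCenter) := by
      rw [pow_succ', mul_assoc]; rfl
    rw [e1, key] at hpos
    have := ih n' hn' hpos
    rw [show m * (q + 1) = m * q + m by ring, h.edge_shift hρ0, key]
    exact this

/-- The edges near a vertex point to the same side as the direction `d`. -/
theorem le_inner_direction (h : IsLatticeLoop ρ m V) (hρ : IsSym ρ) (hρ0 : ρ 0 = 0)
    {g : E3 ≃ᵃⁱ[ℝ] E3} (hgs : IsSym g) (hg0 : g 0 = 0)
    (hg : ∀ n, IsRoot n → 0 < inner ℝ (intVec n) (g stdCenter) →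
      0 ≤ inner ℝ (intVec n) (V 1 - V 0)) {k c c' : ℕ} (hc : c = k ∨ c = k + 1)
    (hc' : c' = c ∨ c' = c + 1) {n : Fin 3 → ℤ} (hn : IsRoot n)
    (hn' : 1 ≤ inner ℝ (intVec n) (V (c + 1) - V c) ∨
      inner ℝ (intVec n) ((ρ ^ (c / m) * g) stdCenter) < 0 ∧
        0 < inner ℝ (intVec n) ((ρ ^ (c' / m) * g) stdCenter)) :
    1 / 8 ≤ inner ℝ (intVec n) ((V (k + 1) - V k) + (V (k + 2) - V (k + 1)) +
      (ρ ^ ((k + 2) / m) * g) stdCenter) := by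
  have hm := h.two_le
  have hsym : ∀ q, IsSym (ρ ^ q * g) := fun q => (hρ.pow q).mul hgs
  have hfix : ∀ q, (ρ ^ q * g) 0 = 0 := fun q => by
    change (ρ ^ q) (g 0) = 0
    rw [hg0, pow_fixed hρ0]
  have hcomp := h.compat k n hn
  rw [inner_add_right, inner_add_right]
  rcases hn' with h1 | ⟨h1, h2⟩
  -- A translation step: one edge contributes at least `1`, the other a nonnegative amount by
  -- `compat`, and the center at least `-7/8`.
  · have h3 := abs_le.1 ((hsym ((k + 2) / m)).abs_inner_le (hfix _) hn)
    rcases hc with rfl | rfl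
    · have : 0 ≤ inner ℝ (intVec n) (V (c + 2) - V (c + 1)) := by
        by_contra hcon
        push Not at hcon
        nlinarith
      linarith
    · have : 0 ≤ inner ℝ (intVec n) (V (k + 1) - V k) := by
        by_contra hcon
        push Not at hcon
        have h1' : 1 ≤ inner ℝ (intVec n) (V (k + 2) - V (k + 1)) := h1
        nlinarith
      have h1' : 1 ≤ inner ℝ (intVec n) (V (k + 2) - V (k + 1)) := h1
      linarith
  -- A turning step: it can occur only at a multiple `c'` of `m`. The edge leaving `V c'` lies in
  -- the closed new chamber, so its product with `n` is nonnegative, and so are those of the edges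
  -- parallel to it; the new center contributes at least `1/8`.
  · have hc1 : c' = c + 1 := by
      rcases hc' with rfl | h3
      · linarith
      · exact h3
    have hdvd : m ∣ c' := by
      by_contra hnd
      have : c' / m = c / m := by rw [hc1] at hnd ⊢; exact Nat.succ_div_of_not_dvd hnd
      rw [this] at h2
      linarith
    have hF : 0 ≤ inner ℝ (intVec n) (V (c' + 1) - V c') := by
      obtain ⟨q, hq⟩ := hdvd
      have h3 := h.chamber_shift hρ hρ0 hg q n hn
      rw [hq, Nat.mul_div_cancel_left _ (by omega)] at h2
      rw [hq]
      exact h3 h2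
    have h8 := (hsym (c' / m)).le_inner_of_pos h2
    rcases hc with rfl | rfl
    -- The chamber used in the direction is that of index `k + 2`; since `2 ≤ m`, it does not change
    -- again between `c + 1` and `c + 2`.
    · have hc2 : (c + 2) / m = c' / m := by
        have hnd : ¬ m ∣ c' + 1 := fun hd => by
          have := (Nat.dvd_add_right hdvd).1 hd
          have := Nat.le_of_dvd one_pos this
          omega
        rw [← Nat.succ_div_of_not_dvd hnd, hc1]
      have hcpos : 1 ≤ c := by
        rcases Nat.eq_zero_or_pos c with h0 | h0
        · rw [hc1, h0] at hdvd
          have := Nat.le_of_dvd one_pos hdvd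
          omega
        · exact h0
      obtain ⟨j, rfl⟩ : ∃ j, c = j + 1 := ⟨c - 1, by omega⟩
      rw [hc1] at hdvd hF
      obtain ⟨a, a', ha, ha', e1, e2⟩ := h.parallel j hdvd
      rw [hc2]
      have e3 : V (j + 1 + 1) - V (j + 1) = a • (V (j + 3) - V (j + 2)) := e1
      have hF' : 0 ≤ inner ℝ (intVec n) (V (j + 3) - V (j + 2)) := hF
      have hF'' : 0 ≤ inner ℝ (intVec n) (V (j + 1 + 2) - V (j + 1 + 1)) := hF
      rw [e3, inner_smul_right]
      have := mul_nonneg ha.le hF'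
      linarith
    · have hck : c' = k + 2 := by omega
      rw [hck] at hdvd hF h8
      obtain ⟨a, a', ha, ha', e1, e2⟩ := h.parallel k hdvd
      have hF' : 0 ≤ inner ℝ (intVec n) (V (k + 3) - V (k + 2)) := hF
      rw [e1, e2, inner_smul_right, inner_smul_right]
      have := mul_nonneg ha.le hF'
      have := mul_nonneg ha'.le hF'
      linarith

/-- The coordinate vectors are roots, so the products of corresponding coordinates are already
nonnegative. -/
theorem inner_edges_nonneg (h : IsLatticeLoop ρ m V) (k : ℕ) :
    0 ≤ inner ℝ (V (k + 1) - V k) (V (k + 2) - V (k + 1)) := by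
  have hcoord (i : Fin 3) : 0 ≤ (V (k + 1) - V k) i * (V (k + 2) - V (k + 1)) i := by
    have hr : IsRoot (Pi.single i 1) := by
      left; fin_cases i <;> simp [Fin.sum_univ_three]
    have := h.compat k _ hr
    rw [inner_intVec, inner_intVec] at this
    fin_cases i <;> simpa using this
  rw [PiLp.inner_apply, Fin.sum_univ_three]
  simp only [RCLike.inner_apply, conj_trivial]
  linarith [hcoord 0, hcoord 1, hcoord 2]

/-- A nonzero even vector `F` has norm at least `2`, so `‖F‖² - ‖F‖` is bounded below. The weak
constant `1/64` is the rate available for the gallery, namely step length `1/8` times inner product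
`1/8`. -/
theorem le_inner_edge (h : IsLatticeLoop ρ m V) {k c : ℕ} (hc : c = k ∨ c = k + 1) {e : E3}
    (he : ‖e‖ ≤ 1) : 1 / 64 ≤ inner ℝ (V (c + 1) - V c)
      ((V (k + 1) - V k) + (V (k + 2) - V (k + 1)) + e) := by
  have h1 := le_norm_of_isEvenVec (h.isEvenVec_edge c) (h.ne c)
  have h2 := neg_le_of_abs_le (abs_real_inner_le_norm (V (c + 1) - V c) e)
  have h3 := h.inner_edges_nonneg k
  have h5 : ‖V (c + 1) - V c‖ * ‖e‖ ≤ ‖V (c + 1) - V c‖ * 1 :=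
    mul_le_mul_of_nonneg_left he (norm_nonneg _)
  rw [inner_add_right, inner_add_right]
  rcases hc with rfl | rfl
  · rw [real_inner_self_eq_norm_sq]
    nlinarith
  · have e1 : V (k + 1 + 1) - V (k + 1) = V (k + 2) - V (k + 1) := rfl
    rw [e1] at *
    rw [real_inner_self_eq_norm_sq, real_inner_comm]
    nlinarith

end IsLatticeLoop

/-- The points dividing each edge of `N • V` into `N` equal parts. -/
noncomputable def subdivision (V : ℕ → E3) (N c : ℕ) : E3 :=
  (N : ℝ) • V (c / N) + ((c % N : ℕ) : ℝ) • (V (c / N + 1) - V (c / N))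

theorem succ_div_mod {N : ℕ} (hN : 0 < N) (c : ℕ) :
    ((c + 1) / N = c / N ∧ (c + 1) % N = c % N + 1) ∨
      ((c + 1) / N = c / N + 1 ∧ (c + 1) % N = 0 ∧ c % N + 1 = N) := by
  have h1 := Nat.div_add_mod c N
  have h2 := Nat.mod_lt c hN
  rcases Nat.lt_or_ge (c % N + 1) N with h | h
  · left
    have e : c + 1 = (c % N + 1) + N * (c / N) := by omega
    constructor
    · rw [e, Nat.add_mul_div_left _ _ hN, Nat.div_eq_of_lt h]; omega
    · rw [e, Nat.add_mul_mod_self_left, Nat.mod_eq_of_lt h]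
  · right
    have e : c + 1 = 0 + N * (c / N + 1) := by rw [Nat.mul_add]; omega
    refine ⟨?_, ?_, by omega⟩
    · rw [e, Nat.add_mul_div_left _ _ hN]; simp
    · rw [e, Nat.add_mul_mod_self_left]; simp

theorem subdivision_succ (V : ℕ → E3) {N : ℕ} (hN : 0 < N) (c : ℕ) :
    subdivision V N (c + 1) = subdivision V N c + (V (c / N + 1) - V (c / N)) := by
  rw [subdivision, subdivision]
  rcases succ_div_mod hN c with ⟨h1, h2⟩ | ⟨h1, h2, h3⟩
  · rw [h1, h2]; push_cast; module
  · rw [h1, h2]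
    have h4 : (N : ℝ) = ((c % N : ℕ) : ℝ) + 1 := by exact_mod_cast h3.symm
    rw [h4]; push_cast; module

theorem interp_subdivision (V : ℕ → E3) {N : ℕ} (hN : 0 < N) {t : ℝ} (ht : 0 ≤ t) :
    interp (subdivision V N) t = (N : ℝ) • interp V (t / N) := by
  have hN0 : (0 : ℝ) < N := by exact_mod_cast hN
  have h1 := Nat.floor_le ht
  have h2 := Nat.lt_floor_add_one t
  set c := ⌊t⌋₊ with hc
  have h3 : (c : ℝ) = N * ((c / N : ℕ) : ℝ) + ((c % N : ℕ) : ℝ) := by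
    exact_mod_cast (Nat.div_add_mod c N).symm
  have h4 : (((c % N : ℕ) : ℝ)) + 1 ≤ N := by exact_mod_cast Nat.mod_lt c hN
  have h5 : (0 : ℝ) ≤ ((c % N : ℕ) : ℝ) := Nat.cast_nonneg _
  rw [interp_of_mem (subdivision V N) h1 h2.le, subdivision_succ V hN,
    interp_of_mem V (k := c / N) (t := t / N)
      (by rw [le_div_iff₀ hN0]; linarith) (by rw [div_le_iff₀ hN0]; linarith), subdivision]
  have h6 : (N : ℝ) * (t / N - ((c / N : ℕ) : ℝ)) = ((c % N : ℕ) : ℝ) + (t - c) := by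
    field_simp; linarith
  rw [smul_add, smul_smul, h6]
  module

/-! ### The gallery along a multiple of a lattice loop, cell by cell. -/

namespace IsLatticeLoop

variable {ρ : E3 ≃ᵃⁱ[ℝ] E3} {m : ℕ} {V : ℕ → E3}

/-- The `c`-th cell word leads from the pyramid at `subdivision V N c` to the one at the next point.
After `m * N` cells the pyramid has been moved by `ρ`, and the letters repeat because words are read
relative to the current pyramid. -/
theorem exists_cells (h : IsLatticeLoop ρ m V) (hρ : IsSym ρ) (hρ0 : ρ 0 = 0)
    {g : E3 ≃ᵃⁱ[ℝ] E3} (hgs : IsSym g) (hg0 : g 0 = 0) {L : ℝ}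
    (hL : ∀ k k', k' = k ∨ k' = k + 1 →
      ((cellWord (ρ ^ (k / m) * g) (V (k + 1) - V k) (ρ ^ (k' / m) * g)).length : ℝ) ≤ L)
    {N : ℕ} (hN : 0 < N) :
    ∃ (H : E3 ≃ᵃⁱ[ℝ] E3) (s : ℕ → Color) (start : ℕ → ℕ), IsSym H ∧ start 0 = 0 ∧
      (∀ c, start c + 1 ≤ start (c + 1)) ∧ (∀ c, ((start (c + 1) : ℕ) : ℝ) - start c ≤ L) ∧
      (∀ c, start (c + m * N) = start c + start (m * N)) ∧
      (∀ i, s (i + start (m * N)) = s i) ∧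
      H * letterProd stdPyramid s (start (m * N)) = ρ * H ∧
      (∀ c, (H * letterProd stdPyramid s (start c)) stdCenter =
        subdivision V N c + (ρ ^ (c / N / m) * g) stdCenter) ∧
      (∀ i, ‖(H * letterProd stdPyramid s (i + 1)) stdCenter -
        (H * letterProd stdPyramid s i) stdCenter‖ ≤ 1) ∧
      ∀ i, ∃ c, start c ≤ i ∧ i < start (c + 1) ∧ ∃ (n : Fin 3 → ℤ) (μ : ℝ), IsRoot n ∧
        1 / 8 ≤ μ ∧ (H * letterProd stdPyramid s (i + 1)) stdCenter -
          (H * letterProd stdPyramid s i) stdCenter = μ • intVec n ∧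
        (1 ≤ inner ℝ (intVec n) (V (c / N + 1) - V (c / N)) ∨
          inner ℝ (intVec n) ((ρ ^ (c / N / m) * g) stdCenter) < 0 ∧
          0 < inner ℝ (intVec n) ((ρ ^ ((c + 1) / N / m) * g) stdCenter)) := by
  have hm := h.two_le
  have hsym : ∀ q, IsSym (ρ ^ q * g) := fun q => (hρ.pow q).mul hgs
  have hfix : ∀ q, (ρ ^ q * g) 0 = 0 := fun q => by
    change (ρ ^ q) (g 0) = 0
    rw [hg0, pow_fixed hρ0]
  have hX : ∀ c, IsEvenVec (subdivision V N c) := fun c =>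
    ((h.even _).natCast_smul N).add ((h.isEvenVec_edge _).natCast_smul _)
  set U : ℕ → List Color := fun c => cellWord (ρ ^ (c / N / m) * g) (V (c / N + 1) - V (c / N))
    (ρ ^ ((c + 1) / N / m) * g) with hU
  set H : ℕ → (E3 ≃ᵃⁱ[ℝ] E3) := fun c => translation (subdivision V N c) * (ρ ^ (c / N / m) * g)
    with hH
  have hHU : ∀ c, H c * wordSymmetry stdPyramid (U c) = H (c + 1) := by
    intro c
    simp only [hH, hU]
    rw [translation_mul_cellWord (hsym _) (hsym _) (h.isEvenVec_edge _), subdivision_succ V hN]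
  have hUne : ∀ c, U c ≠ [] := fun c => cellWord_ne_nil (hsym _) (h.isEvenVec_edge _) (h.ne _)
  have hdiv : ∀ c, (c + m * N) / N = c / N + m := fun c => Nat.add_mul_div_right _ _ hN
  have hdivm : ∀ c, (c + m) / m = c / m + 1 := fun c => Nat.add_div_right _ (by omega)
  -- Both relative positions `g⁻¹ * translation F * g` and `g⁻¹ * g'` are unchanged when the data
  -- are moved by `ρ`.
  have hUper : ∀ c, U (c + m * N) = U c := by
    intro c
    simp only [hU]
    rw [add_right_comm, hdiv, hdiv, hdivm, hdivm, h.edge_shift hρ0, pow_succ', pow_succ', cellWord,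
      cellWord]
    have e : translation (ρ (V (c / N + 1) - V (c / N))) =
        ρ * translation (V (c / N + 1) - V (c / N)) * ρ⁻¹ := by
      rw [mul_translation hρ0]; group
    congr 2
    · rw [e]; group
    · group
  have hLU : ∀ c, ((U c).length : ℝ) ≤ L := by
    intro c
    refine hL (c / N) ((c + 1) / N) ?_
    rcases succ_div_mod hN c with ⟨h1, -⟩ | ⟨h1, -⟩
    · exact Or.inl h1
    · exact Or.inr h1
  obtain ⟨s, start, hs0, hss, hcell, hsU⟩ := exists_concatenation U hUne
  have hkey := mul_letterProd_concatenation hHU hs0 hss hsU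
  have hkey0 : ∀ c, H 0 * letterProd stdPyramid s (start c) = H c := by
    intro c
    have := hkey c 0 (Nat.zero_le _)
    simpa [wordSymmetry] using this
  have hsper : ∀ c, start (c + m * N) = start c + start (m * N) := by
    intro c
    induction c with
    | zero => rw [hs0]; simp
    | succ c ih => rw [add_right_comm, hss, hss, ih, hUper]; omega
  have hlen : ∀ c, 0 < (U c).length := fun c => List.length_pos_iff.2 (hUne c)
  have hstepeq : ∀ i, (H 0 * letterProd stdPyramid s (i + 1)) stdCenter -
      (H 0 * letterProd stdPyramid s i) stdCenter =
      (H 0 * letterProd stdPyramid s i).linearIsometryEquiv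
        (stdReflection (s i) stdCenter - stdCenter) := by
    intro i
    rw [← isometry_sub, letterProd, ← mul_assoc]
    rfl
  refine ⟨H 0, s, start, (hX 0).isSym.mul (hsym _), hs0, fun c => ?_, fun c => ?_, hsper,
    fun i => ?_, ?_, fun c => ?_, fun i => ?_, fun i => ?_⟩
  · rw [hss]; have := hlen c; omega
  · rw [hss]; push_cast; linarith [hLU c]
  · obtain ⟨c, j, hj, rfl⟩ := hcell i
    have hj' : j < (U (c + m * N)).length := by rw [hUper]; exact hj
    rw [add_right_comm, ← hsper, hsU _ _ hj', hsU c j hj]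
    congr 1
    exact hUper c
  · rw [hkey0]
    simp only [hH]
    have h1 : m * N / N = m := Nat.mul_div_cancel _ hN
    have h2 : subdivision V N (m * N) = ρ (subdivision V N 0) := by
      have h3 := h.shift 0
      rw [zero_add] at h3
      simp only [subdivision, h1, Nat.mul_mod_left, Nat.zero_div, Nat.zero_mod, Nat.cast_zero,
        zero_smul, add_zero, h3]
      rw [isometry_apply ρ (V 0), isometry_apply ρ ((N : ℝ) • V 0), hρ0, map_smul]
      simp
    rw [h1, Nat.div_self (by omega), h2, ← mul_assoc, pow_one, ← mul_translation hρ0]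
    simp [mul_assoc]
  · rw [hkey0]; rfl
  · rw [hstepeq, LinearIsometryEquiv.norm_map]
    exact norm_stdReflection_sub_le _
  · obtain ⟨c, j, hj, rfl⟩ := hcell i
    have hdec : U c = (U c).take j ++ s (start c + j) :: (U c).drop (j + 1) := by
      rw [hsU c j hj, List.getElem_cons_drop, List.take_append_drop]
    obtain ⟨n, μ, hn, hμ, hlin, hside⟩ := cellWord_step (hsym _) (hsym _) (hfix _) (hfix _) (hX c)
      (h.isEvenVec_edge _) hdec
    refine ⟨c, by omega, by rw [hss]; omega, n, μ, hn, hμ, ?_, hside⟩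
    rw [hstepeq, hkey c j hj.le]
    exact hlin

end IsLatticeLoop

namespace IsLatticeLoop

variable {ρ : E3 ≃ᵃⁱ[ℝ] E3} {m : ℕ} {V : ℕ → E3}

theorem periodic (h : IsLatticeLoop ρ m V) (hρ3 : ρ ^ 3 = 1) (i : ℕ) : V (i + 3 * m) = V i := by
  rw [show i + 3 * m = i + m + m + m by ring, h.shift, h.shift, h.shift]
  exact congrArg (fun f : E3 ≃ᵃⁱ[ℝ] E3 => f (V i)) (show ρ * (ρ * ρ) = 1 by
      rw [← hρ3, pow_succ, pow_two, mul_assoc])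

/-- The gallery stays within a distance of `N • V` that does not depend on `N`, while non-adjacent
edges of `N • V` move apart in proportion to `N`. On adjacent edges both curves advance in the
direction of `le_inner_direction`. -/
theorem exists_gallery (h : IsLatticeLoop ρ m V) (hρ : IsSym ρ) (hρ0 : ρ 0 = 0)
    (hρ3 : ρ ^ 3 = 1) :
    ∃ (H : E3 ≃ᵃⁱ[ℝ] E3) (s : ℕ → Color) (k : ℕ), IsSym H ∧ 0 < k ∧ (∀ i, s (i + k) = s i) ∧
      H * letterProd stdPyramid s k = ρ * H ∧
      IsSimpleClosedPolygon (3 * k) (fun i => (H * letterProd stdPyramid s i) stdCenter) ∧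
      AmbientIsotopic (polygon (3 * m) V)
        (polygon (3 * k) (fun i => (H * letterProd stdPyramid s i) stdCenter)) := by
  have hm := h.two_le
  have hVper := h.periodic hρ3
  obtain ⟨g, hgs, hg0, hg⟩ := exists_chamber (V 1 - V 0)
  have hchamber : ∀ n, IsRoot n → 0 < inner ℝ (intVec n) (g stdCenter) →
      0 ≤ inner ℝ (intVec n) (V 1 - V 0) := hg
  have hfix : ∀ q, (ρ ^ q * g) 0 = 0 := fun q => by
    change (ρ ^ q) (g 0) = 0
    rw [hg0, pow_fixed hρ0]
  have hcenter : ∀ q, ‖(ρ ^ q * g) stdCenter‖ ≤ 1 := fun q => norm_sym_stdCenter_le (hfix q)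
  obtain ⟨B, hB0, hB⟩ := exists_bound_of_periodic (fun k => ‖V (k + 1) - V k‖)
    (n := 3 * m) (by omega) (fun k => by rw [add_right_comm, hVper, hVper])
  obtain ⟨L, hL0, hL⟩ : ∃ L : ℝ, 0 ≤ L ∧ ∀ k k', k' = k ∨ k' = k + 1 →
      ((cellWord (ρ ^ (k / m) * g) (V (k + 1) - V k) (ρ ^ (k' / m) * g)).length : ℝ) ≤ L := by
    have hp : ∀ k, ρ ^ ((k + 3 * m) / m) = ρ ^ (k / m) := fun k => by
      rw [Nat.add_mul_div_right _ _ (by omega), pow_add, hρ3, mul_one]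
    have key : ∀ j, ∃ L : ℝ, 0 ≤ L ∧ ∀ k,
        ((cellWord (ρ ^ (k / m) * g) (V (k + 1) - V k) (ρ ^ ((k + j) / m) * g)).length : ℝ) ≤ L :=
      fun j => exists_bound_of_periodic _ (n := 3 * m) (by omega) (fun k => by
        simp only [add_right_comm k (3 * m), hVper, hp])
    obtain ⟨L0, h0, hL0⟩ := key 0
    obtain ⟨L1, h1, hL1⟩ := key 1
    refine ⟨max L0 L1, h0.trans (le_max_left _ _), ?_⟩
    rintro k k' (rfl | rfl)
    · exact (hL0 _).trans (le_max_left _ _)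
    · exact (hL1 _).trans (le_max_right _ _)
  obtain ⟨μ, hμ, hsep⟩ := exists_separation hVper h.simple
  -- Within one cell the gallery moves by at most `L`, the polygon by at most `B`, and at its start
  -- they differ by a center of norm at most `1`. This total becomes less than a quarter of the
  -- separation `N * μ`.
  obtain ⟨N, hN⟩ := exists_nat_gt (4 * (L + B + 1) / μ)
  have hN0 : (0 : ℝ) < N := lt_of_le_of_lt (by positivity) hN
  have hNpos : 0 < N := by exact_mod_cast hN0
  obtain ⟨H, s, start, hH, hs0, hs1, hsL, hstart, hsper, hHk, hcell, hnorm, hstep⟩ :=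
    h.exists_cells hρ hρ0 hgs hg0 hL hNpos
  set k := start (m * N) with hk
  set Y : ℕ → E3 := fun i => (H * letterProd stdPyramid s i) stdCenter with hY
  set X := subdivision V N with hX
  have hmono : StrictMono start := strictMono_nat_of_lt_succ hs1
  have hkpos : 0 < k := by
    have := hmono.le_apply (x := m * N)
    have : 0 < m * N := Nat.mul_pos (by omega) hNpos
    omega
  have hYk : ∀ i, Y (i + k) = ρ (Y i) := by
    intro i
    simp only [hY]
    rw [letterProd_add_of_periodic _ hsper, ← mul_assoc, hHk]
    rfl
  have hYper : ∀ i, Y (i + 3 * k) = Y i := by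
    intro i
    rw [show i + 3 * k = i + k + k + k by ring, hYk, hYk, hYk]
    exact congrArg (fun f : E3 ≃ᵃⁱ[ℝ] E3 => f (Y i)) (show ρ * (ρ * ρ) = 1 by
      rw [← hρ3, pow_succ, pow_two, mul_assoc])
  have hstart3 : ∀ c, start (c + 3 * (m * N)) = start c + 3 * k := by
    intro c
    rw [show c + 3 * (m * N) = c + m * N + m * N + m * N by ring, hstart, hstart, hstart]
    ring
  set S : ℕ → ℝ := fun c => (start c : ℝ) with hS
  have hSmono : StrictMono S := fun a b hab =>
    Nat.cast_lt.2 (hmono hab)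
  -- The reparametrization matches the beginning of the `c`-th piece of the subdivided polygon with
  -- the beginning of the `c`-th cell of the gallery.
  set Θ := interp S with hΘ
  have hΘmono : StrictMonoOn Θ (Ici 0) := strictMonoOn_interp hSmono
  have hΘnat : ∀ c : ℕ, Θ c = start c := fun c => interp_natCast S c
  have hΘ0 : ∀ t, 0 ≤ t → 0 ≤ Θ t := by
    intro t ht
    have h1 := hΘmono.monotoneOn (mem_Ici.2 le_rfl) (mem_Ici.2 ht) ht
    have h2 := hΘnat 0
    rw [hs0] at h2
    simp only [Nat.cast_zero] at h2
    linarith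
  have hΘlow : ∀ t t', 0 ≤ t → t ≤ t' → t' - t ≤ Θ t' - Θ t := by
    intro t t' ht htt
    have := le_interp_sub S (κ := 1) (fun i _ _ => by
      have h1 : ((start i + 1 : ℕ) : ℝ) ≤ (start (i + 1) : ℕ) := by exact_mod_cast hs1 i
      simp only [hS]; push_cast at h1; linarith) ht htt
    linarith
  have hΘup : ∀ t t', 0 ≤ t → t ≤ t' → Θ t' - Θ t ≤ L * (t' - t) := by
    intro t t' ht htt
    have := norm_interp_sub_le S (K := L) (fun i => by
      rw [Real.norm_of_nonneg (sub_nonneg.2 (hSmono.monotone (Nat.le_succ i)))]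
      exact hsL i) ht htt
    exact (le_abs_self _).trans this
  have hXstep : ∀ c, X (c + 1) - X c = V (c / N + 1) - V (c / N) := fun c => by
    rw [hX, subdivision_succ V hNpos]; abel
  have hXB : ∀ c, ‖X (c + 1) - X c‖ ≤ B := fun c => by rw [hXstep]; exact hB _
  have hxL : ∀ t t', 0 ≤ t → t ≤ t' → ‖interp X t' - interp X t‖ ≤ B * (t' - t) :=
    fun t t' ht htt => norm_interp_sub_le X hXB ht htt
  have hyL : ∀ t t', 0 ≤ t → t ≤ t' → ‖interp Y (Θ t') - interp Y (Θ t)‖ ≤ L * (t' - t) := by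
    intro t t' ht htt
    have h1 := norm_interp_sub_le Y (K := 1) hnorm (hΘ0 t ht)
      (hΘmono.monotoneOn (mem_Ici.2 ht) (mem_Ici.2 (ht.trans htt)) htt)
    linarith [hΘup t t' ht htt]
  have hXper : ∀ c, X (c + 3 * (m * N)) = X c := by
    intro c
    have e : c + 3 * (m * N) = c + (3 * m) * N := by ring
    simp only [hX, subdivision]
    rw [e, Nat.add_mul_div_right _ _ hNpos, Nat.add_mul_mod_self_right, add_right_comm, hVper,
      hVper]
  set p : ℝ := ((3 * (m * N) : ℕ) : ℝ) with hp
  have hΘper : ∀ t, 0 ≤ t → Θ (t + p) = Θ t + ((3 * k : ℕ) : ℝ) := by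
    intro t ht
    rw [hΘ, hp, interp_shift S _ ht]
    have e : (fun i => S (i + 3 * (m * N))) = fun i => S i + ((3 * k : ℕ) : ℝ) := by
      funext i; simp only [hS, hstart3]; push_cast; ring
    rw [e]
    exact (map_interp (AffineMap.id ℝ ℝ + AffineMap.const ℝ ℝ ((3 * k : ℕ) : ℝ)) S t).symm
  -- The arc from `t` to `t'` meets only the edges `j` and `j + 1` of the lattice loop, for which
  -- one direction serves.
  have near : ∀ (t t' : ℝ) (j : ℕ), 0 ≤ t → t ≤ t' → j ≤ ⌊t⌋₊ / N → ⌊t'⌋₊ / N ≤ j + 1 →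
      ∃ d, ‖d‖ ≤ 2 * B + 1 ∧ 1 / 64 * (t' - t) ≤ inner ℝ (interp X t' - interp X t) d ∧
        1 / 64 * (t' - t) ≤ inner ℝ (interp Y (Θ t') - interp Y (Θ t)) d := by
    intro t t' j ht htt hj hj'
    have hcells : ∀ c : ℕ, ⌊t⌋₊ ≤ c → (c : ℝ) < t' → c / N = j ∨ c / N = j + 1 := by
      intro c h1 h2
      have h3 := Nat.div_le_div_right (c := N) h1
      have h4 := Nat.div_le_div_right (c := N) (Nat.le_floor h2.le)
      omega
    refine ⟨(V (j + 1) - V j) + (V (j + 2) - V (j + 1)) + (ρ ^ ((j + 2) / m) * g) stdCenter,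
      ?_, ?_, ?_⟩
    · refine (norm_add_le _ _).trans (add_le_add ((norm_add_le _ _).trans ?_) (hcenter _))
      have := hB j
      have := hB (j + 1)
      linarith
    · refine le_inner_interp_sub X _ (fun c h1 h2 => ?_) ht htt
      rw [hXstep]
      exact h.le_inner_edge (hcells c h1 h2) (hcenter _)
    · have h1 := le_inner_interp_sub Y ((V (j + 1) - V j) + (V (j + 2) - V (j + 1)) +
        (ρ ^ ((j + 2) / m) * g) stdCenter) (κ := 1 / 64) (fun i hi hi' => ?_) (hΘ0 t ht)
        (hΘmono.monotoneOn (mem_Ici.2 ht) (mem_Ici.2 (ht.trans htt)) htt)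
      · have := hΘlow t t' ht htt
        linarith
      · obtain ⟨c, hc, hc', n, ν, hn, hν, hstepc, hside⟩ := hstep i
        have hct' : (c : ℝ) < t' := by
          by_contra hcon
          push Not at hcon
          have h2 := hΘmono.monotoneOn (mem_Ici.2 (ht.trans htt)) (mem_Ici.2 (Nat.cast_nonneg c)) hcon
          rw [hΘnat] at h2
          have h3 : (start c : ℝ) ≤ i := by exact_mod_cast hc
          linarith
        have hct : ⌊t⌋₊ ≤ c := by
          by_contra hcon
          push Not at hcon
          have h2 : ((c + 1 : ℕ) : ℝ) ≤ t := (Nat.le_floor_iff ht).1 hcon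
          have h3 := hΘmono.monotoneOn (mem_Ici.2 (Nat.cast_nonneg (c + 1))) (mem_Ici.2 ht) h2
          rw [hΘnat] at h3
          have h4 : start (c + 1) ≤ ⌊Θ t⌋₊ := Nat.le_floor h3
          omega
        have h5 := h.le_inner_direction hρ hρ0 hgs hg0 hchamber (c' := (c + 1) / N)
          (hcells c hct hct') (by
            rcases succ_div_mod hNpos c with ⟨h1, -⟩ | ⟨h1, -⟩
            · exact Or.inl h1
            · exact Or.inr h1) hn hside
        simp only [hY]
        rw [hstepc, real_inner_smul_left]
        nlinarith
  have hp0 : 0 ≤ p := Nat.cast_nonneg _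
  have hpN : p = 3 * (m * N) := by rw [hp]; push_cast; ring
  obtain ⟨hiso, hinj⟩ := ambientIsotopic_of_windows (interp X) (fun t => interp Y (Θ t)) (p := p)
    (κ := 1 / 64) (K := B + L) (D := 2 * B + 1) (m := N * μ) (by norm_num) (by positivity)
    (by positivity) (by positivity)
    (fun u hu => by
      rw [hp, interp_shift X _ hu]; simp only [hXper])
    (fun u hu => by
      rw [hΘper u hu, interp_shift Y _ (hΘ0 u hu)]; simp only [hYper])
    (fun u u' hu huu => by nlinarith [hxL u u' hu huu, sub_nonneg.2 huu])
    (fun u u' hu huu => by nlinarith [hyL u u' hu huu, sub_nonneg.2 huu])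
    (fun u hu => by
      have h1 := Nat.floor_le hu
      have h2 := Nat.lt_floor_add_one u
      set c := ⌊u⌋₊
      have h3 := hxL c u (Nat.cast_nonneg c) h1
      have h4 := hyL c u (Nat.cast_nonneg c) h1
      have h5 : interp Y (Θ c) - interp X c = (ρ ^ (c / N / m) * g) stdCenter := by
        rw [hΘnat, interp_natCast, interp_natCast]
        simp only [hY]
        rw [hcell]; abel
      have h6 : interp Y (Θ u) - interp X u = (interp Y (Θ u) - interp Y (Θ c)) +
        (ρ ^ (c / N / m) * g) stdCenter - (interp X u - interp X c) := by rw [← h5]; abel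
      rw [h6]
      refine (norm_sub_le _ _).trans ((add_le_add (norm_add_le _ _) le_rfl).trans ?_)
      have h7 := hcenter (c / N / m)
      have h8 : 4 * (L + B + 1) < N * μ := by rwa [div_lt_iff₀ hμ] at hN
      nlinarith)
    (fun u u' hu huu hup => by
      have hu' := hu.trans huu.le
      have hfl := Nat.floor_le_floor huu.le
      have hdiv := Nat.div_le_div_right (c := N) hfl
      have hlt : ⌊u'⌋₊ / N < 3 * m := by
        rw [Nat.div_lt_iff_lt_mul hNpos, Nat.floor_lt hu']
        rw [hpN] at hup
        push_cast
        linarith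
      rcases le_or_gt (⌊u'⌋₊ / N) (⌊u⌋₊ / N + 1) with h1 | h1
      · exact Or.inl (near u u' _ hu huu.le le_rfl h1)
      refine Or.inr ?_
      -- The last edge and the first one are adjacent across the base point.
      by_cases h2 : ⌊u⌋₊ / N = 0 ∧ ⌊u'⌋₊ / N + 1 = 3 * m
      · refine Or.inl (near u' (u + p) (⌊u'⌋₊ / N) hu' (by linarith) le_rfl ?_)
        rw [hp, Nat.floor_add_natCast hu, show 3 * (m * N) = 3 * m * N by ring,
          Nat.add_mul_div_right _ _ hNpos]
        omega
      · refine Or.inr ?_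
        have b1 : ((⌊u⌋₊ / N : ℕ) : ℝ) ≤ u / N := by
          rw [le_div_iff₀ hN0]
          refine le_trans ?_ (Nat.floor_le hu)
          exact_mod_cast Nat.div_mul_le_self _ _
        have b2 : ((⌊u'⌋₊ / N : ℕ) : ℝ) ≤ u' / N := by
          rw [le_div_iff₀ hN0]
          refine le_trans ?_ (Nat.floor_le hu')
          exact_mod_cast Nat.div_mul_le_self _ _
        have b3 : u / N < ((⌊u⌋₊ / N : ℕ) : ℝ) + 1 := by
          rw [div_lt_iff₀ hN0]
          have := Nat.lt_mul_div_succ ⌊u⌋₊ hNpos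
          have h3 : ⌊u⌋₊ + 1 ≤ (⌊u⌋₊ / N + 1) * N := by rw [mul_comm]; exact this
          have h4 : ((⌊u⌋₊ + 1 : ℕ) : ℝ) ≤ (((⌊u⌋₊ / N + 1) * N : ℕ) : ℝ) := by exact_mod_cast h3
          have := Nat.lt_floor_add_one u
          push_cast at h4
          linarith
        have b4 : u' / N < ((⌊u'⌋₊ / N : ℕ) : ℝ) + 1 := by
          rw [div_lt_iff₀ hN0]
          have := Nat.lt_mul_div_succ ⌊u'⌋₊ hNpos
          have h3 : ⌊u'⌋₊ + 1 ≤ (⌊u'⌋₊ / N + 1) * N := by rw [mul_comm]; exact this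
          have h4 : ((⌊u'⌋₊ + 1 : ℕ) : ℝ) ≤ (((⌊u'⌋₊ / N + 1) * N : ℕ) : ℝ) := by exact_mod_cast h3
          have := Nat.lt_floor_add_one u'
          push_cast at h4
          linarith
        have c1 : ((⌊u⌋₊ / N : ℕ) : ℝ) + 2 ≤ ((⌊u'⌋₊ / N : ℕ) : ℝ) := by exact_mod_cast h1
        have c2 : ((⌊u'⌋₊ / N : ℕ) : ℝ) + 1 ≤ ((3 * m : ℕ) : ℝ) := by exact_mod_cast hlt
        have c3 : ((⌊u'⌋₊ / N : ℕ) : ℝ) + 2 ≤ ((3 * m : ℕ) : ℝ) + ((⌊u⌋₊ / N : ℕ) : ℝ) := by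
          have : ⌊u'⌋₊ / N + 2 ≤ 3 * m + ⌊u⌋₊ / N := by
            generalize ⌊u⌋₊ / N = i at *
            omega
          exact_mod_cast this
        have h3 := hsep (u / N) (u' / N) (by positivity) (by linarith) (by linarith) (by linarith)
        rw [interp_subdivision V hNpos hu, interp_subdivision V hNpos hu', ← smul_sub, norm_smul,
          Real.norm_of_nonneg hN0.le]
        exact mul_le_mul_of_nonneg_left h3 hN0.le)
  have himg : Θ '' Ico 0 p = Ico 0 ((3 * k : ℕ) : ℝ) := by
    rw [hp, hΘ, interp_image_Ico hSmono]
    have h1 := hstart3 0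
    rw [zero_add, hs0, zero_add] at h1
    simp only [hS, hs0, h1, Nat.cast_zero]
  have hY0 : Y (3 * k) = Y 0 := by simpa using hYper 0
  have hVm : V (3 * m) = V 0 := by simpa using hVper 0
  refine ⟨H, s, k, hH, hkpos, hsper, hHk, ⟨by omega, hY0, ?_⟩, ?_⟩
  · intro u hu u' hu' huu
    rw [polygonPath_eq_interp _ hu.1, polygonPath_eq_interp _ hu'.1] at huu
    rw [← himg] at hu hu'
    obtain ⟨t, ht, rfl⟩ := hu
    obtain ⟨t', ht', rfl⟩ := hu'
    rw [hinj ht ht' huu]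
  · have e1 : interp X '' Ico 0 p = (((N : ℝ) • LinearMap.id : E3 →ₗ[ℝ] E3)) '' polygon (3 * m) V := by
      rw [polygon_eq_image_interp _ _ (by omega) hVm, image_image]
      ext z
      constructor
      · rintro ⟨t, ht, rfl⟩
        refine ⟨t / N, ⟨div_nonneg ht.1 hN0.le, ?_⟩, ?_⟩
        · rw [div_lt_iff₀ hN0]; have := ht.2; rw [hpN] at this; push_cast; linarith
        · rw [interp_subdivision V hNpos ht.1]; rfl
      · rintro ⟨t, ht, rfl⟩
        have ht0 : 0 ≤ t * N := mul_nonneg ht.1 hN0.le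
        refine ⟨t * N, ⟨ht0, ?_⟩, ?_⟩
        · have := mul_lt_mul_of_pos_right ht.2 hN0
          rw [hpN]; push_cast at this; linarith
        · rw [interp_subdivision V hNpos ht0, mul_div_cancel_right₀ _ hN0.ne']; rfl
    have e2 : (fun t => interp Y (Θ t)) '' Ico 0 p = polygon (3 * k) Y := by
      rw [polygon_eq_image_interp _ _ (by omega) hY0, ← himg, image_image]
    rw [e1, e2] at hiso
    refine (ambientIsotopic_linear _ ?_ _).trans hiso
    rw [LinearMap.det_smul]; simp; positivity

end IsLatticeLoop

/-! ### Loops that are monotone at small scale -/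

/-- `γ` parametrizes a simple closed curve in a Lipschitz way; at some positive scale it is strictly
increasing in suitable directions. -/
structure IsMonotoneLoop (p : ℝ) (γ : ℝ → E3) : Prop where
  pos : 0 < p
  periodic : Function.Periodic γ p
  injOn : InjOn γ (Ico 0 p)
  lipschitz : ∃ K : ℝ, 0 ≤ K ∧ ∀ s s', s ≤ s' → ‖γ s' - γ s‖ ≤ K * (s' - s)
  monotone : ∃ ε r : ℝ, 0 < ε ∧ 0 < r ∧ ∀ t, ∃ d : E3, ‖d‖ ≤ 1 ∧ ∀ s s', t - r ≤ s → s ≤ s' →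
    s' ≤ t + r → ε * (s' - s) ≤ inner ℝ (γ s' - γ s) d

/-- Near `t` the derivative keeps a positive component along `d`, by continuity; half of its value
at `t` serves as the rate. -/
theorem exists_monotone_of_contDiffOn {γ : ℝ → E3} {a b t : ℝ} (hab : a < b)
    (hγ : ContDiffOn ℝ 1 γ (Icc a b)) (ht : t ∈ Icc a b) {d : E3}
    (hd : 0 < inner ℝ (derivWithin γ (Icc a b) t) d) :
    ∃ ε > 0, ∃ r > 0, ∀ s s', a ≤ s → s' ≤ b → t - r ≤ s → s ≤ s' → s' ≤ t + r →
      ε * (s' - s) ≤ inner ℝ (γ s' - γ s) d := by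
  have hu : UniqueDiffOn ℝ (Icc a b) := uniqueDiffOn_Icc hab
  have hc := hγ.continuousOn_derivWithin hu le_rfl
  set ε := inner ℝ (derivWithin γ (Icc a b) t) d / 2 with hε
  have hε0 : 0 < ε := by positivity
  have hev : ∀ᶠ s in nhdsWithin t (Icc a b), ε < inner ℝ (derivWithin γ (Icc a b) s) d :=
    ((hc t ht).inner continuousWithinAt_const).eventually_const_lt (by linarith)
  obtain ⟨r, hr, hball⟩ := Metric.mem_nhdsWithin_iff.1 hev
  refine ⟨ε, hε0, r / 2, by positivity, fun s s' has hsb hs hss hs' => ?_⟩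
  have hsub : Icc s s' ⊆ Icc a b := Icc_subset_Icc has hsb
  have hmono : MonotoneOn (fun x => inner ℝ (γ x) d - ε * x) (Icc s s') := by
    have hderiv : ∀ x ∈ Ioo s s', HasDerivAt (fun x => inner ℝ (γ x) d - ε * x)
        (inner ℝ (derivWithin γ (Icc a b) x) d - ε) x := by
      intro x hx
      have hxab : x ∈ Icc a b := hsub (Ioo_subset_Icc_self hx)
      have h1 : HasDerivAt γ (derivWithin γ (Icc a b) x) x :=
        ((hγ.differentiableOn (by norm_num) x hxab).hasDerivWithinAt).hasDerivAt
          (Icc_mem_nhds (has.trans_lt hx.1) (hx.2.trans_le hsb))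
      have h2 := (h1.inner ℝ (hasDerivAt_const x d)).sub ((hasDerivAt_id x).const_mul ε)
      exact h2.congr_deriv (by simp)
    refine monotoneOn_of_deriv_nonneg (convex_Icc s s')
      (((hγ.continuousOn.mono hsub).inner continuousOn_const).sub (by fun_prop)) ?_ ?_
    · rw [interior_Icc]
      exact fun x hx => (hderiv x hx).differentiableAt.differentiableWithinAt
    · rw [interior_Icc]
      intro x hx
      rw [(hderiv x hx).deriv]
      have : x ∈ Metric.ball t r ∩ Icc a b := by
        refine ⟨?_, hsub (Ioo_subset_Icc_self hx)⟩
        rw [Metric.mem_ball, Real.dist_eq, abs_lt]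
        constructor <;> linarith [hx.1, hx.2]
      exact sub_nonneg.2 (le_of_lt (hball this))
  have := hmono (left_mem_Icc.2 hss) (right_mem_Icc.2 hss) hss
  simp only at this
  rw [inner_sub_left]
  linarith

/-- The vector `‖w‖ • v + ‖v‖ • w` bisects the angle; by the equality case of the Cauchy–Schwarz
inequality its products with `v` and `w` are positive unless these are opposite. -/
theorem exists_direction {v w : E3} (hv : v ≠ 0) (hw : w ≠ 0) (h : ¬ SameRay ℝ v (-w)) :
    ∃ d, 0 < inner ℝ v d ∧ 0 < inner ℝ w d := by
  have hlt : -(‖v‖ * ‖w‖) < inner ℝ v w := by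
    refine lt_of_le_of_ne (neg_le_of_abs_le (abs_real_inner_le_norm v w)) fun heq => h ?_
    rw [sameRay_iff_norm_smul_eq, eq_comm]
    rw [← inner_eq_norm_mul_iff_real, inner_neg_right, ← heq, norm_neg, neg_neg]
  have hv0 := norm_pos_iff.2 hv
  have hw0 := norm_pos_iff.2 hw
  refine ⟨‖w‖ • v + ‖v‖ • w, ?_, ?_⟩
  · rw [inner_add_right, inner_smul_right, inner_smul_right, real_inner_self_eq_norm_sq]
    nlinarith
  · rw [inner_add_right, inner_smul_right, inner_smul_right, real_inner_self_eq_norm_sq,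
      real_inner_comm]
    nlinarith

/-! ### Piecewise `C¹` loops are monotone at a uniform scale. -/

namespace IsPiecewiseC1Loop

variable {n : ℕ} {γ : ℝ → E3}

theorem exists_monotone (h : IsPiecewiseC1Loop n γ) (t : ℝ) : ∃ d : E3, ‖d‖ ≤ 1 ∧ ∃ ε > 0,
    ∃ r > 0, ∀ s s', t - r ≤ s → s ≤ s' → s' ≤ t + r → ε * (s' - s) ≤ inner ℝ (γ s' - γ s) d := by
  suffices hs : ∃ d : E3, ∃ ε > 0, ∃ r > 0, ∀ s s', t - r ≤ s → s ≤ s' → s' ≤ t + r →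
      ε * (s' - s) ≤ inner ℝ (γ s' - γ s) d by
    obtain ⟨d, ε, hε, r, hr, hd⟩ := hs
    have hpos : 0 < ‖d‖ + 1 := by positivity
    -- Dividing by `‖d‖ + 1` rather than `‖d‖` avoids the case `d = 0`.
    refine ⟨(‖d‖ + 1)⁻¹ • d, ?_, (‖d‖ + 1)⁻¹ * ε, by positivity, r, hr, fun s s' h1 h2 h3 => ?_⟩
    · rw [norm_smul, norm_inv, Real.norm_of_nonneg hpos.le, inv_mul_le_iff₀ hpos]; linarith
    · rw [inner_smul_right, mul_assoc]
      exact mul_le_mul_of_nonneg_left (hd s s' h1 h2 h3) (by positivity)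
  have h1 := Int.floor_le t
  have h2 := Int.lt_floor_add_one t
  set i := ⌊t⌋ with hi
  have hR : t ∈ Icc (i : ℝ) (i + 1) := ⟨h1, h2.le⟩
  rcases eq_or_lt_of_le h1 with heq | hlt
  · have hC := h.contDiffOn (i - 1)
    have hreg := h.regular (i - 1)
    push_cast at hC hreg
    rw [sub_add_cancel] at hC hreg
    have hL : t ∈ Icc ((i : ℝ) - 1) i := by rw [← heq]; constructor <;> linarith
    -- At a corner the two one-sided derivatives are not opposite, so one direction is good for both
    -- arcs.
    obtain ⟨d, hd1, hd2⟩ := exists_direction (h.regular i i (by simp)) (hreg i (by simp))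
      (h.no_cusp i)
    rw [heq] at hd1 hd2
    obtain ⟨ε, hε, r, hr, hA⟩ := exists_monotone_of_contDiffOn (by linarith) (h.contDiffOn i) hR
      (by rw [heq]; exact hd1)
    obtain ⟨ε', hε', r', hr', hB⟩ := exists_monotone_of_contDiffOn (by linarith) hC hL
      (by rw [heq]; exact hd2)
    refine ⟨d, min ε ε', lt_min hε hε', min 1 (min r r'), by positivity, fun s s' g1 g2 g3 => ?_⟩
    have m1 := min_le_left 1 (min r r')
    have m2 := (min_le_right 1 (min r r')).trans (min_le_left r r')
    have m3 := (min_le_right 1 (min r r')).trans (min_le_right r r')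
    have m4 := min_le_left ε ε'
    have m5 := min_le_right ε ε'
    have right : ∀ s s', t ≤ s → s ≤ s' → s' ≤ t + min 1 (min r r') →
        min ε ε' * (s' - s) ≤ inner ℝ (γ s' - γ s) d := fun s s' g1 g2 g3 =>
      (mul_le_mul_of_nonneg_right m4 (by linarith)).trans
        (hA s s' (by linarith) (by linarith) (by linarith) g2 (by linarith))
    have left : ∀ s s', t - min 1 (min r r') ≤ s → s ≤ s' → s' ≤ t →
        min ε ε' * (s' - s) ≤ inner ℝ (γ s' - γ s) d := fun s s' g1 g2 g3 =>
      (mul_le_mul_of_nonneg_right m5 (by linarith)).trans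
        (hB s s' (by linarith) (by linarith) (by linarith) g2 (by linarith))
    rcases le_total t s with c1 | c1
    · exact right s s' c1 g2 g3
    rcases le_total s' t with c2 | c2
    · exact left s s' g1 g2 c2
    have e1 := left s t g1 c1 le_rfl
    have e2 := right t s' le_rfl c2 g3
    have e3 : γ s' - γ s = (γ s' - γ t) + (γ t - γ s) := by abel
    rw [e3, inner_add_left]
    linarith
  · obtain ⟨ε, hε, r, hr, hA⟩ := exists_monotone_of_contDiffOn 
      (by linarith) (h.contDiffOn i) hR (real_inner_self_pos.2 (h.regular i t hR))
    refine ⟨derivWithin γ (Icc (i : ℝ) (i + 1)) t, ε, hε, min r (min (t - i) (i + 1 - t)), ?_, fun s s' g1 g2 g3 => ?_⟩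
    · refine lt_min hr (lt_min ?_ ?_) <;> linarith
    · have m1 := min_le_left r (min (t - i) (i + 1 - t))
      have m2 := (min_le_right r (min (t - i) (i + 1 - t))).trans (min_le_left _ _)
      have m3 := (min_le_right r (min (t - i) (i + 1 - t))).trans (min_le_right _ _)
      exact hA s s' (by linarith) (by linarith) (by linarith) g2 (by linarith)

theorem exists_lipschitz (h : IsPiecewiseC1Loop n γ) :
    ∃ K : ℝ, 0 ≤ K ∧ ∀ s s', s ≤ s' → ‖γ s' - γ s‖ ≤ K * (s' - s) := by
  have hn : (0 : ℤ) < n := by exact_mod_cast h.pos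
  have hper : Function.Periodic γ n := h.periodic
  choose C hC using fun i : ℤ =>
    (h.contDiffOn i).exists_lipschitzOnWith one_ne_zero (convex_Icc _ _) isCompact_Icc
  set K : ℝ := ∑ i ∈ Finset.range n, (C i : ℝ) with hK
  have hK0 : 0 ≤ K := Finset.sum_nonneg fun _ _ => NNReal.coe_nonneg _
  have piece : ∀ (i : ℤ) (s s' : ℝ), (i : ℝ) ≤ s → s ≤ s' → s' ≤ i + 1 →
      ‖γ s' - γ s‖ ≤ K * (s' - s) := by
    intro i s s' h1 h2 h3
    have hmod := Int.emod_nonneg i hn.ne'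
    have hmod' := Int.emod_lt_of_pos i hn
    obtain ⟨k, hk⟩ := Int.eq_ofNat_of_zero_le hmod
    have hi : i = k + (i / n) * n := by rw [← hk]; exact (Int.emod_add_ediv_mul i n).symm
    have hi' : (i : ℝ) = k + ((i / n : ℤ) : ℝ) * n := by exact_mod_cast hi
    have hz := hper.int_mul (i / n)
    have e : ∀ x, γ x = γ (x - ((i / n : ℤ) : ℝ) * n) := fun x => (hz.sub_eq x).symm
    rw [e s, e s']
    have hk' : k ∈ Finset.range n := by rw [Finset.mem_range]; omega
    have hCk : (C k : ℝ) ≤ K :=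
      Finset.single_le_sum (f := fun i : ℕ => (C i : ℝ)) (fun _ _ => NNReal.coe_nonneg _) hk'
    have := (hC k).norm_sub_le (x := s' - ((i / n : ℤ) : ℝ) * n)
      (y := s - ((i / n : ℤ) : ℝ) * n) ⟨by push_cast; linarith, by push_cast; linarith⟩
      ⟨by push_cast; linarith, by push_cast; linarith⟩
    rw [sub_sub_sub_cancel_right, Real.norm_of_nonneg (sub_nonneg.2 h2)] at this
    exact this.trans (mul_le_mul_of_nonneg_right hCk (sub_nonneg.2 h2))
  have chain : ∀ (N : ℕ) (s s' : ℝ), s ≤ s' → s' ≤ ⌊s⌋ + 1 + N → ‖γ s' - γ s‖ ≤ K * (s' - s) := by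
    intro N
    induction N with
    | zero => exact fun s s' h1 h2 => piece ⌊s⌋ s s' (Int.floor_le s) h1 (by simpa using h2)
    | succ N ih =>
      intro s s' h1 h2
      rcases le_total s' (⌊s⌋ + 1 + N) with h3 | h3
      · exact ih s s' h1 h3
      have hf := Int.lt_floor_add_one s
      have hN : (0 : ℝ) ≤ N := Nat.cast_nonneg _
      have e1 := ih s (⌊s⌋ + 1 + N) (by linarith) le_rfl
      have e2 := piece (⌊s⌋ + 1 + N) (⌊s⌋ + 1 + N) s' (by push_cast; linarith) h3
        (by push_cast at h2 ⊢; linarith)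
      have e3 : γ s' - γ s = (γ s' - γ (⌊s⌋ + 1 + N)) + (γ (⌊s⌋ + 1 + N) - γ s) := by abel
      rw [e3]
      refine (norm_add_le _ _).trans ((add_le_add e2 e1).trans ?_)
      linarith
  refine ⟨K, hK0, fun s s' hss => ?_⟩
  obtain ⟨N, hN⟩ := exists_nat_ge (s' - ⌊s⌋)
  exact chain N s s' hss (by linarith)

theorem isMonotoneLoop (h : IsPiecewiseC1Loop n γ) : IsMonotoneLoop n γ := by
  have hn : (0 : ℝ) < n := by exact_mod_cast h.pos
  have hper : Function.Periodic γ n := h.periodic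
  refine ⟨hn, hper, h.injOn, h.exists_lipschitz, ?_⟩
  obtain ⟨ε, r, hε, hr, hw⟩ : ∃ ε r : ℝ, 0 < ε ∧ 0 < r ∧ ∀ t ∈ Icc (0 : ℝ) n, ∃ d : E3, ‖d‖ ≤ 1 ∧
      ∀ s s', t - r ≤ s → s ≤ s' → s' ≤ t + r → ε * (s' - s) ≤ inner ℝ (γ s' - γ s) d := by
    -- Having a common rate and a common scale passes to subsets and finite unions, and holds near
    -- every parameter.
    refine isCompact_Icc.induction_on (p := fun S => ∃ ε r : ℝ, 0 < ε ∧ 0 < r ∧ ∀ t ∈ S,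
      ∃ d : E3, ‖d‖ ≤ 1 ∧ ∀ s s', t - r ≤ s → s ≤ s' → s' ≤ t + r →
        ε * (s' - s) ≤ inner ℝ (γ s' - γ s) d) ?_ ?_ ?_ ?_
    · exact ⟨1, 1, one_pos, one_pos, by simp⟩
    · rintro S T hST ⟨ε, r, hε, hr, hT⟩
      exact ⟨ε, r, hε, hr, fun t ht => hT t (hST ht)⟩
    · rintro S T ⟨ε, r, hε, hr, hS⟩ ⟨ε', r', hε', hr', hT⟩
      refine ⟨min ε ε', min r r', lt_min hε hε', lt_min hr hr', ?_⟩
      have m1 := min_le_left r r'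
      have m2 := min_le_right r r'
      rintro t (ht | ht)
      · obtain ⟨d, hd, hm⟩ := hS t ht
        exact ⟨d, hd, fun s s' g1 g2 g3 => (mul_le_mul_of_nonneg_right (min_le_left _ _)
          (by linarith)).trans (hm s s' (by linarith) g2 (by linarith))⟩
      · obtain ⟨d, hd, hm⟩ := hT t ht
        exact ⟨d, hd, fun s s' g1 g2 g3 => (mul_le_mul_of_nonneg_right (min_le_right _ _)
          (by linarith)).trans (hm s s' (by linarith) g2 (by linarith))⟩
    · intro t _
      obtain ⟨d, hd, ε, hε, r, hr, hm⟩ := h.exists_monotone t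
      refine ⟨Icc (t - r / 2) (t + r / 2), mem_nhdsWithin_of_mem_nhds
        (Icc_mem_nhds (by linarith) (by linarith)), ε, r / 2, hε, by positivity, fun t' ht' =>
        ⟨d, hd, fun s s' g1 g2 g3 => hm s s' ?_ g2 ?_⟩⟩
      · linarith [ht'.1]
      · linarith [ht'.2]
  refine ⟨ε, r, hε, hr, fun t => ?_⟩
  obtain ⟨t', ht', z, hz⟩ : ∃ t' ∈ Icc (0 : ℝ) n, ∃ z : ℤ, t = t' + z * n := by
    refine ⟨toIcoMod hn 0 t, ?_, toIcoDiv hn 0 t, ?_⟩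
    · have := toIcoMod_mem_Ico hn 0 t
      rw [zero_add] at this
      exact Ico_subset_Icc_self this
    · have := toIcoMod_add_toIcoDiv_zsmul hn 0 t
      rw [zsmul_eq_mul] at this
      exact this.symm
  obtain ⟨d, hd, hm⟩ := hw t' ht'
  refine ⟨d, hd, fun s s' g1 g2 g3 => ?_⟩
  have e := (hper.int_mul z).sub_eq
  have := hm (s - z * n) (s' - z * n) (by linarith) (by linarith) (by linarith)
  rw [e, e, sub_sub_sub_cancel_right] at this
  exact this

end IsPiecewiseC1Loop

namespace IsMonotoneLoop

variable {p : ℝ} {γ : ℝ → E3}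

theorem comp_isometry (h : IsMonotoneLoop p γ) (f : E3 ≃ᵃⁱ[ℝ] E3) :
    IsMonotoneLoop p (fun t => f (γ t)) := by
  refine ⟨h.pos, fun t => by rw [h.periodic t],
    fun a ha b hb hab => h.injOn ha hb (f.injective hab), ?_, ?_⟩
  · obtain ⟨K, hK, hl⟩ := h.lipschitz
    refine ⟨K, hK, fun s s' hs => ?_⟩
    rw [isometry_sub, LinearIsometryEquiv.norm_map]
    exact hl s s' hs
  · obtain ⟨ε, r, hε, hr, hm⟩ := h.monotone
    refine ⟨ε, r, hε, hr, fun t => ?_⟩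
    obtain ⟨d, hd, hm⟩ := hm t
    refine ⟨f.linearIsometryEquiv d, by rwa [LinearIsometryEquiv.norm_map], fun s s' g1 g2 g3 => ?_⟩
    rw [isometry_sub, LinearIsometryEquiv.inner_map_map]
    exact hm s s' g1 g2 g3

theorem continuous (h : IsMonotoneLoop p γ) : Continuous γ := by
  obtain ⟨K, hK, hl⟩ := h.lipschitz
  refine LipschitzWith.continuous (K := ⟨K, hK⟩) (LipschitzWith.of_dist_le_mul fun a b => ?_)
  rw [dist_eq_norm, Real.dist_eq]
  rcases le_total a b with hab | hab
  · rw [norm_sub_rev, abs_sub_comm, abs_of_nonneg (sub_nonneg.2 hab)]; exact hl a b hab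
  · rw [abs_of_nonneg (sub_nonneg.2 hab)]; exact hl b a hab

theorem eq_of_lt (h : IsMonotoneLoop p γ) {u u' : ℝ} (h1 : 0 < u' - u) (h2 : u' - u < p) :
    γ u ≠ γ u' := by
  intro heq
  obtain ⟨z, hz⟩ := exists_int_of_eq h.pos h.periodic h.injOn heq
  have hp := h.pos
  have h3 : (z : ℝ) < 0 := by
    by_contra hcon
    push Not at hcon
    nlinarith
  have h4 : (-1 : ℝ) < z := by
    by_contra hcon
    push Not at hcon
    nlinarith
  have h3' : z < 0 := by exact_mod_cast h3
  have h4' : -1 < z := by exact_mod_cast h4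
  omega

theorem exists_separation (h : IsMonotoneLoop p γ) {δ : ℝ} (hδ : 0 < δ) :
    ∃ μ > 0, ∀ u u', 0 ≤ u → u ≤ p → δ ≤ u' - u → u' - u ≤ p - δ → μ ≤ ‖γ u' - γ u‖ := by
  set S : Set (ℝ × ℝ) := Icc 0 p ×ˢ Icc δ (p - δ) with hS
  have hcomp : IsCompact S := isCompact_Icc.prod isCompact_Icc
  have hγ := h.continuous
  have hcont : ContinuousOn (fun q : ℝ × ℝ => ‖γ (q.1 + q.2) - γ q.1‖) S := by fun_prop
  rcases S.eq_empty_or_nonempty with he | hne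
  · refine ⟨1, one_pos, fun u u' h1 h2 h3 h4 => ?_⟩
    have : (u, u' - u) ∈ S := ⟨⟨h1, h2⟩, ⟨h3, h4⟩⟩
    rw [he] at this
    exact this.elim
  · obtain ⟨q, hq, hmin⟩ := hcomp.exists_isMinOn hne hcont
    refine ⟨‖γ (q.1 + q.2) - γ q.1‖, ?_, fun u u' h1 h2 h3 h4 => ?_⟩
    · rw [gt_iff_lt, norm_pos_iff, sub_ne_zero]
      obtain ⟨-, hq2⟩ := hq
      exact (h.eq_of_lt (by linarith [hq2.1]) (by linarith [hq2.2])).symm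
    · have : (u, u' - u) ∈ S := ⟨⟨h1, h2⟩, ⟨h3, h4⟩⟩
      have := hmin this
      simpa using this

end IsMonotoneLoop

/-! ### Lifting a symmetry of a loop to the parameter line -/

theorem exists_forall_le_of_periodic {f : ℝ → ℝ} {p : ℝ} (hp : 0 < p) (hf : Continuous f)
    (hper : Function.Periodic f p) : ∃ t, ∀ s, f s ≤ f t := by
  obtain ⟨t, -, ht⟩ := isCompact_Icc.exists_isMaxOn (nonempty_Icc.2 hp.le) hf.continuousOn
  refine ⟨t, fun s => ?_⟩
  obtain ⟨s', hs', h⟩ := hper.exists_mem_Ico₀ hp s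
  rw [h]
  exact ht (Ico_subset_Icc_self hs')

/-- A continuous map from the line into the discrete group of multiples of `p` is constant. -/
theorem exists_const_of_mem_multiples {f : ℝ → ℝ} {p : ℝ} (hf : Continuous f)
    (h : ∀ t, ∃ z : ℤ, f t = z * p) : ∃ z : ℤ, ∀ t, f t = z * p := by
  have hmaps : MapsTo f univ (AddSubgroup.zmultiples p : Set ℝ) := fun t _ => by
    obtain ⟨z, hz⟩ := h t
    exact ⟨z, by rw [hz]; simp⟩
  obtain ⟨z, hz⟩ := h 0
  refine ⟨z, fun t => ?_⟩
  rw [← hz]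
  exact isPreconnected_univ.constant_of_mapsTo (T := (AddSubgroup.zmultiples p : Set ℝ))
    ⟨(inferInstance : DiscreteTopology (AddSubgroup.zmultiples p))⟩ hf.continuousOn hmaps (mem_univ t) (mem_univ 0)

namespace IsMonotoneLoop

variable {p : ℝ} {γ : ℝ → E3}

/-- A loop inside the line through `u` would turn back where its coordinate is maximal, whereas near
that parameter it increases strictly in some direction. -/
theorem exists_forall_ne_smul (h : IsMonotoneLoop p γ) (u : E3) : ∃ t, ∀ c : ℝ, γ t ≠ c • u := by
  by_contra hcon
  push Not at hcon
  choose c hc using hcon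
  obtain ⟨t, ht⟩ := exists_forall_le_of_periodic h.pos
    (f := fun t => inner ℝ (γ t) u) (h.continuous.inner continuous_const)
    (fun t => by simp only [h.periodic t])
  obtain ⟨ε, r, hε, hr, hm⟩ := h.monotone
  obtain ⟨d, -, hm⟩ := hm t
  have h1 := hm t (t + r) (by linarith) (by linarith) le_rfl
  have h2 := hm (t - r) t le_rfl (by linarith) (by linarith)
  have h3 := ht (t + r)
  have h4 := ht (t - r)
  simp only [hc] at h1 h2 h3 h4
  rw [← sub_smul, real_inner_smul_left] at h1 h2
  rw [real_inner_smul_left, real_inner_smul_left] at h3 h4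
  have h5 : 0 < ε * (t + r - t) := by rw [add_sub_cancel_left]; positivity
  have h6 : 0 < ε * (t - (t - r)) := by rw [sub_sub_cancel]; positivity
  have hu : 0 < inner ℝ u u := by
    rcases eq_or_ne u 0 with rfl | hu
    · rw [inner_zero_left] at h1; linarith
    · exact real_inner_self_pos.2 hu
  have h7 : c (t + r) ≤ c t := le_of_mul_le_mul_right h3 hu
  have h8 : c (t - r) ≤ c t := le_of_mul_le_mul_right h4 hu
  rcases le_total 0 (inner ℝ u d : ℝ) with h9 | h9
  · nlinarith
  · nlinarith

/-- The loop embeds the circle `ℝ / pℤ`, so `ρ` induces a continuous map from the line to the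
circle, which lifts along the covering. -/
theorem exists_lift (h : IsMonotoneLoop p γ) {ρ : E3 ≃ᵃⁱ[ℝ] E3} (hρ : ρ '' range γ = range γ) :
    ∃ φ : ℝ → ℝ, Continuous φ ∧ ∀ t, γ (φ t) = ρ (γ t) := by
  have : Fact (0 < p) := ⟨h.pos⟩
  set g : AddCircle p → E3 := h.periodic.lift with hg
  have hgcoe : ∀ t : ℝ, g (t : AddCircle p) = γ t := fun t => h.periodic.lift_coe t
  have hgc : Continuous g := by
    refine continuous_coinduced_dom.2 ?_
    exact h.continuous
  have hginj : Function.Injective g := by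
    intro a b
    induction a using QuotientAddGroup.induction_on with | H a =>
    induction b using QuotientAddGroup.induction_on with | H b =>
    intro hab
    have hab' : γ a = γ b := hab
    obtain ⟨z, hz⟩ := exists_int_of_eq h.pos h.periodic h.injOn hab'
    refine (QuotientAddGroup.eq).2 ⟨-z, ?_⟩
    simp; linarith
  have hemb := (hgc.isClosedEmbedding hginj).isEmbedding
  have hmem : ∀ t, ρ (γ t) ∈ range g := by
    intro t
    have : ρ (γ t) ∈ range γ := hρ ▸ mem_image_of_mem _ (mem_range_self t)
    obtain ⟨s, hs⟩ := this
    exact ⟨(s : AddCircle p), hs⟩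
  let F : C(ℝ, AddCircle p) := ⟨fun t => hemb.toHomeomorph.symm ⟨ρ (γ t), hmem t⟩, by
    refine hemb.toHomeomorph.symm.continuous.comp ?_
    exact (ρ.continuous.comp h.continuous).subtype_mk _⟩
  have hF : ∀ t, g (F t) = ρ (γ t) := by
    intro t
    have := hemb.toHomeomorph.apply_symm_apply ⟨ρ (γ t), hmem t⟩
    exact congrArg Subtype.val this
  obtain ⟨e₀, he₀⟩ := QuotientAddGroup.mk_surjective (F 0)
  obtain ⟨φ, ⟨-, hφ⟩, -⟩ := (AddCircle.isCoveringMap_coe p).existsUnique_continuousMap_lifts F 0 e₀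
    he₀
  refine ⟨φ, φ.continuous, fun t => ?_⟩
  rw [← hF, ← congrFun hφ t]
  exact (hgcoe _).symm

/-- The number `d` is the degree. If it were zero, `φ` would be periodic and have a maximum, near
which it is injective, which is absurd. With `d ≠ 0`, equal values at `a` and `b` force `a - b = z *
p` and `d * (a - b) = 0`. -/
theorem injective_of_lift (h : IsMonotoneLoop p γ) {ρ : E3 ≃ᵃⁱ[ℝ] E3} {φ : ℝ → ℝ}
    (hφ : Continuous φ) (hγφ : ∀ t, γ (φ t) = ρ (γ t)) :
    Function.Injective φ ∧ ∃ d : ℤ, ∀ t, φ (t + p) - φ t = d * p := by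
  have hp := h.pos
  obtain ⟨d, hd⟩ := exists_const_of_mem_multiples (f := fun t => φ (t + p) - φ t) (by fun_prop)
    (fun t => exists_int_of_eq hp h.periodic h.injOn (by rw [hγφ, hγφ, h.periodic]))
  refine ⟨?_, d, hd⟩
  have hz : ∀ a b, φ a = φ b → ∃ z : ℤ, a - b = z * p := fun a b hab =>
    exists_int_of_eq hp h.periodic h.injOn (ρ.injective (by rw [← hγφ, ← hγφ, hab]))
  have hd0 : d ≠ 0 := by
    rintro rfl
    obtain ⟨t, ht⟩ := exists_forall_le_of_periodic hp hφ (fun t => by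
      have := hd t
      simp only [Int.cast_zero, zero_mul] at this
      linarith)
    have hinj : InjOn φ (Icc (t - p / 4) (t + p / 4)) := by
      intro a ha b hb hab
      by_contra hne
      rcases lt_or_gt_of_ne hne with hlt | hlt
      · refine h.eq_of_lt (u := a) (u' := b) (by linarith) (by linarith [ha.1, hb.2])
          (ρ.injective ?_)
        rw [← hγφ, ← hγφ, hab]
      · refine h.eq_of_lt (u := b) (u' := a) (by linarith) (by linarith [hb.1, ha.2])
          (ρ.injective ?_)
        rw [← hγφ, ← hγφ, hab]
    have m1 : t - p / 4 ∈ Icc (t - p / 4) (t + p / 4) := ⟨le_rfl, by linarith⟩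
    have m2 : t ∈ Icc (t - p / 4) (t + p / 4) := ⟨by linarith, by linarith⟩
    have m3 : t + p / 4 ∈ Icc (t - p / 4) (t + p / 4) := ⟨by linarith, le_rfl⟩
    rcases ContinuousOn.strictMonoOn_of_injOn_Icc' (by linarith) hφ.continuousOn hinj with hm | hm
    · exact absurd (hm m2 m3 (by linarith)) (not_lt.2 (ht _))
    · exact absurd (hm m1 m2 (by linarith)) (not_lt.2 (ht _))
  intro a b hab
  obtain ⟨z, hz⟩ := hz a b hab
  have hper : Function.Periodic (fun t => φ t - d * t) p := fun t => by
    have := hd t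
    linarith
  have h1 := hper.int_mul z b
  rw [show b + z * p = a by linarith] at h1
  have h2 : (d : ℝ) * (a - b) = 0 := by linarith
  rcases mul_eq_zero.1 h2 with h3 | h3
  · exact absurd (by exact_mod_cast h3) hd0
  · linarith

/-- For any lift, `φ³ (t) = t + c * p` with an integer `c`, and shifting `φ` by periods changes `c`
by multiples of three. Remainder zero would make the lift the identity and put the loop on the axis;
remainder two is turned into one by passing to `ρ²`. -/
theorem exists_equivariant_lift (h : IsMonotoneLoop p γ) {ρ : E3 ≃ᵃⁱ[ℝ] E3}
    (hρ : ρ '' range γ = range γ) (hρ3 : ρ ^ 3 = 1) (hline : ∃ u, ∀ x, ρ x = x → ∃ c : ℝ, x = c • u) :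
    ∃ ρ', (ρ' = ρ ∨ ρ' = ρ ^ 2) ∧ ∃ φ : ℝ → ℝ, Continuous φ ∧ StrictMono φ ∧
      (∀ t, φ (φ (φ t)) = t + p) ∧ ∀ t, γ (φ t) = ρ' (γ t) := by
  have hp := h.pos
  obtain ⟨φ, hφ, hγφ⟩ := h.exists_lift hρ
  obtain ⟨hinj, d, hd⟩ := h.injective_of_lift hφ hγφ
  have hρ3' : ∀ x, ρ (ρ (ρ x)) = x := fun x =>
    congrArg (fun f : E3 ≃ᵃⁱ[ℝ] E3 => f x) (show ρ * (ρ * ρ) = 1 by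
      rw [← hρ3, pow_succ, pow_two, mul_assoc])
  obtain ⟨c, hc⟩ := exists_const_of_mem_multiples (f := fun t => φ (φ (φ t)) - t) (by fun_prop)
    (fun t => exists_int_of_eq hp h.periodic h.injOn (by rw [hγφ, hγφ, hγφ, hρ3']))
  -- A decreasing `φ` would have a decreasing third iterate, but that iterate is a translation.
  have hmono : StrictMono φ := by
    rcases hφ.strictMono_of_inj hinj with hm | hm
    · exact hm
    · have h1 := hm (hm (hm (show (0 : ℝ) < 1 by norm_num)))
      have := hc 0
      have := hc 1
      linarith
  have hper : Function.Periodic (fun t => φ t - d * t) p := fun t => by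
    have := hd t
    linarith
  have hshift : ∀ (z : ℤ) t, φ (t + z * p) = φ t + d * z * p := fun z t => by
    have := hper.int_mul z t
    linarith
  -- Comparing the degrees in `φ³ (t) = t + c * p` gives `d³ = 1`.
  have hd1 : d = 1 := by
    have e1 := hshift 1 0
    have e2 := hshift d (φ 0)
    have e3 := hshift (d * d) (φ (φ 0))
    have e4 := hc 0
    have e5 := hc (0 + (1 : ℤ) * p)
    rw [e1] at e5
    rw [show φ 0 + d * (1 : ℤ) * p = φ 0 + d * p by push_cast; ring, e2] at e5
    rw [show φ (φ 0) + d * d * p = φ (φ 0) + ((d * d : ℤ) : ℝ) * p by push_cast; ring, e3] at e5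
    push_cast at e5 e4
    have e6 : ((d : ℝ) * (d * d) - 1) * p = 0 := by linarith
    have e7 : (d : ℝ) * (d * d) = 1 := by
      rcases mul_eq_zero.1 e6 with e7 | e7
      · linarith
      · exact absurd e7 hp.ne'
    have e8 : d * (d * d) = 1 := by exact_mod_cast e7
    exact Int.eq_one_of_mul_eq_one_right (by
      have := hd 0
      have h2 := hmono (show (0 : ℝ) < 0 + p by linarith)
      have h3 : (0 : ℝ) < d := by
        by_contra hcon
        push Not at hcon
        nlinarith
      exact_mod_cast h3.le) e8
  rw [hd1] at hshift
  simp only [Int.cast_one, one_mul] at hshift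
  set q := c / 3 with hq
  set r := c % 3 with hr
  have hcq : (c : ℝ) = 3 * q + r := by exact_mod_cast (Int.mul_ediv_add_emod c 3).symm
  set ψ : ℝ → ℝ := fun t => φ t + ((-q : ℤ) : ℝ) * p with hψ
  have hψc : Continuous ψ := by fun_prop
  have hψm : StrictMono ψ := fun a b hab => by
    simp only [hψ]
    linarith [hmono hab]
  have hψ3 : ∀ t, ψ (ψ (ψ t)) = t + r * p := by
    intro t
    have := hc t
    simp only [hψ, hshift]
    simp only [hcq] at this
    push_cast
    linarith
  have hψs : ∀ (z : ℤ) t, ψ (t + z * p) = ψ t + z * p := by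
    intro z t
    simp only [hψ, hshift]
    ring
  have hγψ : ∀ t, γ (ψ t) = ρ (γ t) := by
    intro t
    rw [← hγφ]
    exact h.periodic.int_mul (-q) (φ t)
  have hr3 : r = 0 ∨ r = 1 ∨ r = 2 := by omega
  rcases hr3 with hr0 | hr1 | hr2
  · exfalso
    obtain ⟨u, hu⟩ := hline
    obtain ⟨t, ht⟩ := h.exists_forall_ne_smul u
    have hid : ψ t = t := by
      have h3 := hψ3 t
      rw [hr0] at h3
      simp only [Int.cast_zero, zero_mul, add_zero] at h3
      rcases lt_trichotomy (ψ t) t with h1 | h1 | h1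
      · have h2 := hψm h1
        have h4 := hψm h2
        linarith
      · exact h1
      · have h2 := hψm h1
        have h4 := hψm h2
        linarith
    obtain ⟨c, hc⟩ := hu (γ t) (by rw [← hγψ, hid])
    exact ht c hc
  · exact ⟨ρ, Or.inl rfl, ψ, hψc, hψm, fun t => by rw [hψ3, hr1]; simp, hγψ⟩
  -- The third iterate of `ψ² - p` is translation by `2 * 2 * p - 3 * p = p`.
  · refine ⟨ρ ^ 2, Or.inr rfl, fun t => ψ (ψ t) + ((-1 : ℤ) : ℝ) * p, by fun_prop,
      fun a b hab => by simpa using hψm (hψm hab), fun t => ?_, fun t => ?_⟩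
    · simp only [hψs, hψ3, hr2]
      push_cast
      ring
    · rw [h.periodic.int_mul (-1) (ψ (ψ t)), hγψ, hγψ, pow_two]
      rfl

end IsMonotoneLoop

/-! ### Equivariant subdivisions of a loop -/

/-- The interval from `0` to `φ 0` is a fundamental domain: it is cut into `m` equal parts, which
are transported by the iterates of `φ`. Uniform continuity of three iterates is enough, as `φ³` is a
translation. -/
theorem exists_cuts {φ : ℝ → ℝ} {p δ : ℝ} (hp : 0 < p) (hδ : 0 < δ) (hφ : Continuous φ)
    (hmono : StrictMono φ) (hφ3 : ∀ t, φ (φ (φ t)) = t + p) :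
    ∃ (m : ℕ) (τ : ℕ → ℝ), 0 < m ∧ τ 0 = 0 ∧ (∀ j, τ j < τ (j + 1)) ∧
      (∀ j, τ (j + 1) - τ j ≤ δ) ∧ ∀ j, τ (j + m) = φ (τ j) := by
  have h0 : 0 < φ 0 := by
    by_contra hcon
    push Not at hcon
    have h1 := hmono.monotone hcon
    have h2 := hmono.monotone h1
    have := hφ3 0
    linarith
  have hunif : ∀ a : ℕ, ∃ η > 0, ∀ x ∈ Icc 0 (φ 0), ∀ y ∈ Icc 0 (φ 0), |x - y| < η →
      |φ^[a] x - φ^[a] y| ≤ δ := by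
    intro a
    obtain ⟨η, hη, h⟩ := Metric.uniformContinuousOn_iff.1
      (isCompact_Icc.uniformContinuousOn_of_continuous (hφ.iterate a).continuousOn) δ hδ
    exact ⟨η, hη, fun x hx y hy hxy => (h x hx y hy hxy).le⟩
  obtain ⟨η, hη, hunif⟩ : ∃ η > 0, ∀ a, ∀ x ∈ Icc 0 (φ 0), ∀ y ∈ Icc 0 (φ 0), |x - y| < η →
      |φ^[a] x - φ^[a] y| ≤ δ := by
    obtain ⟨η₀, h₀, u₀⟩ := hunif 0
    obtain ⟨η₁, h₁, u₁⟩ := hunif 1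
    obtain ⟨η₂, h₂, u₂⟩ := hunif 2
    refine ⟨min η₀ (min η₁ η₂), lt_min h₀ (lt_min h₁ h₂), fun a => ?_⟩
    have m1 := min_le_left η₀ (min η₁ η₂)
    have m2 := (min_le_right η₀ (min η₁ η₂)).trans (min_le_left _ _)
    have m3 := (min_le_right η₀ (min η₁ η₂)).trans (min_le_right _ _)
    induction a using Nat.strong_induction_on with
    | _ a ih =>
      intro x hx y hy hxy
      match a, ih with
      | 0, _ => exact u₀ x hx y hy (by linarith)
      | 1, _ => exact u₁ x hx y hy (by linarith)
      | 2, _ => exact u₂ x hx y hy (by linarith)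
      | a + 3, ih =>
        have e : ∀ x, φ^[a + 3] x = φ^[a] x + p := fun x => by
          rw [add_comm a 3, Function.iterate_add_apply]
          exact hφ3 _
        rw [e, e, add_sub_add_right_eq_sub]
        exact ih a (by omega) x hx y hy hxy
  obtain ⟨m, hm⟩ := exists_nat_gt (φ 0 / η)
  have hm0 : (0 : ℝ) < m := lt_of_le_of_lt (by positivity) hm
  have hmpos : 0 < m := by exact_mod_cast hm0
  -- The quotient of `k` by `m` numbers the fundamental domain, the remainder the part inside it.
  set τ : ℕ → ℝ := fun k => φ^[k / m] (((k % m : ℕ) : ℝ) / m * φ 0) with hτ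
  have hsucc : ∀ k, τ (k + 1) = φ^[k / m] ((((k % m : ℕ) : ℝ) + 1) / m * φ 0) := by
    intro k
    simp only [hτ]
    rcases succ_div_mod hmpos k with ⟨h1, h2⟩ | ⟨h1, h2, h3⟩
    · rw [h1, h2]; push_cast; rfl
    · have h4 : ((k % m : ℕ) : ℝ) + 1 = m := by exact_mod_cast h3
      rw [h1, h2, h4, div_self hm0.ne', one_mul, Function.iterate_succ_apply]
      simp
  have hstep : ∀ k : ℕ, (((k % m : ℕ) : ℝ) + 1) / m * φ 0 - ((k % m : ℕ) : ℝ) / m * φ 0 =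
      φ 0 / m := fun k => by ring
  have hstep0 : 0 < φ 0 / m := by positivity
  have hlt : ∀ k, τ k < τ (k + 1) := by
    intro k
    rw [hsucc]
    exact hmono.iterate _ (by linarith [hstep k])
  refine ⟨m, τ, hmpos, by simp [hτ], hlt, fun k => ?_, fun k => ?_⟩
  · refine (le_abs_self _).trans ?_
    rw [hsucc]
    have h1 : ((k % m : ℕ) : ℝ) + 1 ≤ m := by exact_mod_cast Nat.mod_lt k hmpos
    have h2 : (0 : ℝ) ≤ ((k % m : ℕ) : ℝ) := Nat.cast_nonneg _
    have h3 : (((k % m : ℕ) : ℝ) + 1) / m * φ 0 ≤ φ 0 := by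
      rw [div_mul_eq_mul_div, div_le_iff₀ hm0]
      nlinarith
    have h4 : 0 ≤ ((k % m : ℕ) : ℝ) / m * φ 0 := by positivity
    refine hunif _ _ ⟨by linarith [hstep k], h3⟩ _ ⟨h4, by linarith [hstep k]⟩ ?_
    rw [hstep, abs_of_pos hstep0, div_lt_comm₀ hm0 hη]
    exact hm
  · simp only [hτ]
    rw [Nat.add_div_right _ hmpos, Nat.add_mod_right, Function.iterate_succ_apply']

theorem exists_equivariant_sequence {α : Type*} (f : α → α) {R : ℕ → α → Prop} {m : ℕ}
    (hm : 0 < m) (hR : ∀ k, ∃ z, R k z) (hf : ∀ k z, R k z → R (k + m) (f z)) :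
    ∃ Z : ℕ → α, (∀ k, Z (k + m) = f (Z k)) ∧ ∀ k, R k (Z k) := by
  choose z hz using hR
  have hZ : ∀ k, f^[(k + m) / m] (z ((k + m) % m)) = f (f^[k / m] (z (k % m))) := fun k => by
    rw [Nat.add_div_right _ hm, Nat.add_mod_right, Function.iterate_succ_apply']
  refine ⟨fun k => f^[k / m] (z (k % m)), hZ, fun k => ?_⟩
  induction k using Nat.strong_induction_on with
  | _ k ih =>
    rcases lt_or_ge k m with h | h
    · simp only [Nat.div_eq_of_lt h, Nat.mod_eq_of_lt h]
      exact hz k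
    · obtain ⟨j, rfl⟩ := Nat.exists_eq_add_of_le' h
      simp only [hZ]
      exact hf j _ (ih j (by omega))

theorem exists_isEvenVec_near (v : E3) : ∃ z, IsEvenVec z ∧ ‖z - v‖ ≤ 4 := by
  refine ⟨intVec fun j => 2 * ⌊v j / 2⌋, ⟨_, fun j => even_two_mul _, rfl⟩, ?_⟩
  have hcoord : ∀ j, ‖(intVec (fun j => 2 * ⌊v j / 2⌋) - v) j‖ ^ 2 ≤ 4 := by
    intro j
    rw [PiLp.sub_apply, intVec_apply, Real.norm_eq_abs, sq_abs]
    have h1 := Int.floor_le (v j / 2)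
    have h2 := Int.lt_floor_add_one (v j / 2)
    push_cast
    nlinarith
  rw [EuclideanSpace.norm_eq, Fin.sum_univ_three]
  -- The squared error is at most `3 * 4`, below `4 ^ 2`.
  refine Real.sqrt_le_iff.2 ⟨by norm_num, ?_⟩
  linarith [hcoord 0, hcoord 1, hcoord 2]

theorem IsEvenVec.map {ρ : E3 ≃ᵃⁱ[ℝ] E3} (hρ : IsSym ρ) (hρ0 : ρ 0 = 0) {v : E3}
    (hv : IsEvenVec v) : IsEvenVec (ρ v) := by
  obtain ⟨a, σ, ε, -, -, h⟩ := hρ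
  obtain ⟨z, hz, rfl⟩ := hv
  refine ⟨fun j => ε j * z (σ j), fun j => (hz _).mul_left _, ?_⟩
  ext j
  have h0 := h 0 j
  rw [hρ0] at h0
  simp only [PiLp.zero_apply, mul_zero, add_zero] at h0
  rw [h, ← h0, intVec_apply, intVec_apply]
  push_cast
  ring

/-! ### Lattice polygons that turn slowly -/

section Bevel

/-- The weight of the second edge in the successive steps of a bevel. -/
def bevelWeight (D i : ℕ) : ℕ := min (i - 1) D

/-- The polygon that joins the midpoints of the edges of a multiple of `Z` by bevels, each having
`D + 3` edges. -/
noncomputable def bevel (D : ℕ) (Z : ℕ → E3) (k : ℕ) : E3 :=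
  ((D / 2 * (D + 3) : ℕ) : ℝ) • (Z (k / (D + 3)) + Z (k / (D + 3) + 1)) +
    ((((k % (D + 3)) * D : ℕ) : ℝ) - ((∑ i ∈ Finset.range (k % (D + 3)), bevelWeight D i : ℕ) : ℝ)) •
      (Z (k / (D + 3) + 1) - Z (k / (D + 3))) +
    ((∑ i ∈ Finset.range (k % (D + 3)), bevelWeight D i : ℕ) : ℝ) •
      (Z (k / (D + 3) + 2) - Z (k / (D + 3) + 1))

variable {D : ℕ} {Z : ℕ → E3}

/-- Because of truncated subtraction the weights are `0, 0, 1, 2, …, D - 1, D, D`. Their sum is half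
of `D * (D + 3)`, so a bevel uses half of each of the two edges and ends at a midpoint. The repeated
extreme weights keep the polygon straight around the midpoints. -/
theorem sum_bevelWeight (hD : Even D) :
    ∑ i ∈ Finset.range (D + 3), bevelWeight D i = D / 2 * (D + 3) := by
  obtain ⟨r, rfl⟩ := hD
  have h1 : ∀ n, n ≤ r + r + 2 → 2 * ∑ i ∈ Finset.range n, bevelWeight (r + r) i =
      (n - 1) * (n - 2) := by
    intro n
    induction n with
    | zero => simp
    | succ n ih =>
      intro hn
      rw [Finset.sum_range_succ, Nat.mul_add, ih (by omega), bevelWeight, min_eq_left (by omega)]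
      match n with
      | 0 => simp
      | 1 => simp
      | n + 2 =>
        rw [show n + 2 - 1 = n + 1 by omega, show n + 2 - 2 = n by omega,
          show n + 2 + 1 - 1 = n + 2 by omega, show n + 2 + 1 - 2 = n + 1 by omega]
        ring
  have h2 := h1 (r + r + 2) le_rfl
  have h3 : bevelWeight (r + r) (r + r + 2) = r + r := by
    rw [bevelWeight]; exact min_eq_right (by omega)
  rw [Finset.sum_range_succ, h3, show (r + r) / 2 = r by omega]
  simp only [Nat.add_sub_cancel, Nat.add_succ_sub_one] at h2
  nlinarith

theorem bevelWeight_le (D i : ℕ) : bevelWeight D i ≤ D := min_le_right _ _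

theorem bevel_succ (hD : Even D) (k : ℕ) : bevel D Z (k + 1) - bevel D Z k =
    ((D : ℝ) - bevelWeight D (k % (D + 3))) • (Z (k / (D + 3) + 1) - Z (k / (D + 3))) +
      (bevelWeight D (k % (D + 3)) : ℝ) • (Z (k / (D + 3) + 2) - Z (k / (D + 3) + 1)) := by
  have hsum := sum_bevelWeight hD
  have hpos : 0 < D + 3 := by omega
  simp only [bevel]
  rcases succ_div_mod hpos k with ⟨h1, h2⟩ | ⟨h1, h2, h3⟩
  · rw [h1, h2, Finset.sum_range_succ]
    push_cast
    module
  · rw [h1, h2]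
    set i := k % (D + 3)
    set j := k / (D + 3)
    rw [← h3, Finset.sum_range_succ] at hsum
    have hsum' : ((D / 2 * (D + 3) : ℕ) : ℝ) =
        ((∑ i ∈ Finset.range i, bevelWeight D i : ℕ) : ℝ) + bevelWeight D i := by
      rw [← h3, ← hsum]; push_cast; rfl
    have h4 : ((i * D : ℕ) : ℝ) + D = 2 * ((D / 2 * (D + 3) : ℕ) : ℝ) := by
      have : i * D + D = 2 * (D / 2 * (D + 3)) := by
        rw [← mul_assoc, Nat.two_mul_div_two_of_even hD, ← h3]; ring
      exact_mod_cast this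
    have h5 : ((i * D : ℕ) : ℝ) = 2 * (((∑ i ∈ Finset.range i, bevelWeight D i : ℕ) : ℝ) +
        bevelWeight D i) - D := by rw [← hsum']; linarith
    rw [hsum', h5]
    simp only [Finset.range_zero, Finset.sum_empty, Nat.cast_zero, zero_mul, zero_smul, add_zero,
      sub_zero]
    module

theorem IsEvenVec.bevel (hZ : ∀ k, IsEvenVec (Z k)) (k : ℕ) : IsEvenVec (bevel D Z k) := by
  have hint : ∀ (a b : ℕ) {v : E3}, IsEvenVec v → IsEvenVec (((a : ℝ) - b) • v) := by
    intro a b v hv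
    rw [sub_smul]
    exact (hv.natCast_smul a).sub (hv.natCast_smul b)
  exact ((((hZ _).add (hZ _)).natCast_smul _).add (hint _ _ ((hZ _).sub (hZ _)))).add
    (((hZ _).sub (hZ _)).natCast_smul _)

theorem isometry_smul_of_fixed {ρ : E3 ≃ᵃⁱ[ℝ] E3} (hρ0 : ρ 0 = 0) (x : E3) :
    ρ x = ρ.linearIsometryEquiv x := by
  rw [isometry_apply ρ x, hρ0, add_zero]

theorem bevel_shift {ρ : E3 ≃ᵃⁱ[ℝ] E3} (hρ0 : ρ 0 = 0) {m : ℕ} (hZ : ∀ k, Z (k + m) = ρ (Z k))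
    (k : ℕ) : bevel D Z (k + m * (D + 3)) = ρ (bevel D Z k) := by
  have hpos : 0 < D + 3 := by omega
  have e : ∀ j i, Z (j + m + i) = ρ.linearIsometryEquiv (Z (j + i)) := fun j i => by
    rw [add_right_comm, hZ, isometry_smul_of_fixed hρ0]
  have e0 : ∀ j, Z (j + m) = ρ.linearIsometryEquiv (Z j) := fun j => e j 0
  rw [isometry_smul_of_fixed hρ0]
  simp only [bevel, Nat.add_mul_div_right _ _ hpos, Nat.add_mul_mod_self_right, e, e0, map_add,
    map_sub, map_smul]

/-- If `D = (b - a) * t`, the two factors are `b - a` times the consecutive integers `t * a + c` and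
`t * a + c + 1`, which cannot have opposite signs. -/
theorem mul_nonneg_of_dvd {D a b : ℤ} (h : a ≠ b → b - a ∣ D) (c : ℤ) :
    0 ≤ ((D - c) * a + c * b) * ((D - (c + 1)) * a + (c + 1) * b) := by
  rcases eq_or_ne a b with rfl | hab
  · have : ((D - c) * a + c * a) * ((D - (c + 1)) * a + (c + 1) * a) = (D * a) ^ 2 := by ring
    rw [this]; positivity
  · obtain ⟨t, ht⟩ := h hab
    have : ((D - c) * a + c * b) * ((D - (c + 1)) * a + (c + 1) * b) =
        (b - a) ^ 2 * ((t * a + c) * (t * a + c + 1)) := by rw [ht]; ring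
    rw [this]
    refine mul_nonneg (sq_nonneg _) ?_
    rcases le_or_gt 0 (t * a + c) with h | h
    · positivity
    · exact mul_nonneg_of_nonpos_of_nonpos h.le (by omega)

/-- Inside a bevel the weight grows by at most one per step, so a root takes two consecutive values
of an arithmetic progression that does not jump over zero. Where two bevels meet, the adjacent edges
coincide as vectors. -/
theorem bevel_compat (hD : Even D) (hZ : ∀ k, IsEvenVec (Z k))
    (hdvd : ∀ (j : ℕ) (n : Fin 3 → ℤ) (a b : ℤ), IsRoot n →
      inner ℝ (intVec n) (Z (j + 1) - Z j) = a → inner ℝ (intVec n) (Z (j + 2) - Z (j + 1)) = b →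
      a ≠ b → b - a ∣ (D : ℤ)) (k : ℕ) {n : Fin 3 → ℤ} (hn : IsRoot n) :
    0 ≤ inner ℝ (intVec n) (bevel D Z (k + 1) - bevel D Z k) *
      inner ℝ (intVec n) (bevel D Z (k + 2) - bevel D Z (k + 1)) := by
  have hpos : 0 < D + 3 := by omega
  rw [bevel_succ hD, show k + 2 = k + 1 + 1 from rfl, bevel_succ hD (k + 1)]
  rcases succ_div_mod hpos k with ⟨h1, h2⟩ | ⟨h1, h2, h3⟩
  · rw [h1, h2]
    set i := k % (D + 3)
    set j := k / (D + 3)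
    obtain ⟨a, ha⟩ := ((hZ (j + 1)).sub (hZ j)).inner_eq n
    obtain ⟨b, hb⟩ := ((hZ (j + 2)).sub (hZ (j + 1))).inner_eq n
    simp only [inner_add_right, inner_smul_right, ha, hb]
    have hw : bevelWeight D (i + 1) = bevelWeight D i ∨
        bevelWeight D (i + 1) = bevelWeight D i + 1 := by simp only [bevelWeight]; omega
    rcases hw with hw | hw
    · rw [hw]; exact mul_self_nonneg _
    · rw [hw]
      have := mul_nonneg_of_dvd (D := D) (a := a) (b := b) (hdvd j n a b hn ha hb)
        (bevelWeight D i)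
      have h5 : ((0 : ℤ) : ℝ) ≤ _ := Int.cast_le.2 this
      push_cast at h5 ⊢
      exact h5
  · rw [h1, h2]
    have w1 : bevelWeight D (k % (D + 3)) = D := by simp only [bevelWeight]; omega
    have w2 : bevelWeight D 0 = 0 := by simp [bevelWeight]
    rw [w1, w2]
    simp only [sub_self, zero_smul, zero_add, Nat.cast_zero, sub_zero, add_zero]
    exact mul_self_nonneg _

theorem isLatticeLoop_bevel {ρ : E3 ≃ᵃⁱ[ℝ] E3} {m : ℕ} (hm : 0 < m) (hρ0 : ρ 0 = 0) (hD : Even D)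
    (hZ : ∀ k, IsEvenVec (Z k)) (hshift : ∀ k, Z (k + m) = ρ (Z k))
    (hdvd : ∀ (j : ℕ) (n : Fin 3 → ℤ) (a b : ℤ), IsRoot n →
      inner ℝ (intVec n) (Z (j + 1) - Z j) = a → inner ℝ (intVec n) (Z (j + 2) - Z (j + 1)) = b →
      a ≠ b → b - a ∣ (D : ℤ))
    (hne : ∀ k, bevel D Z (k + 1) - bevel D Z k ≠ 0)
    (hsimple : IsSimpleClosedPolygon (3 * (m * (D + 3))) (bevel D Z)) :
    IsLatticeLoop ρ (m * (D + 3)) (bevel D Z) := by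
  have hpos : 0 < D + 3 := by omega
  refine ⟨by nlinarith, IsEvenVec.bevel hZ, bevel_shift hρ0 hshift, hne,
    fun k n hn => bevel_compat hD hZ hdvd k hn, fun k hk => ⟨1, 1, one_pos, one_pos, ?_⟩, hsimple⟩
  -- The vertex `k + 2` begins a bevel; the two edges before it have weight `D` and the one after it
  -- weight `0`, so all three equal `D` times the same edge of `Z`.
  obtain ⟨q, hq⟩ := (Dvd.intro_left m rfl : D + 3 ∣ m * (D + 3)).trans hk
  have hq0 : 0 < q := by
    rcases Nat.eq_zero_or_pos q with h | h
    · rw [h] at hq; omega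
    · exact h
  obtain ⟨j, rfl⟩ : ∃ j, q = j + 1 := ⟨q - 1, by omega⟩
  have e : (D + 3) * (j + 1) = (D + 3) * j + (D + 3) := by ring
  have hdm : ∀ i i', i' < D + 3 → i = (D + 3) * j + i' → i / (D + 3) = j ∧ i % (D + 3) = i' := by
    rintro i i' hi' rfl
    rw [Nat.mul_add_div hpos, Nat.div_eq_of_lt hi', Nat.mul_add_mod, Nat.mod_eq_of_lt hi']
    exact ⟨rfl, rfl⟩
  obtain ⟨d0, m0⟩ := hdm k (D + 1) (by omega) (by omega)
  obtain ⟨d1, m1⟩ := hdm (k + 1) (D + 2) (by omega) (by omega)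
  have d2 : (k + 2) / (D + 3) = j + 1 := by rw [hq, Nat.mul_div_cancel_left _ hpos]
  have m2 : (k + 2) % (D + 3) = 0 := by rw [hq, Nat.mul_mod_right]
  have w0 : bevelWeight D (D + 1) = D := by simp only [bevelWeight]; omega
  have w1 : bevelWeight D (D + 2) = D := by simp only [bevelWeight]; omega
  have w2 : bevelWeight D 0 = 0 := by simp [bevelWeight]
  have e0 := bevel_succ (Z := Z) hD k
  have e1 := bevel_succ (Z := Z) hD (k + 1)
  have e2 := bevel_succ (Z := Z) hD (k + 2)
  rw [d0, m0, w0] at e0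
  rw [d1, m1, w1] at e1
  rw [d2, m2, w2] at e2
  simp only [sub_self, zero_smul, zero_add, Nat.cast_zero, sub_zero, add_zero, one_smul] at *
  rw [show k + 3 = k + 2 + 1 from rfl, show k + 2 = k + 1 + 1 from rfl] at *
  rw [e0, e1, e2]
  exact ⟨rfl, rfl⟩

end Bevel

/-- The differences `b - a` are bounded by some `M`, so `2 * M!` is divisible by all of them, and it
is even. -/
theorem exists_dvd_of_bounded {Z : ℕ → E3} {B : ℝ} (hB : ∀ j, ‖Z (j + 1) - Z j‖ ≤ B) :
    ∃ D : ℕ, 0 < D ∧ Even D ∧ ∀ (j : ℕ) (n : Fin 3 → ℤ) (a b : ℤ), IsRoot n →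
      inner ℝ (intVec n) (Z (j + 1) - Z j) = a → inner ℝ (intVec n) (Z (j + 2) - Z (j + 1)) = b →
      a ≠ b → b - a ∣ (D : ℤ) := by
  obtain ⟨M, hM⟩ := exists_nat_ge (4 * B)
  refine ⟨2 * M.factorial, by positivity, even_two_mul _, fun j n a b hn ha hb hab => ?_⟩
  have hroot : ∀ i, |(inner ℝ (intVec n) (Z (i + 1) - Z i) : ℝ)| ≤ 2 * B := fun i =>
    (abs_real_inner_le_norm _ _).trans
      (mul_le_mul (norm_intVec_le hn) (hB i) (norm_nonneg _) (by norm_num))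
  have h1 := hroot j
  have h2 := hroot (j + 1)
  rw [ha] at h1
  rw [hb] at h2
  have h3 : ((|b - a| : ℤ) : ℝ) ≤ M := by
    push_cast
    rw [abs_le] at h1 h2 ⊢
    constructor <;> linarith [h1.1, h1.2, h2.1, h2.2]
  have h4 : (b - a).natAbs ≤ M := by
    have : |b - a| ≤ (M : ℤ) := by exact_mod_cast h3
    rw [Int.abs_eq_natAbs] at this
    omega
  have h5 : (b - a).natAbs ∣ 2 * M.factorial :=
    (Nat.dvd_factorial (Int.natAbs_pos.2 (sub_ne_zero.2 hab.symm)) h4).mul_left 2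
  exact Int.natAbs_dvd.1 (Int.natCast_dvd_natCast.2 h5)

theorem norm_bevel_succ_le {D : ℕ} {Z : ℕ → E3} {B : ℝ} (hD : Even D)
    (hB : ∀ j, ‖Z (j + 1) - Z j‖ ≤ B) (k : ℕ) : ‖bevel D Z (k + 1) - bevel D Z k‖ ≤ D * B := by
  have hw : (bevelWeight D (k % (D + 3)) : ℝ) ≤ D := by exact_mod_cast bevelWeight_le _ _
  have h0 : (0 : ℝ) ≤ bevelWeight D (k % (D + 3)) := Nat.cast_nonneg _
  rw [bevel_succ hD]
  refine (norm_add_le _ _).trans ?_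
  rw [norm_smul, norm_smul, Real.norm_of_nonneg (sub_nonneg.2 hw), Real.norm_of_nonneg h0]
  have h1 := mul_le_mul_of_nonneg_left (hB (k / (D + 3))) (sub_nonneg.2 hw)
  have h2 := mul_le_mul_of_nonneg_left (hB (k / (D + 3) + 1)) h0
  linarith

theorem le_inner_bevel_succ {D : ℕ} {Z : ℕ → E3} (hD : Even D) (hD0 : 0 < D) {k : ℕ} {d : E3}
    (h1 : 1 ≤ inner ℝ (Z (k / (D + 3) + 1) - Z (k / (D + 3))) d)
    (h2 : 1 ≤ inner ℝ (Z (k / (D + 3) + 2) - Z (k / (D + 3) + 1)) d) :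
    1 ≤ inner ℝ (bevel D Z (k + 1) - bevel D Z k) d := by
  have hw : (bevelWeight D (k % (D + 3)) : ℝ) ≤ D := by exact_mod_cast bevelWeight_le _ _
  have h0 : (0 : ℝ) ≤ bevelWeight D (k % (D + 3)) := Nat.cast_nonneg _
  have hD1 : (1 : ℝ) ≤ D := by exact_mod_cast hD0
  rw [bevel_succ hD, inner_add_left, real_inner_smul_left, real_inner_smul_left]
  have e1 := mul_le_mul_of_nonneg_left h1 (sub_nonneg.2 hw)
  have e2 := mul_le_mul_of_nonneg_left h2 h0
  linarith

/-! ### Approximation of a symmetric loop by a lattice loop. -/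

namespace IsMonotoneLoop

variable {p : ℝ} {γ : ℝ → E3}

set_option maxHeartbeats 1000000 in
-- The points `Q • γ (τ j)` are rounded to even vectors `Z j`, equivariantly, and the resulting
-- polygon is bevelled. The rounding error is bounded independently of `Q`, so for large `Q` the
-- edges still advance in the directions in which `γ` does.
theorem exists_latticeLoop (h : IsMonotoneLoop p γ) {ρ : E3 ≃ᵃⁱ[ℝ] E3} (hρ : IsSym ρ)
    (hρ0 : ρ 0 = 0) (hρ3 : ρ ^ 3 = 1) {φ : ℝ → ℝ} (hφ : Continuous φ) (hφm : StrictMono φ)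
    (hφ3 : ∀ t, φ (φ (φ t)) = t + p) (hγφ : ∀ t, γ (φ t) = ρ (γ t)) :
    ∃ (m : ℕ) (V : ℕ → E3), IsLatticeLoop ρ m V ∧ AmbientIsotopic (range γ) (polygon (3 * m) V) := by
  obtain ⟨K, hK, hl⟩ := h.lipschitz
  obtain ⟨ε, r, hε, hr, hmono⟩ := h.monotone
  obtain ⟨μ, hμ, hsep⟩ := h.exists_separation (half_pos hr)
  -- With cuts at most `r / 4` apart, an arc of parameter length `r / 2` lengthened by two cuts
  -- stays within the scale `r`; the other bound keeps `γ` within `μ / 20` on each piece.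
  set δ := min (r / 4) (μ / (20 * (K + 1))) with hδ
  have hδ0 : 0 < δ := by positivity
  have hδr : δ ≤ r / 4 := min_le_left _ _
  have hδμ : K * δ ≤ μ / 20 := by
    have h1 : δ ≤ μ / (20 * (K + 1)) := min_le_right _ _
    rw [le_div_iff₀ (by positivity)] at h1
    nlinarith
  obtain ⟨m, τ, hm, hτ0, hτlt, hτδ, hτm⟩ := exists_cuts h.pos hδ0 hφ hφm hφ3
  have hτ3 : ∀ j, τ (j + 3 * m) = τ j + p := fun j => by
    rw [show j + 3 * m = j + m + m + m by ring, hτm, hτm, hτm, hφ3]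
  obtain ⟨σ, hσ, hτσ⟩ : ∃ σ > 0, ∀ j, σ ≤ τ (j + 1) - τ j := by
    obtain ⟨B, hB0, hB⟩ := exists_bound_of_periodic (fun j => (τ (j + 1) - τ j)⁻¹)
      (n := 3 * m) (by omega) (fun j => by
        rw [add_right_comm, hτ3, hτ3, add_sub_add_right_eq_sub])
    refine ⟨(B + 1)⁻¹, by positivity, fun j => ?_⟩
    have h1 := sub_pos.2 (hτlt j)
    rw [inv_le_comm₀ (by positivity) h1]
    linarith [hB j]
  have hτmono : StrictMono τ := strictMono_nat_of_lt_succ hτlt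
  -- The second summand makes the advance `Q * ε * σ` of an edge exceed its rounding error `8` by at
  -- least one; the first one makes the accumulated rounding errors small against `Q * μ`.
  obtain ⟨Q, hQ⟩ := exists_nat_gt (128 / μ + 9 / (ε * σ))
  have hQ1 : 128 ≤ Q * μ := by
    rw [← div_le_iff₀ hμ]
    have : 0 ≤ 9 / (ε * σ) := by positivity
    linarith
  have hQ2 : 9 ≤ Q * (ε * σ) := by
    rw [← div_le_iff₀ (by positivity)]
    have : 0 ≤ 128 / μ := by positivity
    linarith
  have hQ0 : (0 : ℝ) < Q := lt_of_le_of_lt (by positivity) hQ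
  obtain ⟨Z, hZρ, hZ⟩ := exists_equivariant_sequence ρ
    (R := fun k z => IsEvenVec z ∧ ‖z - (Q : ℝ) • γ (τ k)‖ ≤ 4) hm
    (fun k => exists_isEvenVec_near _) (fun k z hz => ⟨hz.1.map hρ hρ0, by
      rw [hτm, hγφ, isometry_smul_of_fixed hρ0, isometry_smul_of_fixed hρ0, ← map_smul, ← map_sub,
        LinearIsometryEquiv.norm_map]
      exact hz.2⟩)
  set B : ℝ := Q * (K * δ) + 8 with hB
  have hB0 : 0 ≤ B := by positivity
  have hZE : ∀ j, Z (j + 1) - Z j = (Q : ℝ) • (γ (τ (j + 1)) - γ (τ j)) +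
      ((Z (j + 1) - (Q : ℝ) • γ (τ (j + 1))) - (Z j - (Q : ℝ) • γ (τ j))) := fun j => by module
  have hZerr : ∀ j, ‖(Z (j + 1) - (Q : ℝ) • γ (τ (j + 1))) - (Z j - (Q : ℝ) • γ (τ j))‖ ≤ 8 :=
    fun j => (norm_sub_le _ _).trans (by linarith [(hZ j).2, (hZ (j + 1)).2])
  have hZB : ∀ j, ‖Z (j + 1) - Z j‖ ≤ B := by
    intro j
    rw [hZE]
    refine (norm_add_le _ _).trans (add_le_add ?_ (hZerr j))
    rw [norm_smul, Real.norm_of_nonneg hQ0.le]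
    refine mul_le_mul_of_nonneg_left ((hl _ _ (hτlt j).le).trans ?_) hQ0.le
    exact mul_le_mul_of_nonneg_left (hτδ j) hK
  obtain ⟨D, hD0, hDe, hdvd⟩ := exists_dvd_of_bounded hZB
  set V := bevel D Z with hV
  set ℓ := D + 3 with hℓ
  have hℓ0 : 0 < ℓ := by omega
  have hℓ1 : (1 : ℝ) ≤ ℓ := by exact_mod_cast hℓ0
  have hD1 : (1 : ℝ) ≤ D := by exact_mod_cast hD0
  have hVshift : ∀ k, V (k + m * ℓ) = ρ (V k) := bevel_shift hρ0 hZρ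
  have hEd : ∀ t d, ‖d‖ ≤ 1 → (∀ s s', t - r ≤ s → s ≤ s' → s' ≤ t + r →
      ε * (s' - s) ≤ inner ℝ (γ s' - γ s) d) → ∀ j, t - r ≤ τ j → τ (j + 1) ≤ t + r →
      1 ≤ inner ℝ (Z (j + 1) - Z j) d := by
    intro t d hd hmd j h1 h2
    have h3 := hmd _ _ h1 (hτlt j).le h2
    rw [hZE, inner_add_left, real_inner_smul_left]
    have h4 := neg_le_of_abs_le (abs_real_inner_le_norm
      ((Z (j + 1) - (Q : ℝ) • γ (τ (j + 1))) - (Z j - (Q : ℝ) • γ (τ j))) d)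
    have h5 := mul_le_mul (hZerr j) hd (norm_nonneg _) (by norm_num)
    have h6 := mul_le_mul_of_nonneg_left (hτσ j) hε.le
    have h7 := mul_le_mul_of_nonneg_left (h6.trans h3) hQ0.le
    linarith
  have hVd : ∀ t d, ‖d‖ ≤ 1 → (∀ s s', t - r ≤ s → s ≤ s' → s' ≤ t + r →
      ε * (s' - s) ≤ inner ℝ (γ s' - γ s) d) → ∀ k, t - r ≤ τ (k / ℓ) → τ (k / ℓ + 2) ≤ t + r →
      1 ≤ inner ℝ (V (k + 1) - V k) d := by
    intro t d hd hmd k h1 h2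
    have h3 := hτlt (k / ℓ)
    have h4 := hτlt (k / ℓ + 1)
    rw [show k / ℓ + 1 + 1 = k / ℓ + 2 from rfl] at h4
    exact le_inner_bevel_succ hDe hD0 (hEd t d hd hmd _ h1 (by linarith))
      (hEd t d hd hmd (k / ℓ + 1) (by linarith) h2)
  have hne : ∀ k, V (k + 1) - V k ≠ 0 := by
    intro k hk
    obtain ⟨d, hd, hmd⟩ := hmono (τ (k / ℓ))
    have h3 := hτδ (k / ℓ)
    have h4 := hτδ (k / ℓ + 1)
    rw [show k / ℓ + 1 + 1 = k / ℓ + 2 from rfl] at h4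
    have := hVd _ d hd hmd k (by linarith) (by linarith)
    rw [hk, inner_zero_left] at this
    linarith
  have hVB : ∀ k, ‖V (k + 1) - V k‖ ≤ D * B := norm_bevel_succ_le hDe hZB
  have hV3 : ∀ k, V (k + 3 * (m * ℓ)) = V k := fun k => by
    rw [show k + 3 * (m * ℓ) = k + m * ℓ + m * ℓ + m * ℓ by ring, hVshift, hVshift, hVshift]
    exact congrArg (fun f : E3 ≃ᵃⁱ[ℝ] E3 => f (V k)) (show ρ * (ρ * ρ) = 1 by
      rw [← hρ3, pow_succ, pow_two, mul_assoc])
  set Θ := interp τ with hΘ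
  have hΘmono : StrictMonoOn Θ (Ici 0) := strictMonoOn_interp hτmono
  have hΘnat : ∀ j : ℕ, Θ j = τ j := interp_natCast τ
  have hΘlow : ∀ t t', 0 ≤ t → t ≤ t' → σ * (t' - t) ≤ Θ t' - Θ t := fun t t' ht htt =>
    le_interp_sub τ (fun i _ _ => hτσ i) ht htt
  have hΘup : ∀ t t', 0 ≤ t → t ≤ t' → Θ t' - Θ t ≤ δ * (t' - t) := fun t t' ht htt =>
    (le_abs_self _).trans (norm_interp_sub_le τ (K := δ) (fun i => by
      rw [Real.norm_of_nonneg (sub_pos.2 (hτlt i)).le]; exact hτδ i) ht htt)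
  have hΘle : ∀ t t', 0 ≤ t → t ≤ t' → Θ t ≤ Θ t' := fun t t' ht htt =>
    hΘmono.monotoneOn (mem_Ici.2 ht) (mem_Ici.2 (ht.trans htt)) htt
  set q : ℝ := ((3 * m : ℕ) : ℝ) with hq
  have hq0 : 0 ≤ q := Nat.cast_nonneg _
  have hΘper : ∀ t, 0 ≤ t → Θ (t + q) = Θ t + p := by
    intro t ht
    rw [hΘ, hq, interp_shift τ _ ht]
    simp only [hτ3]
    exact (map_interp (AffineMap.id ℝ ℝ + AffineMap.const ℝ ℝ p) τ t).symm
  -- The bevel polygon begins its pieces at `D * ℓ` times the midpoints of the edges of `Z`, and `Z`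
  -- approximates `Q • γ`.
  set R : ℝ := D * ℓ * Q with hR
  have hR0 : 0 < R := by positivity
  have hκ1 : min 1 (R * (ε * σ)) ≤ 1 := min_le_left _ _
  have hκ2 : min 1 (R * (ε * σ)) ≤ R * (ε * σ) := min_le_right _ _
  have near : ∀ t t' : ℝ, 0 ≤ t → t ≤ t' → Θ t' - Θ t ≤ r / 2 → ∃ d : E3, ‖d‖ ≤ 1 ∧
      min 1 (R * (ε * σ)) * (t' - t) ≤ inner ℝ (R • γ (Θ t') - R • γ (Θ t)) d ∧
      min 1 (R * (ε * σ)) * (t' - t) ≤ inner ℝ (interp V (ℓ * t') - interp V (ℓ * t)) d := by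
    intro t t' ht htt hnear
    have ht' := ht.trans htt
    obtain ⟨d, hd, hmd⟩ := hmono (Θ t)
    have hs : 0 ≤ t' - t := sub_nonneg.2 htt
    refine ⟨d, hd, ?_, ?_⟩
    · rw [← smul_sub, real_inner_smul_left]
      have h1 := hmd (Θ t) (Θ t') (by linarith) (hΘle t t' ht htt) (by linarith)
      have h2 := mul_le_mul_of_nonneg_left (hΘlow t t' ht htt) hε.le
      have h3 := mul_le_mul_of_nonneg_left (h2.trans h1) hR0.le
      have h4 := mul_le_mul_of_nonneg_right hκ2 hs
      linarith
    · have h1 := le_inner_interp_sub V d (κ := 1) (u := ℓ * t) (u' := ℓ * t') (fun k hk hk' => ?_)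
        (by positivity) (by gcongr)
      · have h2 := mul_le_mul_of_nonneg_right hκ1 hs
        have h3 := mul_le_mul_of_nonneg_right hℓ1 hs
        linarith
      · have h2 : ((k / ℓ : ℕ) : ℝ) ≤ t' := by
          have : ((k / ℓ * ℓ : ℕ) : ℝ) ≤ k := by exact_mod_cast Nat.div_mul_le_self k ℓ
          push_cast at this
          nlinarith
        have h3 : t ≤ ((k / ℓ + 1 : ℕ) : ℝ) := by
          have e1 := Nat.lt_floor_add_one ((ℓ : ℝ) * t)
          have e2 : ⌊(ℓ : ℝ) * t⌋₊ + 1 ≤ ℓ * (k / ℓ + 1) :=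
            (Nat.succ_le_succ hk).trans (Nat.lt_mul_div_succ k hℓ0)
          have e3 : ((⌊(ℓ : ℝ) * t⌋₊ + 1 : ℕ) : ℝ) ≤ ((ℓ * (k / ℓ + 1) : ℕ) : ℝ) := by
            exact_mod_cast e2
          push_cast at e3 ⊢
          nlinarith
        have h4 := hΘle _ _ (Nat.cast_nonneg _) h2
        have h5 := hΘle _ _ ht h3
        rw [hΘnat] at h4 h5
        have h6 := hτδ (k / ℓ)
        have h7 := hτδ (k / ℓ + 1)
        rw [show k / ℓ + 1 + 1 = k / ℓ + 2 from rfl] at h7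
        exact hVd _ d hd hmd k (by linarith) (by linarith)
  have hDB : 0 ≤ (D : ℝ) * B := by positivity
  have hxL : ∀ t t', 0 ≤ t → t ≤ t' →
      ‖R • γ (Θ t') - R • γ (Θ t)‖ ≤ R * (K * δ) * (t' - t) := by
    intro t t' ht htt
    rw [← smul_sub, norm_smul, Real.norm_of_nonneg hR0.le]
    have h1 := hl _ _ (hΘle t t' ht htt)
    have h2 := mul_le_mul_of_nonneg_left (hΘup t t' ht htt) hK
    have h3 := mul_le_mul_of_nonneg_left (h1.trans h2) hR0.le
    linarith
  have hyL : ∀ t t', 0 ≤ t → t ≤ t' →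
      ‖interp V (ℓ * t') - interp V (ℓ * t)‖ ≤ D * B * ℓ * (t' - t) := by
    intro t t' ht htt
    have := norm_interp_sub_le V (K := D * B) hVB (u := ℓ * t) (u' := ℓ * t') (by positivity)
      (by gcongr)
    linarith
  obtain ⟨hiso, hinj⟩ := ambientIsotopic_of_windows (fun t => R • γ (Θ t))
    (fun t => interp V (ℓ * t)) (p := q) (κ := min 1 (R * (ε * σ)))
    (K := R * (K * δ) + D * B * ℓ) (D := 1) (m := R * μ) (by positivity) (by positivity)
    zero_le_one (by positivity)
    (fun u hu => by
      rw [hΘper u hu, h.periodic])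
    (fun u hu => by
      have e : (ℓ : ℝ) * (u + q) = ℓ * u + ((3 * (m * ℓ) : ℕ) : ℝ) := by
        rw [hq]; push_cast; ring
      rw [e, interp_shift V _ (by positivity)]; simp only [hV3])
    (fun u u' hu huu => (hxL u u' hu huu).trans (by
      have : 0 ≤ D * B * ℓ * (u' - u) := mul_nonneg (by positivity) (sub_nonneg.2 huu)
      linarith))
    (fun u u' hu huu => (hyL u u' hu huu).trans (by
      have : 0 ≤ R * (K * δ) * (u' - u) := mul_nonneg (by positivity) (sub_nonneg.2 huu)
      linarith))
    (fun u hu => by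
      have h1 := Nat.floor_le hu
      have h2 := Nat.lt_floor_add_one u
      set j := ⌊u⌋₊
      have h3 := hxL j u (Nat.cast_nonneg j) h1
      have h4 := hyL j u (Nat.cast_nonneg j) h1
      have h5 : interp V (ℓ * j) - R • γ (Θ j) = ((D : ℝ) * ℓ) •
          ((Z j - (Q : ℝ) • γ (τ j)) + (1 / 2 : ℝ) • (Z (j + 1) - Z j)) := by
        have e1 : interp V (ℓ * j) = V (ℓ * j) := by exact_mod_cast interp_natCast V (ℓ * j)
        have e2 : ((D / 2 * ℓ : ℕ) : ℝ) = (D : ℝ) * ℓ / 2 := by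
          have : 2 * (D / 2 * ℓ) = D * ℓ := by
            rw [← mul_assoc, Nat.two_mul_div_two_of_even hDe]
          have h6 : (2 : ℝ) * ((D / 2 * ℓ : ℕ) : ℝ) = D * ℓ := by exact_mod_cast this
          linarith
        rw [e1, hΘnat, hV, bevel, ← hℓ, Nat.mul_div_cancel_left _ hℓ0, Nat.mul_mod_right, e2, hR]
        simp only [zero_mul, Finset.range_zero, Finset.sum_empty, Nat.cast_zero, sub_self,
          zero_smul, add_zero]
        module
      have h6 : interp V (ℓ * u) - R • γ (Θ u) = (interp V (ℓ * u) - interp V (ℓ * j)) +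
        (interp V (ℓ * j) - R • γ (Θ j)) - (R • γ (Θ u) - R • γ (Θ j)) := by abel
      have h7 : ‖interp V (ℓ * j) - R • γ (Θ j)‖ ≤ D * ℓ * (4 + B / 2) := by
        rw [h5, norm_smul, Real.norm_of_nonneg (by positivity)]
        refine mul_le_mul_of_nonneg_left ((norm_add_le _ _).trans (add_le_add (hZ j).2 ?_))
          (by positivity)
        rw [norm_smul, Real.norm_of_nonneg (by norm_num)]
        linarith [hZB j]
      rw [h6]
      refine (norm_sub_le _ _).trans ((add_le_add (norm_add_le _ _) le_rfl).trans ?_)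
      have h8 : u - j ≤ 1 := by linarith
      have h9 : D * B * ℓ * (u - j) ≤ D * B * ℓ * 1 := mul_le_mul_of_nonneg_left h8 (by positivity)
      have h10 : R * (K * δ) * (u - j) ≤ R * (K * δ) * 1 :=
        mul_le_mul_of_nonneg_left h8 (by positivity)
      -- Since `B = Q * K * δ + 8`, the left side is `(5 / 2) * Q * K * δ + 16`; each of the two
      -- terms is at most `Q * μ / 8`.
      have h11 : B + (4 + B / 2) + Q * (K * δ) ≤ Q * μ / 4 := by
        have := mul_le_mul_of_nonneg_left hδμ hQ0.le
        linarith
      have h12 := mul_le_mul_of_nonneg_left h11 (show 0 ≤ (D : ℝ) * ℓ by positivity)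
      have h13 : (D : ℝ) * ℓ * (Q * μ / 4) = R * μ / 4 := by rw [hR]; ring
      have h14 : (D : ℝ) * ℓ * (Q * (K * δ)) = R * (K * δ) := by rw [hR]; ring
      linarith)
    (fun u u' hu huu hup => by
      have hu' := hu.trans huu.le
      rcases le_or_gt (Θ u' - Θ u) (r / 2) with h1 | h1
      · exact Or.inl (near u u' hu huu.le h1)
      refine Or.inr ?_
      rcases le_or_gt (Θ u + p - Θ u') (r / 2) with h2 | h2
      · exact Or.inl (near u' (u + q) hu' (by linarith) (by rwa [hΘper u hu]))
      refine Or.inr ?_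
      have h3 : Θ u ≤ p := by
        have := hΘle u q hu (by linarith)
        have h0 := hΘper 0 le_rfl
        have h00 := hΘnat 0
        simp only [Nat.cast_zero] at h00
        rw [h00, hτ0, zero_add, zero_add] at h0
        linarith
      have h4 : 0 ≤ Θ u := by
        have := hΘle 0 u le_rfl hu
        have h00 := hΘnat 0
        simp only [Nat.cast_zero] at h00
        linarith
      have := hsep (Θ u) (Θ u') h4 h3 h1.le (by linarith)
      rw [← smul_sub, norm_smul, Real.norm_of_nonneg hR0.le]
      exact mul_le_mul_of_nonneg_left this hR0.le)
  have hℓr : (0 : ℝ) < ℓ := by linarith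
  have hqℓ : ((3 * (m * ℓ) : ℕ) : ℝ) = ℓ * q := by rw [hq]; push_cast; ring
  have hV0 : V (3 * (m * ℓ)) = V 0 := by simpa using hV3 0
  have himg : (fun t => (ℓ : ℝ) * t) '' Ico 0 q = Ico 0 ((3 * (m * ℓ) : ℕ) : ℝ) := by
    rw [hqℓ]
    have := image_mul_left_Ico hℓr 0 q
    rwa [mul_zero] at this
  have h3mℓ : 3 ≤ 3 * (m * ℓ) := by
    have : 0 < m * ℓ := Nat.mul_pos hm hℓ0
    omega
  have hsimple : IsSimpleClosedPolygon (3 * (m * ℓ)) V := by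
    refine ⟨h3mℓ, hV0, fun u hu u' hu' huu => ?_⟩
    rw [polygonPath_eq_interp _ hu.1, polygonPath_eq_interp _ hu'.1] at huu
    rw [← himg] at hu hu'
    obtain ⟨t, ht, rfl⟩ := hu
    obtain ⟨t', ht', rfl⟩ := hu'
    rw [hinj ht ht' huu]
  refine ⟨m * ℓ, V, isLatticeLoop_bevel hm hρ0 hDe (fun k => (hZ k).1) hZρ hdvd hne hsimple, ?_⟩
  have e2 : (fun t => interp V (ℓ * t)) '' Ico 0 q = polygon (3 * (m * ℓ)) V := by
    rw [polygon_eq_image_interp _ _ (by omega) hV0, ← himg, image_image]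
  have e3 : Θ '' Ico 0 q = Ico 0 p := by
    rw [hq, hΘ, interp_image_Ico hτmono]
    have h1 := hτ3 0
    rw [zero_add, hτ0, zero_add] at h1
    rw [hτ0, h1]
  have e1 : (fun t => R • γ (Θ t)) '' Ico 0 q = (R • LinearMap.id : E3 →ₗ[ℝ] E3) '' range γ := by
    rw [Function.Periodic.range_eq_image_Ico h.pos h.periodic, ← e3, image_image, image_image]
    rfl
  rw [e1, e2] at hiso
  refine (ambientIsotopic_linear _ ?_ _).trans hiso
  rw [LinearMap.det_smul]; simp; positivity

end IsMonotoneLoop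

/-! ### Orientation of isometries -/

/-- The determinant of the linear part of an isometry. -/
noncomputable def isoDet (f : E3 ≃ᵃⁱ[ℝ] E3) : ℝ :=
  LinearMap.det (f.linearIsometryEquiv.toLinearEquiv : E3 →ₗ[ℝ] E3)

theorem isoDet_mul (f g : E3 ≃ᵃⁱ[ℝ] E3) : isoDet (f * g) = isoDet f * isoDet g := by
  rw [isoDet, isoDet, isoDet, ← LinearMap.det_comp]
  rfl

theorem isoDet_ne_zero (f : E3 ≃ᵃⁱ[ℝ] E3) : isoDet f ≠ 0 :=
  (LinearEquiv.isUnit_det' f.linearIsometryEquiv.toLinearEquiv).ne_zero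

theorem isoDet_eq_of_matrix {f : E3 ≃ᵃⁱ[ℝ] E3} (M : Matrix (Fin 3) (Fin 3) ℝ)
    (h : ∀ x, f x - f 0 = Matrix.toEuclideanLin M x) : isoDet f = M.det := by
  have e : (f.linearIsometryEquiv.toLinearEquiv : E3 →ₗ[ℝ] E3) = Matrix.toEuclideanLin M := by
    ext1 x
    rw [← h, isometry_apply f x]
    simp
  rw [isoDet, e, Matrix.toEuclideanLin_eq_toLin_orthonormal, LinearMap.det_toLin]

theorem isoDet_stdReflection_neg (s : Color) : isoDet (stdReflection s) < 0 := by
  rcases color_cases s with rfl | rfl | rfl | rfl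
  · rw [isoDet_eq_of_matrix !![0, -1, 0; -1, 0, 0; 0, 0, 1]]
    · simp [Matrix.det_fin_three]
    · intro x
      ext j
      fin_cases j <;> simp [stdReflection_zero, Matrix.toLpLin_apply, dotProduct,
        Fin.sum_univ_three]
  · rw [isoDet_eq_of_matrix !![0, 1, 0; 1, 0, 0; 0, 0, 1]]
    · simp [Matrix.det_fin_three]
    · intro x
      ext j
      fin_cases j <;> simp [stdReflection_one, Matrix.toLpLin_apply, dotProduct,
        Fin.sum_univ_three]
  · rw [isoDet_eq_of_matrix !![1, 0, 0; 0, 0, 1; 0, 1, 0]]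
    · simp [Matrix.det_fin_three]
    · intro x
      ext j
      fin_cases j <;> simp [stdReflection_two, Matrix.toLpLin_apply, dotProduct,
        Fin.sum_univ_three]
  · rw [isoDet_eq_of_matrix !![1, 0, 0; 0, 1, 0; 0, 0, -1]]
    · simp [Matrix.det_fin_three]
    · intro x
      ext j
      fin_cases j <;> simp [stdReflection_three, Matrix.toLpLin_apply, dotProduct,
        Fin.sum_univ_three]

/-! ### Moving an axis into standard position -/

/-- The isometry carries one orthonormal frame to the other; it may reverse orientation. -/
theorem exists_isometry_conj (o o' : E3) (b b' : OrthonormalBasis (Fin 3) ℝ E3) :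
    ∃ U : E3 ≃ᵃⁱ[ℝ] E3, ∀ θ x, U (rotationAbout o b θ x) = rotationAbout o' b' θ (U x) := by
  set A : E3 ≃ₗᵢ[ℝ] E3 := b.equiv b' (Equiv.refl _) with hA
  have hAb : ∀ i, A (b i) = b' i := fun i => by simp [hA]
  have hin : ∀ i x, inner ℝ (b' i) (A x) = inner ℝ (b i) x := fun i x => by
    rw [← hAb, LinearIsometryEquiv.inner_map_map]
  refine ⟨translation (o' - A o) * A.toAffineIsometryEquiv, fun θ x => ?_⟩
  have hU : ∀ x, (translation (o' - A o) * A.toAffineIsometryEquiv) x = o' - A o + A x :=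
    fun _ => rfl
  rw [hU, hU, rotationAbout, rotationAbout,
    show o' - A o + A x - o' = A (x - o) by rw [map_sub]; abel]
  simp only [map_add, map_smul, hAb, hin]
  abel

/-- The rotation permuting the coordinates cyclically. -/
theorem exists_cyclic : ∃ ρ : E3 ≃ᵃⁱ[ℝ] E3, IsSym ρ ∧ ρ 0 = 0 ∧ ρ ^ 3 = 1 ∧ ρ ≠ 1 ∧
    (∀ x, ρ (-x) = -ρ x) ∧ ∃ u, ∀ x, ρ x = x → ∃ c : ℝ, x = c • u := by
  obtain ⟨ρ, hρ⟩ := exists_isometry_of_signs 0 (finRotate 3) 1 (fun _ => Or.inl rfl)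
  have h0 : ∀ x, ρ x 0 = x 1 := fun x => by rw [hρ]; simp
  have h1 : ∀ x, ρ x 1 = x 2 := fun x => by rw [hρ]; simp
  have h2 : ∀ x, ρ x 2 = x 0 := fun x => by rw [hρ]; simp
  refine ⟨ρ, ⟨0, finRotate 3, 1, fun _ => Or.inl rfl, by simp, hρ⟩, ?_, ?_, ?_, ?_,
    !₂[1, 1, 1], ?_⟩
  · ext j; fin_cases j <;> simp [h0, h1, h2]
  · ext x j
    change ρ (ρ (ρ x)) j = x j
    fin_cases j <;> simp [h0, h1, h2]
  · intro h
    have := h0 !₂[1, 0, 0]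
    rw [h] at this
    simp at this
  · intro x
    ext j; fin_cases j <;> simp [h0, h1, h2]
  · intro x hx
    have e0 := h0 x
    have e1 := h1 x
    rw [hx] at e0 e1
    refine ⟨x 0, ?_⟩
    ext j; fin_cases j <;> simp [e0, e1]

/-- The point reflection in the origin. -/
noncomputable def pointReflectionZero : E3 ≃ᵃⁱ[ℝ] E3 :=
  (LinearIsometryEquiv.neg ℝ : E3 ≃ₗᵢ[ℝ] E3).toAffineIsometryEquiv

theorem isoDet_pointReflectionZero_neg : isoDet pointReflectionZero < 0 := by
  have e : (pointReflectionZero.linearIsometryEquiv.toLinearEquiv : E3 →ₗ[ℝ] E3) =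
      (-1 : ℝ) • LinearMap.id := by
    ext1 x; simp [pointReflectionZero]
  rw [isoDet, e, LinearMap.det_smul]
  simp
  norm_num

/-- The two rotations by 120° are conjugate by an isometry. If it reverses orientation, it is
composed with the point reflection in the origin, which commutes with `ρ`; so the knot type is not
mirrored. -/
theorem exists_monotoneLoop_of_symmetric {K : Set E3} (h : HasThreefoldRotationalSymmetry K)
    {ρ : E3 ≃ᵃⁱ[ℝ] E3} (hord : orderOf ρ = 3) (hneg : ∀ x, ρ (-x) = -ρ x) :
    ∃ (p : ℝ) (γ : ℝ → E3), IsMonotoneLoop p γ ∧ ρ '' range γ = range γ ∧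
      AmbientIsotopic K (range γ) := by
  obtain ⟨L, ⟨n, γ, hγ, rfl⟩, hKL, o, b, hrot⟩ := h
  obtain ⟨o', b', hρ⟩ := exists_rotationAbout_of_orderOf_eq_three ρ hord
  obtain ⟨U, hdet, hU⟩ : ∃ U : E3 ≃ᵃⁱ[ℝ] E3, 0 < isoDet U ∧
      ∀ x, U (rotationAbout o b (2 * Real.pi / 3) x) = ρ (U x) := by
    obtain ⟨U, hU⟩ := exists_isometry_conj o o' b b'
    have hU' : ∀ x, U (rotationAbout o b (2 * Real.pi / 3) x) = ρ (U x) := fun x => by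
      rw [hU, hρ]
    rcases lt_or_gt_of_ne (isoDet_ne_zero U) with hneg' | hpos
    · refine ⟨pointReflectionZero * U, ?_, fun x => ?_⟩
      · rw [isoDet_mul]
        exact mul_pos_of_neg_of_neg isoDet_pointReflectionZero_neg hneg'
      · change -U _ = ρ (-U x)
        rw [hU', hneg]
    · exact ⟨U, hpos, hU'⟩
  have hrange : range (fun t => U (γ t)) = U '' range γ := range_comp U γ
  refine ⟨n, fun t => U (γ t), hγ.isMonotoneLoop.comp_isometry U, ?_, ?_⟩
  · rw [hrange, image_image]
    simp only [← hU]
    rw [← image_image U (rotationAbout o b (2 * Real.pi / 3)), hrot]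
  · rw [hrange]
    exact hKL.trans (ambientIsotopic_isometry U hdet _)

/-! ### From galleries to words -/

theorem isSimpleClosedPolygon_succ {n : ℕ} {a : ℕ → E3} (ha : ∀ i, a (i + n) = a i)
    (h : IsSimpleClosedPolygon n a) : IsSimpleClosedPolygon n (fun i => a (i + 1)) := by
  have h3 : (3 : ℝ) ≤ n := by exact_mod_cast h.1
  refine ⟨h.1, by simpa [add_comm] using ha 1, fun u hu u' hu' huu => ?_⟩
  have key : ∀ u ∈ Ico (0 : ℝ) n, ∃ v ∈ Ico (0 : ℝ) n, (v = u + 1 ∨ v + n = u + 1) ∧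
      polygonPath (fun i => a (i + 1)) u = polygonPath a v := by
    intro u hu
    have e : polygonPath (fun i => a (i + 1)) u = interp a (u + 1) := by
      have := interp_shift a 1 hu.1
      rw [Nat.cast_one] at this
      rw [this, polygonPath_eq_interp _ hu.1]
    rcases lt_or_ge (u + 1) n with h1 | h1
    · exact ⟨u + 1, ⟨by linarith [hu.1], h1⟩, Or.inl rfl, by
        rw [e, polygonPath_eq_interp _ (by linarith [hu.1])]⟩
    · refine ⟨u + 1 - n, ⟨by linarith, by linarith [hu.2]⟩, Or.inr (by ring), ?_⟩
      have := interp_shift a n (t := u + 1 - n) (by linarith)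
      simp only [ha, sub_add_cancel] at this
      rw [e, this, polygonPath_eq_interp _ (by linarith)]
  obtain ⟨v, hv, h1, e1⟩ := key u hu
  obtain ⟨v', hv', h1', e1'⟩ := key u' hu'
  have hvv : v = v' := h.2.2 hv hv' (by rw [← e1, ← e1', huu])
  subst hvv
  rcases h1 with h1 | h1 <;> rcases h1' with h1' | h1'
  · linarith
  · linarith [hu.1, hu.2, hu'.1, hu'.2]
  · linarith [hu.1, hu.2, hu'.1, hu'.2]
  · linarith

/-- The isometry `g * H⁻¹` carries the given gallery to the one with the same letters starting at
the prescribed pyramid, and conjugates `ρ` into the symmetry of the word. Preserving orientation, it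
does not change the knot type. -/
theorem exists_word_of_isoDet_pos {K : Set E3} {g ρ H : E3 ≃ᵃⁱ[ℝ] E3} {s : ℕ → Color} {k : ℕ}
    (hρ : orderOf ρ = 3) (hs : ∀ i, s (i + k) = s i)
    (hH : H * letterProd stdPyramid s k = ρ * H)
    (hsimple : IsSimpleClosedPolygon (3 * k) fun i => (H * letterProd stdPyramid s i) stdCenter)
    (hK : AmbientIsotopic K
      (polygon (3 * k) fun i => (H * letterProd stdPyramid s i) stdCenter))
    (hdet : 0 < isoDet (g * H⁻¹)) :
    IsRepresentedByWord (fun c => g (stdPyramid c)) ((List.range k).map s) K := by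
  set P : Color → E3 := fun c => g (stdPyramid c) with hP
  set Y : ℕ → E3 := fun i => (H * letterProd stdPyramid s i) stdCenter with hY
  have hprod : ∀ i, letterProd P s i = g * letterProd stdPyramid s i * g⁻¹ := by
    intro i
    induction i with
    | zero => simp [letterProd]
    | succ i ih => rw [letterProd, letterProd, ih, hP, wallReflection_comp]; group
  have hcenter : ∀ i ≤ 3 * k, (g * H⁻¹) (Y i) = center (galleryPyramid P
      ((List.range k).map s ++ (List.range k).map s ++ (List.range k).map s) i) := by
    intro i hi
    rw [galleryPyramid_of_periodic P hs hi, center_comp, hprod, hP, center_comp, center_stdPyramid]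
    have e1 : g * H⁻¹ * (H * letterProd stdPyramid s i) =
        g * letterProd stdPyramid s i * g⁻¹ * g := by group
    exact congrArg (fun f : E3 ≃ᵃⁱ[ℝ] E3 => f stdCenter) e1
  have hword : wordSymmetry P ((List.range k).map s) = (g * H⁻¹) * ρ * (g * H⁻¹)⁻¹ := by
    have e1 : letterProd stdPyramid s k = H⁻¹ * (ρ * H) := by rw [← hH]; group
    rw [wordSymmetry_map_range, hprod, e1]
    group
  have hpath : ∀ t, 0 ≤ t → polygonPath (fun i => (g * H⁻¹) (Y i)) t =
      (g * H⁻¹) (polygonPath Y t) := fun t ht => by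
    rw [polygonPath_eq_interp _ ht, polygonPath_eq_interp _ ht]
    exact (map_interp ((g * H⁻¹).toAffineEquiv : E3 →ᵃ[ℝ] E3) Y t).symm
  have hn : 0 < 3 * k := by have := hsimple.1; omega
  have hY0 : Y (3 * k) = Y 0 := hsimple.2.1
  rw [IsRepresentedByWord, List.length_map, List.length_range]
  refine ⟨?_, IsSimpleClosedPolygon.congr hcenter ⟨hsimple.1, by simp only [hY0], ?_⟩, ?_⟩
  · rw [hword]
    exact (orderOf_injective (MulAut.conj (g * H⁻¹)).toMonoidHom
      (MulAut.conj (g * H⁻¹)).injective ρ).trans hρ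
  · intro u hu u' hu' huu
    rw [hpath u hu.1, hpath u' hu'.1] at huu
    exact hsimple.2.2 hu hu' ((g * H⁻¹).injective huu)
  · rw [← polygon_congr hcenter]
    have e : polygon (3 * k) (fun i => (g * H⁻¹) (Y i)) = (g * H⁻¹) '' polygon (3 * k) Y := by
      rw [polygon_eq_image_interp _ _ hn hY0, polygon_eq_image_interp _ _ hn (by simp only [hY0]),
        image_image]
      refine image_congr fun t _ => ?_
      exact (map_interp ((g * H⁻¹).toAffineEquiv : E3 →ᵃ[ℝ] E3) Y t).symm
    rw [e]
    exact hK.trans (ambientIsotopic_isometry _ hdet _)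

/-- Neighbouring pyramids are mirror images of each other. If `g * H⁻¹` reverses orientation, the
closed gallery is therefore started at its second pyramid: the letters are permuted cyclically, the
polygon is the same, and the isometry to the prescribed pyramid now preserves orientation. -/
theorem exists_word {K : Set E3} {g ρ H : E3 ≃ᵃⁱ[ℝ] E3} {s : ℕ → Color} {k : ℕ}
    (hρ : orderOf ρ = 3) (hs : ∀ i, s (i + k) = s i)
    (hH : H * letterProd stdPyramid s k = ρ * H)
    (hsimple : IsSimpleClosedPolygon (3 * k) fun i => (H * letterProd stdPyramid s i) stdCenter)
    (hK : AmbientIsotopic K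
      (polygon (3 * k) fun i => (H * letterProd stdPyramid s i) stdCenter)) :
    ∃ w, IsRepresentedByWord (fun c => g (stdPyramid c)) w K := by
  rcases lt_or_gt_of_ne (isoDet_ne_zero (g * H⁻¹)) with hneg | hpos
  · have hn : 0 < 3 * k := by have := hsimple.1; omega
    have hk : ∀ i, H * letterProd stdPyramid s (i + k) = ρ * (H * letterProd stdPyramid s i) :=
      fun i => by rw [letterProd_add_of_periodic _ hs, ← mul_assoc, hH, mul_assoc]
    have hρ3 : ρ ^ 3 = 1 := by
      have := pow_orderOf_eq_one ρ
      rwa [hρ] at this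
    have hper : ∀ i, (H * letterProd stdPyramid s (i + 3 * k)) stdCenter =
        (H * letterProd stdPyramid s i) stdCenter := fun i => by
      rw [show i + 3 * k = i + k + k + k by ring, hk, hk, hk]
      rw [show ρ * (ρ * (ρ * (H * letterProd stdPyramid s i))) =
        ρ ^ 3 * (H * letterProd stdPyramid s i) by rw [pow_succ, pow_two]; simp only [mul_assoc],
        hρ3, one_mul]
    have hone : letterProd stdPyramid s 1 = stdReflection (s 0) := by
      rw [letterProd, letterProd, one_mul]; rfl
    have hsucc : ∀ i, H * stdReflection (s 0) * letterProd stdPyramid (fun i => s (i + 1)) i =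
        H * letterProd stdPyramid s (i + 1) := fun i => by
      rw [add_comm i 1, letterProd_add, hone, mul_assoc]
      simp only [add_comm 1]
    refine ⟨_, exists_word_of_isoDet_pos (H := H * stdReflection (s 0))
      (s := fun i => s (i + 1)) (k := k) hρ (fun i => ?_) ?_ ?_ ?_ ?_⟩
    · rw [add_right_comm, hs]
    · rw [hsucc, add_comm k 1, hk, letterProd, letterProd, one_mul]; rfl
    · simp only [hsucc]
      exact isSimpleClosedPolygon_succ hper hsimple
    · simp only [hsucc]
      have e : polygon (3 * k) (fun i => (H * letterProd stdPyramid s (i + 1)) stdCenter) =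
          polygon (3 * k) (fun i => (H * letterProd stdPyramid s i) stdCenter) :=
        polygon_shift (c := fun i => (H * letterProd stdPyramid s i) stdCenter) hn hper 1
      rwa [e]
    -- The new isometry differs from the old one by a conjugate of a reflection, which changes the
    -- sign of the determinant.
    · have e : g * (H * stdReflection (s 0))⁻¹ = g * H⁻¹ * (H * stdReflection (s 0) * H⁻¹) := by
        have := stdReflection_mul_self (s 0)
        rw [mul_inv_rev, inv_eq_of_mul_eq_one_left this]; group
      have e2 : isoDet H * isoDet H⁻¹ = 1 := by
        rw [← isoDet_mul, mul_inv_cancel]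
        simpa using isoDet_eq_of_matrix (f := 1) 1 (fun x => by simp)
      have e3 : isoDet (H * stdReflection (s 0) * H⁻¹) = isoDet (stdReflection (s 0)) := by
        rw [isoDet_mul, isoDet_mul, mul_right_comm, e2, one_mul]
      rw [e, isoDet_mul, e3]
      exact mul_pos_of_neg_of_neg hneg (isoDet_stdReflection_neg _)
  · exact ⟨_, exists_word_of_isoDet_pos hρ hs hH hsimple hK hpos⟩

theorem HasThreefoldRotationalSymmetry.exists_word {K : Set E3}
    (h : HasThreefoldRotationalSymmetry K) {P : Color → E3} (hP : IsPyramid P) :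
    ∃ w, IsRepresentedByWord P w K := by
  obtain ⟨ρ, hsym, h0, h3, h1, hneg, hline⟩ := exists_cyclic
  have hord : ∀ f : E3 ≃ᵃⁱ[ℝ] E3, f ^ 3 = 1 → f ≠ 1 → orderOf f = 3 := fun f h3 h1 => by
    have : Fact (Nat.Prime 3) := ⟨Nat.prime_three⟩
    exact orderOf_eq_prime h3 h1
  obtain ⟨p, γ, hγ, hργ, hK⟩ := exists_monotoneLoop_of_symmetric h (hord ρ h3 h1) hneg
  obtain ⟨ρ', hρ', φ, hφ, hφm, hφ3, hγφ⟩ := hγ.exists_equivariant_lift hργ h3 hline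
  obtain ⟨hsym', h0', h3', h1'⟩ : IsSym ρ' ∧ ρ' 0 = 0 ∧ ρ' ^ 3 = 1 ∧ ρ' ≠ 1 := by
    rcases hρ' with rfl | rfl
    · exact ⟨hsym, h0, h3, h1⟩
    · refine ⟨hsym.pow 2, IsLatticeLoop.pow_fixed h0 2, ?_, fun h2 => h1 ?_⟩
      · rw [← pow_mul, mul_comm, pow_mul, h3, one_pow]
      · rwa [pow_succ, h2, one_mul] at h3
  obtain ⟨m, V, hV, hiso⟩ := hγ.exists_latticeLoop hsym' h0' h3' hφ hφm hφ3 hγφ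
  obtain ⟨H, s, k, -, -, hs, hH, hsimple, hiso'⟩ := hV.exists_gallery hsym' h0' h3'
  obtain ⟨g, -, rfl⟩ := hP.exists_sym
  exact ThreefoldKnots.exists_word (hord ρ' h3' h1') hs hH hsimple
    (hK.trans (hiso.trans hiso'))

end ThreefoldKnots

theorem proposition3p1 (K : Set ThreefoldKnots.E3) (hK : ThreefoldKnots.IsTameKnot K)
    (P : ThreefoldKnots.Color → ThreefoldKnots.E3) (hP : ThreefoldKnots.IsPyramid P) :
    ThreefoldKnots.HasThreefoldRotationalSymmetry K ↔
      ∃ w : List ThreefoldKnots.Color, ThreefoldKnots.IsRepresentedByWord P w K := by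
  exact ⟨fun h => h.exists_word hP, fun ⟨_, hw⟩ => hw.hasThreefoldRotationalSymmetry⟩
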